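/- Let $X_1,X_2,\dots$ be i.i.d. random variables with distribution function $F$ and with $X_i\ge 1$. Write $F^-(u)=\inf\{x: F(x)\ge u\}$, $U(t)=F^-(1-1/t)$, and $x_p=F^-(1-p)$ for $p\in(0,1)$. Assume that there are $\gamma>0$, $\rho<0$ and a measurable function $A$ with $A(t)\to0$ as $t\to\infty$ such that $$\lim_{t\to\infty}\frac{U(tx)/U(t)-x^\gamma}{A(t)}=x^\gamma\,\frac{x^\rho-1}{\rho}\qquad\text{for all }x>0 .$$ Let $k_n$ be nonnegative integers and $m_n=\lfloor n/k_n\rfloor$ (when $k_n\geq 1$), with $k_n\to\infty$, $m_n\to\infty$ and $k_n^{1/2}A(m_n)\to0$ as $n\to\infty$. Let $p_n\in(0,1)$ satisfy $m_np_n\to0$ and $\log(m_np_n)=o(k_n^{1/2})$. Let $r\ge1$ be a fixed integer, and let $a_n$ be real constants with $a_n=o(k_n^{2/3})$. For $1\le i\le k_n$ let $X^{(i)}_{m_n,1}\ge\dots\ge X^{(i)}_{m_n,m_n}$ be the order statistics of the $i$-th block $X_{(i-1)m_n+1},\dots,X_{im_n}$. With $a(m,r,p)=\sum_{j=r+1}^m\frac1j+\log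 p$, put, for $1\le j\le r$, $1\le i\le k_n$, $$z^{(i)}_j(y)=j\bigl(\log X^{(i)}_{m_n,j}-\log X^{(i)}_{m_n,j+1}\bigr)-\frac{1}{a(m_n,r,p_n)}\bigl(\log X^{(i)}_{m_n,r+1}-y\bigr),\qquad z(y)=-\frac{a_n}{k_nr}\sum_{i=1}^{k_n}\sum_{j=1}^r z^{(i)}_j(y).$$ Define the adjusted empirical log-likelihood ratio statistic by $$\mathcal{AL}(y)=2\sum_{i=1}^{k_n}\sum_{j=1}^r\log\{1+\lambda z^{(i)}_j(y)\}+2\log\{1+\lambda z(y)\},$$ where $\lambda$ is a solution of $$\sum_{i=1}^{k_n}\sum_{j=1}^r\frac{z^{(i)}_j(y)}{1+\lambda z^{(i)}_j(y)}+\frac{z(y)}{1+\lambda z(y)}=0$$ for which $1+\lambda z(y)>0$ and $1+\lambda z^{(i)}_j(y)>0$ for all $i,j$ (the value does not depend on the choice of such a $\lambda$), and $\mathcal{AL}(y)=\infty$ if there is no such $\lambda$. Then, with $y_0=\log x_{p_n}$, $$\mathcal{AL}(y_0)\stackrel{d}{\to}\chi^2_1\qquad(n\to\infty),$$ where $\chi^2_1$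 denotes a chi-squared random variable with one degree of freedom. -/

import Mathlib

open Filter Topology MeasureTheory ProbabilityTheory

namespace BlockQuantile

noncomputable section

/-- Generalized inverse `F⁻(u) = inf {x : F x ≥ u}` of a distribution function. -/
def genInv (F : ℝ → ℝ) (u : ℝ) : ℝ := sInf {x : ℝ | u ≤ F x}

/-- `U(t) = F⁻(1 - 1/t)`. -/
def tailQuantile (F : ℝ → ℝ) (t : ℝ) : ℝ := genInv F (1 - 1 / t)

/-- The high quantile `x_p`, that is, the `(1 - p)`-th quantile of `F`. -/
def highQuantile (F : ℝ → ℝ) (p : ℝ) : ℝ := genInv F (1 - p)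

/-- The second-order regular variation condition on `U`, with auxiliary function `A`:
`A` is measurable, `A(t) → 0`, and
`(U(tx)/U(t) - x^γ) / A(t) → x^γ (x^ρ - 1)/ρ` as `t → ∞`, for all `x > 0`. -/
structure SecondOrder (F : ℝ → ℝ) (γ ρ : ℝ) (A : ℝ → ℝ) : Prop where
  measurable : Measurable A
  tendsto_zero : Tendsto A atTop (𝓝 0)
  tendsto_ratio : ∀ x : ℝ, 0 < x →
    Tendsto (fun t : ℝ =>
        (tailQuantile F (t * x) / tailQuantile F t - x ^ γ) / A t)
      atTop (𝓝 (x ^ γ * ((x ^ ρ - 1) / ρ)))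

/-- The `j`-th largest entry (`1 ≤ j ≤ m`) of a vector of length `m`; the value is `0` if `j` is
outside this range. -/
def descOrderStat {m : ℕ} (v : Fin m → ℝ) (j : ℕ) : ℝ :=
  if h : 1 ≤ j ∧ j ≤ m then v (Tuple.sort v ⟨m - j, by omega⟩) else 0

/-- `X_{m,j}^{(i)}`: the `j`-th largest of the `m` observations in the `i`-th block. Observations
and blocks are numbered from `0`: the `i`-th block is `x (i m), …, x (i m + m - 1)`. -/
def blockOrderStat (x : ℕ → ℝ) (m i j : ℕ) : ℝ :=
  descOrderStat (fun l : Fin m => x (i * m + l)) j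

/-- `a(m,r,p) = ∑_{j=r+1}^m 1/j + log p`. -/
def aCoef (m r : ℕ) (p : ℝ) : ℝ :=
  (∑ j ∈ Finset.Icc (r + 1) m, (1 : ℝ) / (j : ℝ)) + Real.log p

/-- `z_j^{(i)}(y)`, for `1 ≤ j ≤ r`. -/
def zData (x : ℕ → ℝ) (m r : ℕ) (p y : ℝ) (i j : ℕ) : ℝ :=
  (j : ℝ) * (Real.log (blockOrderStat x m i j) - Real.log (blockOrderStat x m i (j + 1)))
    - 1 / aCoef m r p * (Real.log (blockOrderStat x m i (r + 1)) - y)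

/-- The pseudo-data point `z(y) = -(a/(k r)) ∑_{i ≤ k} ∑_{j ≤ r} z_j^{(i)}(y)`. -/
def pseudoPoint (x : ℕ → ℝ) (k m r : ℕ) (p a y : ℝ) : ℝ :=
  -(a / ((k : ℝ) * (r : ℝ))) *
    ∑ i ∈ Finset.range k, ∑ j ∈ Finset.Icc 1 r, zData x m r p y i j

/-- The `k r + 1` data points: the `z_j^{(i)}(y)`, and the pseudo-point (at index `none`). -/
def adjustedData (x : ℕ → ℝ) (k m r : ℕ) (p a y : ℝ) : Option (Fin k × Fin r) → ℝ
  | none => pseudoPoint x k m r p a y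
  | some (i, j) => zData x m r p y i (j + 1)

/-- `lam` solves the Lagrange multiplier equation `∑ z/(1 + lam z) = 0` of empirical likelihood,
and the resulting weights `(1/N) (1 + lam z)⁻¹` are (finite and) nonnegative. -/
def IsMultiplier {ι : Type*} [Fintype ι] (z : ι → ℝ) (lam : ℝ) : Prop :=
  (∀ s, 0 < 1 + lam * z s) ∧ ∑ s, z s / (1 + lam * z s) = 0

open Classical in
/-- The empirical log-likelihood ratio statistic `2 ∑ log (1 + lam z)` of the data points `z` for
mean zero, where `lam` is the Lagrange multiplier; it is `∞` if there is no multiplier. -/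
def empLogLR {ι : Type*} [Fintype ι] (z : ι → ℝ) : EReal :=
  if h : ∃ lam : ℝ, IsMultiplier z lam then
    ((2 * ∑ s, Real.log (1 + h.choose * z s) : ℝ) : EReal)
  else ⊤

/-- The statistic does not depend on the choice of the multiplier. -/
theorem empLogLR_eq {ι : Type*} [Fintype ι] {z : ι → ℝ} {lam : ℝ} (h : IsMultiplier z lam) :
    empLogLR z = ((2 * ∑ s, Real.log (1 + lam * z s) : ℝ) : EReal) := by
  have hex : ∃ lam : ℝ, IsMultiplier z lam := ⟨lam, h⟩
  have hc : IsMultiplier z hex.choose := hex.choose_spec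
  rw [empLogLR, dif_pos hex]
  generalize hex.choose = mu at hc
  by_cases hne : mu = lam
  · rw [hne]
  have key : ∑ s, z s ^ 2 / ((1 + mu * z s) * (1 + lam * z s)) = 0 := by
    have h1 : (lam - mu) * ∑ s, z s ^ 2 / ((1 + mu * z s) * (1 + lam * z s)) = 0 := by
      calc (lam - mu) * ∑ s, z s ^ 2 / ((1 + mu * z s) * (1 + lam * z s))
          = ∑ s, (z s / (1 + mu * z s) - z s / (1 + lam * z s)) := by
            rw [Finset.mul_sum]
            refine Finset.sum_congr rfl fun s _ => ?_
            have := (hc.1 s).ne'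
            have := (h.1 s).ne'
            field_simp
            ring
        _ = 0 := by rw [Finset.sum_sub_distrib, hc.2, h.2, sub_zero]
    rcases mul_eq_zero.1 h1 with h2 | h2
    · exact absurd (by linarith) hne
    · exact h2
  have hz : ∀ s, z s = 0 := by
    intro s
    have h3 := (Finset.sum_eq_zero_iff_of_nonneg (fun s _ =>
      div_nonneg (sq_nonneg (z s)) (mul_pos (hc.1 s) (h.1 s)).le)).1 key s (Finset.mem_univ s)
    rcases div_eq_zero_iff.1 h3 with h4 | h4
    · exact pow_eq_zero_iff (two_ne_zero) |>.1 h4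
    · exact absurd h4 (mul_pos (hc.1 s) (h.1 s)).ne'
  simp [hz]

/-- The adjusted empirical log-likelihood ratio statistic `AL(y)`. -/
def adjustedLogLR (x : ℕ → ℝ) (k m r : ℕ) (p a y : ℝ) : EReal :=
  empLogLR (adjustedData x k m r p a y)

/-- The chi-squared distribution with one degree of freedom: the law of the square of a standard
normal random variable. -/
def chiSqOne : Measure ℝ := (gaussianReal 0 1).map (fun x : ℝ => x ^ 2)

instance : IsProbabilityMeasure chiSqOne :=
  Measure.isProbabilityMeasure_map (by fun_prop)

end

end BlockQuantile

/-! An observation has the law of q(E), where E is standard exponential and q(w) = U(exp w). Rényi's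
representation turns the descending exponential order statistics of a block into sums E_j = ∑_{l ≥
j} g_l/(l+1) of independent standard exponentials, so that the normalized spacing (j+1)(E_j -
E_{j+1}) is exactly g_j (`map_descSort_eq_map_renyiSum`, `map_adjustedLogLR`). The second-order
condition gives log q(w) = γ w + c + h(w) with |h(w)| ≤ C |A(m)| (1 + (m exp(-w))^s) for all w > 0
and all large m (`exists_global_bound`, `SecondOrder.exists_expansion`).

In the data points the constant c cancels and γ factors out. Since a(m,r,p) is the mean of E_r plus
log p, each point equals γ times (g_j - 1) - (E_r - mean)/a(m,r,p) + (terms in h/γ). The mean of E_r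
is at most 1 + log m, hence a(m,r,p) ≤ 1 + log(m p) → -∞; as E_r has bounded variance, the second
term adds only o(√k) in probability to the sum of the data. The terms in h add up to something of
order k |A(m)| = o(√k) in mean, because (m exp(-E_j))^s has bounded expectation.

For points with sum S, sum of squares V and maximal modulus M, the multiplier is close to S/V and
the empirical likelihood statistic is close to S²/V as soon as M |S| is small compared with V
(`empLogLR_approx`). The pseudo-point is -b times the sum of the other points with b = a_n/(k r) →
0; it multiplies S by 1 - b and hardly changes V. Hence the statistic differs from the square of (k
r)^(-1/2) ∑ (g - 1) by a quantity tending to 0 in probability (`empLogLR_logData_approx` on a good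
event, `tendsto_measureReal_not_approx` for the probability of that event), and the central limit
theorem identifies the limit as the square of a standard normal variable. -/

namespace BlockQuantile

/-! ### Uniform bounds in the second-order condition -/

/-- A relation that holds eventually at each shift holds, uniformly in `u ∈ [0, 1]`, at a common
shift of the base points `v` and `v + u`. -/
theorem exists_common_shift {R : ℝ → ℝ → Prop} (hR : ∀ v, MeasurableSet {w | R v w})
    (h : ∀ w ∈ Set.Icc (0 : ℝ) 2, ∀ᶠ v in atTop, R v w) :
    ∃ V : ℝ, ∀ v ≥ V, ∀ u ∈ Set.Icc (0 : ℝ) 1, ∃ w, R v w ∧ 0 ≤ w - u ∧ w ≤ 2 ∧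
      R (v + u) (w - u) := by
  -- A Steinhaus-type argument: pointwise convergence makes the exceptional shifts in [0, 2] a set
  -- of vanishing measure, so from some V on that measure is below 1/2.
  have h0 : Tendsto (fun v => (volume.restrict (Set.Icc (0 : ℝ) 2)) {w | R v w}ᶜ) atTop
      (𝓝 ((volume.restrict (Set.Icc (0 : ℝ) 2)) ∅)) := by
    refine tendsto_measure_of_ae_tendsto_indicator_of_isFiniteMeasure atTop MeasurableSet.empty
      (fun v => (hR v).compl) ?_
    filter_upwards [ae_restrict_mem measurableSet_Icc] with w hw
    filter_upwards [h w hw] with v hv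
    simp [hv]
  rw [measure_empty] at h0
  obtain ⟨V, hV⟩ := eventually_atTop.1 (h0.eventually_lt_const
    (show (0 : ENNReal) < ENNReal.ofReal (1 / 2) by simp))
  refine ⟨V, fun v hv u hu => ?_⟩
  by_contra! hcon
  have h1 := hV v hv
  have h2 := hV (v + u) (by linarith [hu.1])
  rw [Measure.restrict_apply (hR _).compl] at h1 h2
  -- If no w served, the interval [u, 2], of length at least 1, would be covered by the exceptional
  -- set at v and the translate by u of the one at v + u, of total measure below 1.
  have hsub : Set.Icc u 2 ⊆ ({w | R v w}ᶜ ∩ Set.Icc 0 2) ∪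
      (fun w => w + (-u)) ⁻¹' ({w | R (v + u) w}ᶜ ∩ Set.Icc 0 2) := by
    intro w hw
    by_cases hvw : R v w
    · right
      refine ⟨?_, ?_, ?_⟩
      · have := hcon w hvw (by linarith [hw.1]) hw.2
        simpa [← sub_eq_add_neg] using this
      · show 0 ≤ w + -u
        linarith [hw.1]
      · show w + -u ≤ 2
        linarith [hw.2, hu.1]
    · exact Or.inl ⟨hvw, by linarith [hu.1, hw.1], hw.2⟩
  have h3 := (measure_mono hsub).trans (measure_union_le (μ := volume) _ _)
  rw [measure_preimage_add_right, Real.volume_Icc] at h3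
  have h4 := h3.trans_lt (ENNReal.add_lt_add h1 h2)
  rw [← ENNReal.ofReal_add (by norm_num) (by norm_num), ENNReal.ofReal_lt_ofReal_iff (by norm_num)]
    at h4
  linarith [hu.2]

section SecondOrderAdditive

variable {G B : ℝ → ℝ} {ρ : ℝ}

/-- The limit function of the second-order condition, in additive form. -/
noncomputable def secondOrderLimit (ρ w : ℝ) : ℝ := (Real.exp (ρ * w) - 1) / ρ

/-- This functional equation forces regular variation of the auxiliary function: the step from v + w
to v + w + 1 can be measured in units of B v or of B (v + w), and comparing the two limits gives the
ratio. -/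
theorem secondOrderLimit_add_sub (ρ w : ℝ) :
    secondOrderLimit ρ (w + 1) - secondOrderLimit ρ w
      = Real.exp (ρ * w) * secondOrderLimit ρ 1 := by
  simp only [secondOrderLimit, mul_add, Real.exp_add]
  ring

theorem secondOrderLimit_pos (hρ : ρ < 0) {w : ℝ} (hw : 0 < w) : 0 < secondOrderLimit ρ w :=
  div_pos_of_neg_of_neg (by
    have : Real.exp (ρ * w) < 1 := by
        rw [← Real.exp_zero]
        exact Real.exp_lt_exp.2 (mul_neg_of_neg_of_pos hρ hw)
    linarith) hρ

theorem secondOrderLimit_nonneg (hρ : ρ < 0) {w : ℝ} (hw : 0 ≤ w) : 0 ≤ secondOrderLimit ρ w := by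
  rcases hw.eq_or_lt with rfl | hw
  · simp [secondOrderLimit]
  · exact (secondOrderLimit_pos hρ hw).le

theorem secondOrderLimit_le (hρ : ρ < 0) (w : ℝ) : secondOrderLimit ρ w ≤ -ρ⁻¹ := by
  have h := Real.exp_pos (ρ * w)
  rw [secondOrderLimit, div_le_iff_of_neg hρ, neg_mul, inv_mul_cancel₀ hρ.ne]
  linarith

/-- Where B v = 0 the quotient takes the default value 0, which stays away from the nonzero limit at
shift 1. -/
theorem eventually_ne_zero_of_secondOrder (hρ : ρ < 0)
    (h : ∀ w, Tendsto (fun v => (G (v + w) - G v) / B v) atTop (𝓝 (secondOrderLimit ρ w))) :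
    ∀ᶠ v in atTop, B v ≠ 0 := by
  filter_upwards [(h 1).eventually_ne (secondOrderLimit_pos hρ one_pos).ne'] with v hv hB
  simp [hB] at hv

/-- The auxiliary function in the second-order condition is regularly varying. -/
theorem tendsto_auxiliary_ratio (hρ : ρ < 0)
    (h : ∀ w, Tendsto (fun v => (G (v + w) - G v) / B v) atTop (𝓝 (secondOrderLimit ρ w)))
    (w : ℝ) : Tendsto (fun v => B (v + w) / B v) atTop (𝓝 (Real.exp (ρ * w))) := by
  have hκ := secondOrderLimit_pos hρ one_pos
  have h1 := (h (w + 1)).sub (h w)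
  rw [secondOrderLimit_add_sub] at h1
  have h2 : Tendsto (fun v => (G (v + w + 1) - G (v + w)) / B (v + w)) atTop
      (𝓝 (secondOrderLimit ρ 1)) := (h 1).comp (tendsto_atTop_add_const_right _ w tendsto_id)
  have h3 := h1.div h2 hκ.ne'
  rw [mul_div_cancel_right₀ _ hκ.ne'] at h3
  refine h3.congr' ?_
  have hne := eventually_ne_zero_of_secondOrder hρ h
  have hne' := (tendsto_atTop_add_const_right _ w tendsto_id).eventually hne
  filter_upwards [hne, hne', h2.eventually_ne hκ.ne'] with v h4 h5 h6
  simp only [id] at h5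
  have h7 : G (v + w + 1) - G (v + w) ≠ 0 := fun h0 => h6 (by simp [h0])
  simp only [Pi.div_apply]
  rw [← add_assoc]
  field_simp
  ring

/-- Local uniformity in the second-order condition. -/
theorem exists_local_bound (hG : Measurable G) (hB : Measurable B) (hρ : ρ < 0)
    (h : ∀ w, Tendsto (fun v => (G (v + w) - G v) / B v) atTop (𝓝 (secondOrderLimit ρ w))) :
    ∃ C V : ℝ, 1 ≤ C ∧ ∀ v ≥ V, ∀ u ∈ Set.Icc (0 : ℝ) 1,
      |G (v + u) - G v| ≤ C * |B v| ∧ |B (v + u)| ≤ C * |B v| ∧ |B v| ≤ C * |B (v + u)| := by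
  -- M exceeds the supremum -1/ρ of the limit function, and D exceeds exp(-ρ w) for every w in [0,
  -- 2]; both bounds therefore hold eventually at each fixed shift.
  set M : ℝ := 1 - ρ⁻¹ with hM
  set D : ℝ := 2 * Real.exp (-(2 * ρ)) with hD
  have hMpos : 0 ≤ M := by have := inv_lt_zero.2 hρ; linarith
  have hDone : 1 ≤ D := by
    have : 1 ≤ Real.exp (-(2 * ρ)) := Real.one_le_exp (by linarith)
    linarith
  set R : ℝ → ℝ → Prop := fun v w => |G (v + w) - G v| ≤ M * |B v| ∧ |B (v + w)| ≤ 2 * |B v| ∧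
      |B v| ≤ D * |B (v + w)| with hR
  have hmeas : ∀ v, MeasurableSet {w | R v w} := by
    intro v
    have h1 : Measurable fun w => G (v + w) := hG.comp (measurable_const_add v)
    have h2 : Measurable fun w => B (v + w) := hB.comp (measurable_const_add v)
    have h3 : Measurable fun w => |G (v + w) - G v| := (h1.sub_const _).abs
    exact (measurableSet_le h3 measurable_const).inter
      ((measurableSet_le h2.abs measurable_const).inter
        (measurableSet_le measurable_const (h2.abs.const_mul D)))
  have hev : ∀ w ∈ Set.Icc (0 : ℝ) 2, ∀ᶠ v in atTop, R v w := by
    intro w hw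
    have hlt : |secondOrderLimit ρ w| < M := by
      rw [abs_of_nonneg (secondOrderLimit_nonneg hρ hw.1)]
      linarith [secondOrderLimit_le hρ w]
    have hr := (tendsto_auxiliary_ratio hρ h w).abs
    rw [abs_of_pos (Real.exp_pos _)] at hr
    have hr1 : Real.exp (ρ * w) < 2 := by
      have : Real.exp (ρ * w) ≤ 1 := Real.exp_le_one_iff.2 (mul_nonpos_of_nonpos_of_nonneg hρ.le hw.1)
      linarith
    have hr2 : D⁻¹ < Real.exp (ρ * w) := by
      have h1 : Real.exp (2 * ρ) ≤ Real.exp (ρ * w) := Real.exp_le_exp.2 (by nlinarith [hw.2])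
      rw [hD, mul_inv, ← Real.exp_neg, neg_neg]
      linarith [Real.exp_pos (2 * ρ)]
    filter_upwards [(h w).abs.eventually_lt_const hlt, hr.eventually_lt_const hr1,
      hr.eventually_const_lt hr2, eventually_ne_zero_of_secondOrder hρ h] with v h1 h2 h3 h4
    have h5 := abs_pos.2 h4
    rw [abs_div, div_lt_iff₀ h5] at h1 h2
    rw [abs_div, lt_div_iff₀ h5, inv_mul_lt_iff₀ (by linarith)] at h3
    exact ⟨h1.le, h2.le, h3.le⟩
  obtain ⟨V, hV⟩ := exists_common_shift hmeas hev
  refine ⟨M + M * (2 * D) + 2 * D, V, by nlinarith, fun v hv u hu => ?_⟩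
  -- The base points v and v + u are compared through the common endpoint v + w, which is good for
  -- both.
  obtain ⟨w, ⟨h1, h2, h3⟩, -, -, h4, h5, h6⟩ := hV v hv u hu
  have e : v + u + (w - u) = v + w := by ring
  rw [e] at h4 h5 h6
  have hBb : |B (v + u)| ≤ 2 * D * |B v| := by nlinarith
  have hBb' : |B v| ≤ 2 * D * |B (v + u)| := by nlinarith
  have hp : 0 ≤ M * (2 * D) := by positivity
  refine ⟨?_, ?_, ?_⟩
  · calc |G (v + u) - G v| = |(G (v + w) - G v) - (G (v + w) - G (v + u))| := by ring_nf
      _ ≤ |G (v + w) - G v| + |G (v + w) - G (v + u)| := abs_sub _ _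
      _ ≤ M * |B v| + M * (2 * D * |B v|) := by
          refine add_le_add h1 (h4.trans ?_)
          gcongr
      _ ≤ _ := by nlinarith [abs_nonneg (B v)]
  · nlinarith [abs_nonneg (B v), mul_nonneg hMpos (abs_nonneg (B v)),
      mul_nonneg hp (abs_nonneg (B v))]
  · nlinarith [abs_nonneg (B (v + u)), mul_nonneg hMpos (abs_nonneg (B (v + u))),
      mul_nonneg hp (abs_nonneg (B (v + u)))]

/-- The deviation of `G` from its limit at infinity is controlled, everywhere on `(0, ∞)`, by the
auxiliary function at any single large point, with an exponential loss to the left of it. -/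
theorem exists_global_bound (hG : Measurable G) (hB : Measurable B) (hρ : ρ < 0)
    (h : ∀ w, Tendsto (fun v => (G (v + w) - G v) / B v) atTop (𝓝 (secondOrderLimit ρ w)))
    (hbdd : ∀ V : ℝ, ∃ K : ℝ, ∀ w, 0 < w → w ≤ V → |G w| ≤ K) :
    ∃ (c : ℝ) (s : ℕ) (C V : ℝ), 0 ≤ C ∧ ∀ v ≥ V, ∀ w, 0 < w →
      |G w - c| ≤ C * |B v| * (1 + Real.exp (s * (v - w))) := by
  obtain ⟨C, V₀, hC, hloc⟩ := exists_local_bound hG hB hρ h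
  -- A number strictly between the limiting ratio exp ρ of B over a unit step and 1, so that |B|
  -- eventually contracts geometrically.
  set q : ℝ := Real.exp (ρ / 2) with hq
  have hq0 : 0 < q := Real.exp_pos _
  have hq1 : q < 1 := by
    rw [hq, ← Real.exp_zero]
    exact Real.exp_lt_exp.2 (by linarith)
  have hstep : ∀ᶠ v in atTop, |B (v + 1)| ≤ q * |B v| := by
    have hr := (tendsto_auxiliary_ratio hρ h 1).abs
    rw [abs_of_pos (Real.exp_pos _)] at hr
    filter_upwards [hr.eventually_lt_const (show Real.exp (ρ * 1) < q from
      Real.exp_lt_exp.2 (by linarith)), eventually_ne_zero_of_secondOrder hρ h] with v h1 h2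
    rw [abs_div, div_lt_iff₀ (abs_pos.2 h2)] at h1
    exact h1.le
  obtain ⟨V₁, hV₁⟩ := eventually_atTop.1 (hstep.and (eventually_ne_zero_of_secondOrder hρ h))
  set V := max V₀ V₁ with hV
  have hiter : ∀ v ≥ V, ∀ n : ℕ, |B (v + n)| ≤ q ^ n * |B v| ∧ |B v| ≤ C ^ n * |B (v + n)| ∧
      |G (v + n) - G v| ≤ C * |B v| * ∑ l ∈ Finset.range n, q ^ l := by
    intro v hv n
    induction n with
    | zero => simp
    | succ n ih =>
      obtain ⟨h1, h2, h3⟩ := ih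
      have hvn : V ≤ v + n := by have : (0 : ℝ) ≤ n := n.cast_nonneg; linarith
      have e : v + ((n + 1 : ℕ) : ℝ) = v + n + 1 := by push_cast; ring
      obtain ⟨h4, -, h5⟩ := hloc (v + n) ((le_max_left _ _).trans hvn) 1 (by simp)
      have h6 := (hV₁ (v + n) ((le_max_right _ _).trans hvn)).1
      rw [e]
      refine ⟨?_, ?_, ?_⟩
      · calc _ ≤ q * |B (v + n)| := h6
          _ ≤ q * (q ^ n * |B v|) := by gcongr
          _ = _ := by ring
      · calc _ ≤ C ^ n * |B (v + n)| := h2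
          _ ≤ C ^ n * (C * |B (v + n + 1)|) := by gcongr
          _ = _ := by ring
      · calc |G (v + n + 1) - G v| ≤ |G (v + n + 1) - G (v + n)| + |G (v + n) - G v| :=
              abs_sub_le _ _ _
          _ ≤ C * (q ^ n * |B v|) + C * |B v| * ∑ l ∈ Finset.range n, q ^ l := by
              refine add_le_add (h4.trans ?_) h3
              gcongr
          _ = _ := by rw [Finset.sum_range_succ]; ring
  have hsum : ∀ n : ℕ, ∑ l ∈ Finset.range n, q ^ l ≤ (1 - q)⁻¹ := fun n => by
    rw [← tsum_geometric_of_lt_one hq0.le hq1]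
    exact (summable_geometric_of_lt_one hq0.le hq1).sum_le_tsum _ fun _ _ => by positivity
  have hq2 : 0 < 1 - q := by linarith
  -- Going one unit to the left enlarges |B| by a factor at most C ≤ exp s. An integer s is taken
  -- because the negative moments of the order statistics are later bounded for integer exponents.
  obtain ⟨s, hs⟩ := exists_nat_ge (Real.log C)
  have hCs : C ≤ Real.exp s := by
    rwa [← Real.log_le_iff_le_exp (by linarith)]
  set K : ℝ := C * (1 - q)⁻¹ + C with hK
  have hKpos : 0 ≤ K := by positivity
  have hreal : ∀ v ≥ V, ∀ y, 0 ≤ y → |B (v + y)| ≤ C * |B v| ∧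
      |B v| ≤ C * Real.exp (s * y) * |B (v + y)| ∧ |G (v + y) - G v| ≤ K * |B v| := by
    intro v hv y hy
    set n := ⌊y⌋₊ with hn
    have hny : (n : ℝ) ≤ y := Nat.floor_le hy
    have hvn : V ≤ v + n := by have : (0 : ℝ) ≤ n := n.cast_nonneg; linarith
    have e : v + y = v + n + (y - n) := by ring
    obtain ⟨h1, h2, h3⟩ := hiter v hv n
    obtain ⟨h4, h5, h6⟩ := hloc (v + n) ((le_max_left _ _).trans hvn) (y - n)
      ⟨by linarith, by have := Nat.lt_floor_add_one y; rw [← hn] at this; linarith⟩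
    have hBn : |B (v + n)| ≤ |B v| :=
      h1.trans (mul_le_of_le_one_left (abs_nonneg _) (pow_le_one₀ hq0.le hq1.le))
    rw [e]
    refine ⟨h5.trans (by gcongr), ?_, ?_⟩
    · calc |B v| ≤ C ^ n * |B (v + n)| := h2
        _ ≤ C ^ n * (C * |B (v + n + (y - n))|) := by gcongr
        _ = C * C ^ n * |B (v + n + (y - n))| := by ring
        _ ≤ _ := by
          gcongr
          calc C ^ n ≤ Real.exp s ^ n := by gcongr
            _ = Real.exp (s * n) := by rw [← Real.exp_nat_mul]; ring_nf
            _ ≤ _ := by gcongr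
    · calc |G (v + n + (y - n)) - G v|
          ≤ |G (v + n + (y - n)) - G (v + n)| + |G (v + n) - G v| := abs_sub_le _ _ _
        _ ≤ C * |B v| + C * |B v| * (1 - q)⁻¹ := by
            refine add_le_add (h4.trans (by gcongr)) (h3.trans ?_)
            gcongr
            exact hsum n
        _ = K * |B v| := by rw [hK]; ring
  obtain ⟨c, hc⟩ : ∃ c, Tendsto (fun n : ℕ => G (V + n)) atTop (𝓝 c) := by
    refine cauchySeq_tendsto_of_complete (cauchySeq_of_le_geometric q (C * |B V|) hq1 fun n => ?_)
    have hvn : V ≤ V + n := by have : (0 : ℝ) ≤ n := n.cast_nonneg; linarith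
    rw [dist_comm, Real.dist_eq]
    have e : V + ((n + 1 : ℕ) : ℝ) = V + n + 1 := by push_cast; ring
    rw [e]
    calc _ ≤ C * |B (V + n)| := (hloc (V + n) ((le_max_left _ _).trans hvn) 1 (by simp)).1
      _ ≤ C * (q ^ n * |B V|) := by
          gcongr
          exact (hiter V le_rfl n).1
      _ = _ := by ring
  have hlim : ∀ v ≥ V, |G v - c| ≤ K * |B v| := by
    intro v hv
    have h1 : Tendsto (fun n : ℕ => |G v - G (V + n)|) atTop (𝓝 |G v - c|) :=
      (tendsto_const_nhds.sub hc).abs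
    refine le_of_tendsto h1 ?_
    obtain ⟨n₀, hn₀⟩ := exists_nat_ge (v - V)
    filter_upwards [eventually_ge_atTop n₀] with n hn
    have hn' : (n₀ : ℝ) ≤ n := by exact_mod_cast hn
    have h2 := (hreal v hv (V + n - v) (by linarith)).2.2
    rw [add_sub_cancel] at h2
    rwa [abs_sub_comm]
  obtain ⟨K₀, hK₀⟩ := hbdd V
  have hBV : 0 < |B V| := abs_pos.2 (hV₁ V (le_max_right _ _)).2
  have hKc : 0 ≤ |K₀| + |c| := by positivity
  refine ⟨c, s, K * C + (|K₀| + |c|) / |B V| * C, V, by positivity, fun v hv w hw => ?_⟩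
  have hP1 : 0 ≤ K * C * |B v| := by positivity
  have hP2 : 0 ≤ (|K₀| + |c|) / |B V| * C * |B v| := by positivity
  have hexp := Real.exp_pos (s * (v - w))
  rcases le_or_gt V w with hwV | hwV
  · rcases le_total v w with hvw | hvw
    · have h1 := (hreal v hv (w - v) (by linarith)).1
      rw [add_sub_cancel] at h1
      calc |G w - c| ≤ K * |B w| := hlim w hwV
        _ ≤ K * (C * |B v|) := by gcongr
        _ ≤ _ := by nlinarith [mul_nonneg hP1 hexp.le, mul_nonneg hP2 hexp.le]
    · have h1 := (hreal w hwV (v - w) (by linarith)).2.1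
      rw [add_sub_cancel] at h1
      calc |G w - c| ≤ K * |B w| := hlim w hwV
        _ ≤ K * (C * Real.exp (s * (v - w)) * |B v|) := by gcongr
        _ ≤ _ := by nlinarith [mul_nonneg hP1 hexp.le, mul_nonneg hP2 hexp.le]
  -- To the left of V only boundedness of G is available. The constant bound is written as a
  -- multiple of |B V| ≠ 0 and carried to v with the loss exp(s (v - V)), which w < V only
  -- increases.
  · have h1 := (hreal V le_rfl (v - V) (by linarith)).2.1
    rw [add_sub_cancel] at h1
    have h2 : Real.exp (s * (v - V)) ≤ Real.exp (s * (v - w)) := by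
      gcongr
    calc |G w - c| ≤ |G w| + |c| := abs_sub _ _
      _ ≤ |K₀| + |c| := by
          exact add_le_add_left ((hK₀ w hw hwV.le).trans (le_abs_self _)) _
      _ = (|K₀| + |c|) / |B V| * |B V| := by field_simp
      _ ≤ (|K₀| + |c|) / |B V| * (C * Real.exp (s * (v - w)) * |B v|) := by
          gcongr
          exact h1.trans (by gcongr)
      _ ≤ _ := by nlinarith [mul_nonneg hP1 hexp.le, mul_nonneg hP2 hexp.le]

end SecondOrderAdditive

/-! ### The quantile function in exponential coordinates -/

section Quantile

variable {μ : Measure ℝ}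

theorem bddBelow_le_cdf {u : ℝ} (hu : 0 < u) : BddBelow {x : ℝ | u ≤ cdf μ x} := by
  obtain ⟨b, hb⟩ := eventually_atBot.1 ((tendsto_cdf_atBot μ).eventually_lt_const hu)
  refine ⟨b, fun x hx => ?_⟩
  by_contra! h
  exact absurd (hb x h.le) (not_lt.2 hx)

theorem nonempty_le_cdf {u : ℝ} (hu : u < 1) : {x : ℝ | u ≤ cdf μ x}.Nonempty := by
  obtain ⟨x, hx⟩ := ((tendsto_cdf_atTop μ).eventually_const_lt hu).exists
  exact ⟨x, hx.le⟩

/-- The Galois connection between a distribution function and its generalized inverse. -/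
theorem genInv_le_iff [IsProbabilityMeasure μ] {u x : ℝ} (hu : 0 < u) (hu1 : u < 1) :
    genInv (cdf μ) u ≤ x ↔ u ≤ cdf μ x := by
  refine ⟨fun h => ?_, fun h => csInf_le (bddBelow_le_cdf hu) h⟩
  refine le_trans ?_ (monotone_cdf μ h)
  have hlim : Tendsto (cdf μ) (𝓝[>] genInv (cdf μ) u) (𝓝 (cdf μ (genInv (cdf μ) u))) :=
    ((cdf μ).right_continuous _).tendsto.mono_left
      (nhdsWithin_mono _ Set.Ioi_subset_Ici_self)
  refine ge_of_tendsto hlim ?_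
  filter_upwards [self_mem_nhdsWithin] with y hy
  obtain ⟨z, hz, hzy⟩ := exists_lt_of_csInf_lt (nonempty_le_cdf hu1) hy
  exact le_trans hz (monotone_cdf μ hzy.le)

theorem one_le_genInv [IsProbabilityMeasure μ] (hμ : μ (Set.Iio 1) = 0) {u : ℝ} (hu : 0 < u)
    (hu1 : u < 1) :
    1 ≤ genInv (cdf μ) u := by
  refine le_csInf (nonempty_le_cdf hu1) fun x hx => ?_
  by_contra! h
  have : cdf μ x = 0 := by
    rw [cdf_eq_real, measureReal_eq_zero_iff]
    exact measure_mono_null (Set.Iic_subset_Iio.2 h) hμ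
  have hx' : u ≤ cdf μ x := hx
  linarith

theorem genInv_eq_zero {u : ℝ} (hu : u ≤ 0) : genInv (cdf μ) u = 0 := by
  have : {x : ℝ | u ≤ cdf μ x} = Set.univ :=
    Set.eq_univ_of_forall fun x => hu.trans (cdf_nonneg μ x)
  rw [genInv, this, Real.sInf_univ]

theorem one_sub_inv_exp_mem {w : ℝ} (hw : 0 < w) :
    0 < 1 - 1 / Real.exp w ∧ 1 - 1 / Real.exp w < 1 := by
  have h1 : 1 < Real.exp w := Real.one_lt_exp_iff.2 hw
  have h2 : 1 / Real.exp w < 1 := by rw [div_lt_one (by linarith)]; exact h1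
  have h3 : 0 < 1 / Real.exp w := by positivity
  constructor <;> linarith

theorem one_le_tailQuantile_exp [IsProbabilityMeasure μ] (hμ : μ (Set.Iio 1) = 0) {w : ℝ}
    (hw : 0 < w) :
    1 ≤ tailQuantile (cdf μ) (Real.exp w) :=
  one_le_genInv hμ (one_sub_inv_exp_mem hw).1 (one_sub_inv_exp_mem hw).2

/-- For w ≤ 0 the level is nonpositive and `sInf` of the whole line is 0. This default lies below
the values for w > 0, which are at least 1, so monotonicity holds on the whole line and not only on
the relevant half. -/
theorem monotone_tailQuantile_exp [IsProbabilityMeasure μ] (hμ : μ (Set.Iio 1) = 0) :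
    Monotone fun w => tailQuantile (cdf μ) (Real.exp w) := by
  intro w w' hww
  rcases le_or_gt w 0 with hw | hw
  · have h1 : tailQuantile (cdf μ) (Real.exp w) = 0 := by
      refine genInv_eq_zero ?_
      have : 1 ≤ 1 / Real.exp w := by
        rw [le_div_iff₀ (Real.exp_pos _), one_mul]
        exact Real.exp_le_one_iff.2 hw
      linarith
    simp only [h1]
    rcases le_or_gt w' 0 with hw' | hw'
    · refine (genInv_eq_zero (μ := μ) ?_).ge
      have : 1 ≤ 1 / Real.exp w' := by
        rw [le_div_iff₀ (Real.exp_pos _), one_mul]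
        exact Real.exp_le_one_iff.2 hw'
      linarith
    · exact zero_le_one.trans (one_le_tailQuantile_exp hμ hw')
  · have hw' := hw.trans_le hww
    refine csInf_le_csInf (bddBelow_le_cdf (one_sub_inv_exp_mem hw).1)
      (nonempty_le_cdf (one_sub_inv_exp_mem hw').2) fun x hx => le_trans (b := 1 - 1 / Real.exp w') ?_ hx
    have : 1 / Real.exp w' ≤ 1 / Real.exp w := by gcongr
    linarith

/-- The quantile transform: `U(exp E)` has distribution `μ` if `E` is standard exponential. -/
theorem map_expMeasure_tailQuantile [IsProbabilityMeasure μ] (hμ : μ (Set.Iio 1) = 0) :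
    (expMeasure 1).map (fun w => tailQuantile (cdf μ) (Real.exp w)) = μ := by
  have : IsProbabilityMeasure (expMeasure 1) := isProbabilityMeasure_expMeasure one_pos
  have hmeas := (monotone_tailQuantile_exp hμ).measurable
  have : IsProbabilityMeasure ((expMeasure 1).map
      (fun w => tailQuantile (cdf μ) (Real.exp w))) :=
    Measure.isProbabilityMeasure_map hmeas.aemeasurable
  refine Measure.eq_of_cdf _ _ (StieltjesFunction.ext fun x => ?_)
  rw [cdf_eq_real, map_measureReal_apply hmeas measurableSet_Iic]
  have hneg : expMeasure 1 (Set.Iic 0) = 0 := by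
    have := cdf_expMeasure_eq one_pos 0
    rw [cdf_eq_real] at this
    rw [← measureReal_eq_zero_iff, this]
    simp
  have hae : ∀ᵐ w ∂(expMeasure 1), 0 < w := by
    rw [ae_iff]
    simpa [Set.Iic] using hneg
  -- The threshold -log(1 - F x) should be infinite when F x = 1, whereas `Real.log 0 = 0`; that
  -- case is treated apart.
  rcases (cdf_le_one μ x).eq_or_lt with h1 | h1
  · rw [h1]
    refine Eq.trans (measureReal_congr ?_) (probReal_univ (μ := expMeasure 1))
    filter_upwards [hae] with w hw
    refine propext ⟨fun _ => trivial, fun _ => ?_⟩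
    show genInv _ _ ≤ x
    rw [genInv_le_iff (one_sub_inv_exp_mem hw).1 (one_sub_inv_exp_mem hw).2, h1]
    exact (one_sub_inv_exp_mem hw).2.le
  · have h2 : (expMeasure 1).real ((fun w => tailQuantile (cdf μ) (Real.exp w)) ⁻¹' Set.Iic x)
        = (expMeasure 1).real (Set.Iic (-Real.log (1 - cdf μ x))) := by
      refine measureReal_congr ?_
      filter_upwards [hae] with w hw
      refine propext ?_
      show genInv _ _ ≤ x ↔ w ≤ _
      rw [genInv_le_iff (one_sub_inv_exp_mem hw).1 (one_sub_inv_exp_mem hw).2, one_div,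
        ← Real.exp_neg, le_neg, Real.log_le_iff_le_exp (by linarith)]
      constructor <;> intro h <;> linarith
    have h3 : 0 ≤ -Real.log (1 - cdf μ x) :=
      neg_nonneg.2 (Real.log_nonpos (by linarith) (by linarith [cdf_nonneg μ x]))
    rw [h2, ← cdf_eq_real, cdf_expMeasure_eq one_pos, if_pos h3, one_mul, neg_neg,
      Real.exp_log (by linarith)]
    ring

theorem abs_log_one_add_sub_le {y : ℝ} (hy : |y| ≤ 1 / 2) : |Real.log (1 + y) - y| ≤ 2 * y ^ 2 := by
  have h1 := abs_le.1 hy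
  have h2 : 0 < 1 + y := by linarith
  have h3 := Real.log_le_sub_one_of_pos h2
  have h4 := Real.one_sub_inv_le_log_of_pos h2
  have h5 : y - 2 * y ^ 2 ≤ 1 - (1 + y)⁻¹ := by
    have : 1 - (1 + y)⁻¹ = y / (1 + y) := by field_simp; ring
    rw [this, le_div_iff₀ h2]
    nlinarith [mul_nonneg (sq_nonneg y) (show 0 ≤ 1 + 2 * y by linarith)]
  rw [abs_le]
  constructor <;> nlinarith [sq_nonneg y]

/-- The second-order condition for the logarithm of the tail quantile function. -/
theorem SecondOrder.tendsto_log [IsProbabilityMeasure μ] {γ ρ : ℝ} {A : ℝ → ℝ} (hμ : μ (Set.Iio 1) = 0)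
    (hρ : ρ < 0) (hU : SecondOrder (cdf μ) γ ρ A) (w : ℝ) :
    Tendsto (fun v => ((Real.log (tailQuantile (cdf μ) (Real.exp (v + w))) - γ * (v + w))
        - (Real.log (tailQuantile (cdf μ) (Real.exp v)) - γ * v)) / A (Real.exp v))
      atTop (𝓝 (secondOrderLimit ρ w)) := by
  set U : ℝ → ℝ := fun v => tailQuantile (cdf μ) (Real.exp v) with hUdef
  -- The relative error of U(v + w)/U(v) against exp(γ w). The hypothesis says that y/A converges,
  -- so y → 0 and log(1 + y) - y = O(y²) is o(A).
  set y : ℝ → ℝ → ℝ := fun w v => U (v + w) / U v * Real.exp (-(γ * w)) - 1 with hy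
  have h1 : ∀ w, Tendsto (fun v => y w v / A (Real.exp v)) atTop (𝓝 (secondOrderLimit ρ w)) := by
    intro w
    have h := ((hU.tendsto_ratio (Real.exp w) (Real.exp_pos w)).comp
      Real.tendsto_exp_atTop).mul_const (Real.exp (-(γ * w)))
    have e1 : Real.exp w ^ γ = Real.exp (γ * w) := by rw [← Real.exp_mul, mul_comm]
    have e2 : Real.exp w ^ ρ = Real.exp (ρ * w) := by rw [← Real.exp_mul, mul_comm]
    have e3 : Real.exp (γ * w) * Real.exp (-(γ * w)) = 1 := by rw [← Real.exp_add]; simp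
    rw [e1, e2, mul_right_comm, e3, one_mul] at h
    refine h.congr fun v => ?_
    simp only [Function.comp, hy, hUdef, Real.exp_add v w]
    rw [div_mul_eq_mul_div, sub_mul, e3]
  have hA0 : Tendsto (fun v => A (Real.exp v)) atTop (𝓝 0) :=
    hU.tendsto_zero.comp Real.tendsto_exp_atTop
  have hne : ∀ᶠ v in atTop, A (Real.exp v) ≠ 0 := by
    filter_upwards [(h1 1).eventually_ne (secondOrderLimit_pos hρ one_pos).ne'] with v hv hA
    simp [hA] at hv
  have hy0 : Tendsto (y w) atTop (𝓝 0) := by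
    have h := (h1 w).mul hA0
    rw [mul_zero] at h
    refine h.congr' ?_
    filter_upwards [hne] with v hv
    field_simp
  have h2 : Tendsto (fun v => (Real.log (1 + y w v) - y w v) / A (Real.exp v)) atTop (𝓝 0) := by
    have h := ((h1 w).mul hy0).abs.const_mul 2
    rw [mul_zero, abs_zero, mul_zero] at h
    refine squeeze_zero_norm' ?_ h
    filter_upwards [hy0.abs.eventually_le_const (show |(0 : ℝ)| < 1 / 2 by norm_num)] with v hv
    calc ‖(Real.log (1 + y w v) - y w v) / A (Real.exp v)‖
        ≤ 2 * y w v ^ 2 / |A (Real.exp v)| := by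
          rw [Real.norm_eq_abs, abs_div]
          gcongr
          exact abs_log_one_add_sub_le hv
      _ = 2 * |y w v / A (Real.exp v) * y w v| := by
          rw [abs_mul, abs_div, ← sq_abs]
          ring
  have h3 := h2.add (h1 w)
  rw [zero_add] at h3
  refine h3.congr' ?_
  filter_upwards [eventually_gt_atTop 0, eventually_gt_atTop (-w)] with v hv hv'
  have hU1 : 0 < U v := zero_lt_one.trans_le (one_le_tailQuantile_exp hμ hv)
  have hU2 : 0 < U (v + w) := zero_lt_one.trans_le (one_le_tailQuantile_exp hμ (by linarith))
  rw [← add_div, sub_add_cancel]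
  congr 1
  have e4 : 1 + y w v = U (v + w) / U v * Real.exp (-(γ * w)) := by simp only [hy]; ring
  rw [e4, Real.log_mul (by positivity) (by positivity), Real.log_div hU2.ne' hU1.ne', Real.log_exp]
  ring

/-- Second-order expansion of the log-quantile function in exponential coordinates. -/
theorem SecondOrder.exists_expansion [IsProbabilityMeasure μ] {γ ρ : ℝ} {A : ℝ → ℝ}
    (hμ : μ (Set.Iio 1) = 0) (hρ : ρ < 0) (hU : SecondOrder (cdf μ) γ ρ A) :
    ∃ (c : ℝ) (s : ℕ) (C V : ℝ), 0 ≤ C ∧ ∀ v ≥ V, ∀ w, 0 < w →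
      |Real.log (tailQuantile (cdf μ) (Real.exp w)) - γ * w - c|
        ≤ C * |A (Real.exp v)| * (1 + Real.exp (s * (v - w))) := by
  have hmono := monotone_tailQuantile_exp hμ
  refine exists_global_bound (B := fun v => A (Real.exp v))
    (G := fun w => Real.log (tailQuantile (cdf μ) (Real.exp w)) - γ * w)
    ?_ (hU.measurable.comp Real.measurable_exp) hρ (hU.tendsto_log hμ hρ) fun V => ?_
  · exact (Real.measurable_log.comp hmono.measurable).sub (measurable_id.const_mul γ)
  -- Observations being at least 1, log q is nonnegative and increasing on (0, V], hence bounded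
  -- there.
  · refine ⟨Real.log (tailQuantile (cdf μ) (Real.exp V)) + |γ| * |V|, fun w hw hwV => ?_⟩
    have h1 := one_le_tailQuantile_exp hμ hw
    have h2 := Real.log_nonneg h1
    have h3 : Real.log (tailQuantile (cdf μ) (Real.exp w))
        ≤ Real.log (tailQuantile (cdf μ) (Real.exp V)) :=
      Real.log_le_log (by linarith) (hmono hwV)
    refine (abs_sub _ _).trans ?_
    rw [abs_of_nonneg h2, abs_mul]
    gcongr

end Quantile

/-! ### Empirical likelihood: measurability and quadratic approximation -/

section EmpiricalLikelihood

variable {ι : Type*} [Fintype ι]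

theorem empLogLR_ne_bot (z : ι → ℝ) : empLogLR z ≠ ⊥ := by
  rw [empLogLR]
  split_ifs
  · exact EReal.coe_ne_bot _
  · exact top_ne_bot

theorem empLogLR_le_coe_iff (z : ι → ℝ) (c : ℝ) :
    empLogLR z ≤ c ↔ ∃ lam, IsMultiplier z lam ∧ 2 * ∑ s, Real.log (1 + lam * z s) ≤ c := by
  constructor
  · intro h
    by_cases hex : ∃ lam, IsMultiplier z lam
    · obtain ⟨lam, hlam⟩ := hex
      rw [empLogLR_eq hlam, EReal.coe_le_coe_iff] at h
      exact ⟨lam, hlam, h⟩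
    · rw [empLogLR, dif_neg hex, top_le_iff] at h
      exact absurd h (EReal.coe_ne_top c)
  · rintro ⟨lam, hlam, h⟩
    rw [empLogLR_eq hlam]
    exact EReal.coe_le_coe_iff.2 h

/-- The multiplier comes from a choice, so measurability is read off sublevel sets. With lam in a
compact interval and the factors 1 + lam z bounded away from 0, the constraints are closed jointly
in lam and z, and projecting along the compact factor preserves closedness. The sublevel sets of the
statistic are countable unions over N of such sets. -/
theorem isClosed_bounded_multiplier (c : ℝ) (N : ℕ) :
    IsClosed {z : ι → ℝ | ∃ lam : Set.Icc (-(N : ℝ)) N,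
      (∀ s, ((N : ℝ) + 1)⁻¹ ≤ 1 + lam * z s) ∧ ∑ s, z s / (1 + lam * z s) = 0 ∧
        2 * ∑ s, Real.log (1 + lam * z s) ≤ c} := by
  have hN : (0 : ℝ) < ((N : ℝ) + 1)⁻¹ := by positivity
  -- Truncating the factors from below makes the quotients and logarithms continuous everywhere and
  -- changes nothing under the constraint.
  set D : Set.Icc (-(N : ℝ)) N × (ι → ℝ) → ι → ℝ :=
    fun q s => max (((N : ℝ) + 1)⁻¹) (1 + q.1 * q.2 s) with hD
  have hDpos : ∀ q s, D q s ≠ 0 := fun q s => (hN.trans_le (le_max_left _ _)).ne'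
  have hDc : ∀ s, Continuous fun q => D q s := fun s => by
    simp only [hD]
    fun_prop
  have hcl : IsClosed {q : Set.Icc (-(N : ℝ)) N × (ι → ℝ) |
      (∀ s, ((N : ℝ) + 1)⁻¹ ≤ 1 + q.1 * q.2 s) ∧ ∑ s, q.2 s / D q s = 0 ∧
        2 * ∑ s, Real.log (D q s) ≤ c} := by
    refine IsClosed.inter ?_ (IsClosed.inter ?_ ?_)
    · have : {q : Set.Icc (-(N : ℝ)) N × (ι → ℝ) | ∀ s, ((N : ℝ) + 1)⁻¹ ≤ 1 + q.1 * q.2 s}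
          = ⋂ s, {q | ((N : ℝ) + 1)⁻¹ ≤ 1 + q.1 * q.2 s} := by
        ext q
        simp
      have hcl : IsClosed {q : Set.Icc (-(N : ℝ)) N × (ι → ℝ) |
          ∀ s, ((N : ℝ) + 1)⁻¹ ≤ 1 + q.1 * q.2 s} := by
        rw [this]
        exact isClosed_iInter fun s => isClosed_le continuous_const (by fun_prop)
      exact hcl
    · refine isClosed_eq (continuous_finsetSum _ fun s _ => ?_) continuous_const
      exact Continuous.div (by fun_prop) (hDc s) fun q => hDpos q s
    · have : Continuous fun q => 2 * ∑ s, Real.log (D q s) :=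
        (continuous_finsetSum _ fun s _ => (hDc s).log fun q => hDpos q s).const_mul 2
      exact isClosed_le this continuous_const
  convert isClosedMap_snd_of_compactSpace _ hcl using 1
  ext z
  simp only [Set.mem_ofPred_eq, Set.mem_image, Prod.exists, exists_eq_right]
  refine exists_congr fun lam => and_congr_right fun h => ?_
  have : ∀ s, D (lam, z) s = 1 + lam * z s := fun s => max_eq_right (h s)
  simp only [this]

theorem measurable_empLogLR : Measurable (empLogLR : (ι → ℝ) → EReal) := by
  refine measurable_of_Iic fun c => ?_
  induction c with
  | bot =>
    convert MeasurableSet.empty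
    ext z
    simp [empLogLR_ne_bot]
  | top => simp
  | coe c =>
    have : empLogLR ⁻¹' Set.Iic (c : EReal) = ⋃ N : ℕ, {z : ι → ℝ |
        ∃ lam : Set.Icc (-(N : ℝ)) N,
          (∀ s, ((N : ℝ) + 1)⁻¹ ≤ 1 + lam * z s) ∧ ∑ s, z s / (1 + lam * z s) = 0 ∧
          2 * ∑ s, Real.log (1 + lam * z s) ≤ c} := by
      ext z
      simp only [Set.mem_preimage, Set.mem_Iic, empLogLR_le_coe_iff, Set.mem_iUnion,
        Set.mem_ofPred_eq]
      constructor
      · rintro ⟨lam, ⟨h1, h2⟩, h3⟩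
        have hev : ∀ᶠ N : ℕ in atTop, |lam| ≤ N ∧ ∀ s, ((N : ℝ) + 1)⁻¹ ≤ 1 + lam * z s := by
          refine (tendsto_natCast_atTop_atTop.eventually_ge_atTop |lam|).and
            (eventually_all.2 fun s => ?_)
          have h4 : Tendsto (fun N : ℕ => ((N : ℝ) + 1)⁻¹) atTop (𝓝 0) :=
            tendsto_inv_atTop_zero.comp
              (tendsto_atTop_add_const_right _ 1 tendsto_natCast_atTop_atTop)
          exact h4.eventually_le_const (h1 s)
        obtain ⟨N, h4, h5⟩ := hev.exists
        exact ⟨N, ⟨lam, abs_le.1 h4⟩, h5, h2, h3⟩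
      · rintro ⟨N, lam, h1, h2, h3⟩
        exact ⟨lam, ⟨fun s => lt_of_lt_of_le (by positivity) (h1 s), h2⟩, h3⟩
    rw [this]
    exact MeasurableSet.iUnion fun N => (isClosed_bounded_multiplier c N).measurableSet

theorem abs_log_one_add_sub_sub_le {u : ℝ} (hu : |u| ≤ 1 / 4) :
    |Real.log (1 + u) - u + u ^ 2 / 2| ≤ 4 / 3 * (|u| * u ^ 2) := by
  have h := Real.abs_log_sub_add_sum_range_le (x := -u) (by rw [abs_neg]; linarith) 2
  have e : ∑ i ∈ Finset.range 2, (-u) ^ (i + 1) / ((i : ℝ) + 1) + Real.log (1 - -u)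
      = Real.log (1 + u) - u + u ^ 2 / 2 := by
    simp [Finset.sum_range_succ]
    ring
  rw [e, abs_neg] at h
  refine h.trans ?_
  rw [div_le_iff₀ (by linarith), ← sq_abs u]
  have h0 := abs_nonneg u
  have h3 : 0 ≤ |u| ^ 3 := by positivity
  nlinarith

/-- Quadratic approximation of the empirical log-likelihood ratio statistic. -/
theorem empLogLR_approx {z : ι → ℝ} {M ε : ℝ} (hV : 0 < ∑ s, z s ^ 2) (hM : ∀ s, |z s| ≤ M)
    (hε : M * |∑ s, z s| ≤ ε * ∑ s, z s ^ 2) (hε8 : ε ≤ 1 / 8) :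
    ∃ Y : ℝ, empLogLR z = Y ∧
      |Y - (∑ s, z s) ^ 2 / ∑ s, z s ^ 2| ≤ 32 * ε * ((∑ s, z s) ^ 2 / ∑ s, z s ^ 2) := by
  set S := ∑ s, z s with hS
  set V := ∑ s, z s ^ 2 with hVdef
  -- Twice the first-order root S/V: wide enough for the score to change sign on [-L, L], narrow
  -- enough to keep |lam z| ≤ 1/4 there.
  set L := 2 * |S| / V with hL
  have hL0 : 0 ≤ L := by positivity
  have hne : Nonempty ι := by
    by_contra hcon
    rw [not_nonempty_iff] at hcon
    simp [hVdef] at hV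
  have hM0 : 0 ≤ M := (abs_nonneg _).trans (hM hne.some)
  have hLM : L * M ≤ 2 * ε := by
    rw [hL, div_mul_eq_mul_div, div_le_iff₀ hV]
    linarith
  have hsmall : ∀ lam, |lam| ≤ L → ∀ s, |lam * z s| ≤ |lam| * M ∧ |lam * z s| ≤ 1 / 4 := by
    intro lam hlam s
    have h1 : |lam * z s| ≤ |lam| * M := by
      rw [abs_mul]
      exact mul_le_mul_of_nonneg_left (hM s) (abs_nonneg _)
    exact ⟨h1, by nlinarith⟩
  have hpos : ∀ lam, |lam| ≤ L → ∀ s, 3 / 4 ≤ 1 + lam * z s ∧ 1 + lam * z s ≤ 5 / 4 := by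
    intro lam hlam s
    have := abs_le.1 (hsmall lam hlam s).2
    constructor <;> linarith
  obtain ⟨lam, hlam, hroot⟩ : ∃ lam ∈ Set.Icc (-L) L, ∑ s, z s / (1 + lam * z s) = 0 := by
    have hcont : ContinuousOn (fun lam => ∑ s, z s / (1 + lam * z s)) (Set.Icc (-L) L) := by
      refine continuousOn_finsetSum _ fun s _ => ContinuousOn.div (by fun_prop) (by fun_prop) ?_
      intro lam hlam
      linarith [(hpos lam (abs_le.2 hlam) s).1]
    have hend : ∑ s, z s / (1 + L * z s) ≤ 0 := by
      have h1 : ∑ s, z s / (1 + L * z s) ≤ ∑ s, (z s - 4 / 5 * L * z s ^ 2) := by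
        refine Finset.sum_le_sum fun s _ => ?_
        obtain ⟨h2, h3⟩ := hpos L (abs_of_nonneg hL0).le s
        rw [div_le_iff₀ (by linarith)]
        nlinarith [mul_nonneg (mul_nonneg hL0 (sq_nonneg (z s)))
          (show 0 ≤ 5 / 4 - (1 + L * z s) by linarith)]
      rw [Finset.sum_sub_distrib, ← Finset.mul_sum, ← hS, ← hVdef] at h1
      have h2 : L * V = 2 * |S| := by rw [hL]; field_simp
      linarith [le_abs_self S, abs_nonneg S]
    have hstart : 0 ≤ ∑ s, z s / (1 + -L * z s) := by
      have h1 : ∑ s, (z s + 4 / 5 * L * z s ^ 2) ≤ ∑ s, z s / (1 + -L * z s) := by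
        refine Finset.sum_le_sum fun s _ => ?_
        obtain ⟨h2, h3⟩ := hpos (-L) (by rw [abs_neg, abs_of_nonneg hL0]) s
        rw [le_div_iff₀ (by linarith)]
        nlinarith [mul_nonneg (mul_nonneg hL0 (sq_nonneg (z s)))
          (show 0 ≤ 5 / 4 - (1 + -L * z s) by linarith)]
      rw [Finset.sum_add_distrib, ← Finset.mul_sum, ← hS, ← hVdef] at h1
      have h2 : L * V = 2 * |S| := by rw [hL]; field_simp
      linarith [neg_abs_le S, abs_nonneg S]
    obtain ⟨lam, h1, h2⟩ := intermediate_value_Icc' (by linarith) hcont ⟨hend, hstart⟩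
    exact ⟨lam, h1, h2⟩
  have hlam' : |lam| ≤ L := abs_le.2 hlam
  have hmult : IsMultiplier z lam := ⟨fun s => by linarith [(hpos lam hlam' s).1], hroot⟩
  refine ⟨_, empLogLR_eq hmult, ?_⟩
  set δ := |lam| * M with hδ
  have hδ0 : 0 ≤ δ := by positivity
  have hδε : δ ≤ 2 * ε := by nlinarith
  have hQ : 0 ≤ lam ^ 2 * V := by positivity
  -- Summing z/(1 + u) = z - u z + u² z/(1 + u) with u = lam z shows that the root is S/V up to a
  -- relative error of order δ; 4/3 comes from 1 + u ≥ 3/4.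
  have hd : |S - lam * V| ≤ 4 / 3 * δ * (|lam| * V) := by
    have h1 : S - lam * V = ∑ s, -(lam * (lam * z s) * z s ^ 2 / (1 + lam * z s)) := by
      have h2 : S - lam * V = ∑ s, (z s - lam * z s ^ 2 - z s / (1 + lam * z s)) := by
        rw [Finset.sum_sub_distrib, hroot, Finset.sum_sub_distrib, ← Finset.mul_sum]
        ring
      rw [h2]
      refine Finset.sum_congr rfl fun s _ => ?_
      have hne := (hmult.1 s).ne'
      have h3 : z s / (1 + lam * z s)
          = z s - lam * z s ^ 2 + lam * (lam * z s) * z s ^ 2 / (1 + lam * z s) := by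
        rw [div_eq_iff hne, add_mul, div_mul_cancel₀ _ hne]
        ring
      rw [h3]
      ring
    rw [h1, hVdef, Finset.mul_sum, Finset.mul_sum]
    refine (Finset.abs_sum_le_sum_abs _ _).trans (Finset.sum_le_sum fun s _ => ?_)
    have h2 := (hpos lam hlam' s).1
    rw [abs_neg, abs_div, abs_of_pos (hmult.1 s), div_le_iff₀ (hmult.1 s), abs_mul, abs_mul,
      abs_of_nonneg (sq_nonneg (z s))]
    have h3 := (hsmall lam hlam' s).1
    calc |lam| * |lam * z s| * z s ^ 2 ≤ |lam| * δ * z s ^ 2 := by gcongr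
      _ = 4 / 3 * δ * (|lam| * z s ^ 2) * (3 / 4) := by ring
      _ ≤ _ := by gcongr
  have hlog : |2 * ∑ s, Real.log (1 + lam * z s) - (2 * lam * S - lam ^ 2 * V)|
      ≤ 8 / 3 * δ * (lam ^ 2 * V) := by
    have h1 : 2 * ∑ s, Real.log (1 + lam * z s) - (2 * lam * S - lam ^ 2 * V)
        = 2 * ∑ s, (Real.log (1 + lam * z s) - lam * z s + (lam * z s) ^ 2 / 2) := by
      rw [Finset.sum_add_distrib, Finset.sum_sub_distrib, ← Finset.mul_sum, ← Finset.sum_div]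
      simp only [mul_pow]
      rw [← Finset.mul_sum]
      ring
    rw [h1, abs_mul, abs_two]
    have h2 : |∑ s, (Real.log (1 + lam * z s) - lam * z s + (lam * z s) ^ 2 / 2)|
        ≤ 4 / 3 * δ * (lam ^ 2 * V) := by
      rw [hVdef, Finset.mul_sum, Finset.mul_sum]
      refine (Finset.abs_sum_le_sum_abs _ _).trans (Finset.sum_le_sum fun s _ => ?_)
      obtain ⟨h3, h4⟩ := hsmall lam hlam' s
      refine (abs_log_one_add_sub_sub_le h4).trans ?_
      rw [← mul_pow, mul_assoc]
      gcongr
    linarith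
  -- Completing the square: the quadratic 2 lam S - lam² V is maximal at S/V, so the error in lam
  -- enters only squared.
  have hsq : 2 * lam * S - lam ^ 2 * V - S ^ 2 / V = -((S - lam * V) ^ 2 / V) := by
    field_simp
    ring
  have hd2 : (S - lam * V) ^ 2 / V ≤ 4 / 9 * δ * (lam ^ 2 * V) := by
    rw [div_le_iff₀ hV]
    calc (S - lam * V) ^ 2 = |S - lam * V| ^ 2 := (sq_abs _).symm
      _ ≤ (4 / 3 * δ * (|lam| * V)) ^ 2 := by gcongr
      _ = 16 / 9 * δ * δ * (|lam| ^ 2 * V ^ 2) := by ring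
      _ ≤ 16 / 9 * δ * (1 / 4) * (|lam| ^ 2 * V ^ 2) := by
        gcongr
        linarith
      _ = _ := by rw [sq_abs]; ring
  have hlamV : lam ^ 2 * V ≤ 4 * (S ^ 2 / V) := by
    have h1 : lam ^ 2 ≤ L ^ 2 := by rw [← sq_abs]; gcongr
    calc lam ^ 2 * V ≤ L ^ 2 * V := by gcongr
      _ = 4 * (S ^ 2 / V) := by rw [hL, div_pow, mul_pow, sq_abs]; field_simp; ring
  have hSV : 0 ≤ S ^ 2 / V := by positivity
  have hdiv0 : 0 ≤ (S - lam * V) ^ 2 / V := by positivity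
  have hfin : δ * (lam ^ 2 * V) ≤ 2 * ε * (4 * (S ^ 2 / V)) :=
    mul_le_mul hδε hlamV hQ (by linarith)
  rw [abs_le] at hlog ⊢
  have hδQ : 0 ≤ δ * (lam ^ 2 * V) := by positivity
  constructor <;> nlinarith [hlog.1, hlog.2]

/-- The cross terms are split by 2|x e| ≤ η x² + e²/η, the weight η being matched to a perturbation
of size η g in Euclidean norm. -/
theorem abs_sum_sq_add_sub_le {x e : ι → ℝ} {g η : ℝ} (hη : 0 < η) (hη1 : η ≤ 1)
    (hx2 : |∑ s, x s ^ 2 - g ^ 2| ≤ η * g ^ 2) (he2 : ∑ s, e s ^ 2 ≤ (η * g) ^ 2) :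
    |∑ s, (x s + e s) ^ 2 - ∑ s, x s ^ 2| ≤ 4 * η * g ^ 2 := by
  have hx2' := abs_le.1 hx2
  have h1 : ∑ s, (x s + e s) ^ 2 - ∑ s, x s ^ 2 = ∑ s, (2 * (x s * e s) + e s ^ 2) := by
    rw [← Finset.sum_sub_distrib]
    exact Finset.sum_congr rfl fun s _ => by ring
  have h2 : ∀ s, |2 * (x s * e s) + e s ^ 2| ≤ η * x s ^ 2 + (η⁻¹ + 1) * e s ^ 2 := by
    intro s
    have h3 : 0 ≤ η⁻¹ * (η * x s - e s) ^ 2 := by positivity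
    have h4 : 0 ≤ η⁻¹ * (η * x s + e s) ^ 2 := by positivity
    have h5 : η⁻¹ * (η * x s - e s) ^ 2 = η * x s ^ 2 - 2 * (x s * e s) + η⁻¹ * e s ^ 2 := by
      field_simp
      ring
    have h6 : η⁻¹ * (η * x s + e s) ^ 2 = η * x s ^ 2 + 2 * (x s * e s) + η⁻¹ * e s ^ 2 := by
      field_simp
      ring
    rw [abs_le]
    constructor <;> nlinarith [sq_nonneg (e s)]
  rw [h1]
  calc _ ≤ ∑ s, (η * x s ^ 2 + (η⁻¹ + 1) * e s ^ 2) :=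
        (Finset.abs_sum_le_sum_abs _ _).trans (Finset.sum_le_sum fun s _ => h2 s)
    _ = η * ∑ s, x s ^ 2 + (η⁻¹ + 1) * ∑ s, e s ^ 2 := by
        rw [Finset.sum_add_distrib, ← Finset.mul_sum, ← Finset.mul_sum]
    _ ≤ η * (2 * g ^ 2) + (η⁻¹ + 1) * (η * g) ^ 2 := by
        gcongr
        nlinarith only [sq_nonneg g, hx2'.2, hη1]
    _ = (3 * η + η ^ 2) * g ^ 2 := by field_simp; ring
    _ ≤ _ := by
        gcongr
        nlinarith only [hη, hη1]

/-- Here σ and ν stand for the normalized sum and sum of squares of all data points, and w for the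
ideal normalized sum that σ approximates. -/
theorem abs_sq_div_sub_sq_le {σ ν w β η : ℝ} (hβ1 : 1 ≤ β) (hη : 0 ≤ η) (hw : |w| ≤ β)
    (hνhalf : 1 / 2 ≤ ν) (hσw : |σ - w| ≤ 2 * β * η) (hσβ : |σ| ≤ 2 * β)
    (hν1 : |ν - 1| ≤ 6 * β ^ 2 * η) : |σ ^ 2 / ν - w ^ 2| ≤ 24 * β ^ 4 * η := by
  have h1 : σ ^ 2 / ν - w ^ 2 = ((σ - w) * (σ + w) + w ^ 2 * (1 - ν)) / ν := by
    have : ν ≠ 0 := by linarith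
    field_simp
    ring
  have h2 : |(σ - w) * (σ + w) + w ^ 2 * (1 - ν)| ≤ 12 * β ^ 4 * η := by
    have h3 : |σ + w| ≤ 3 * β := (abs_add_le _ _).trans (by linarith)
    have h4 : w ^ 2 ≤ β ^ 2 := by
      rw [← sq_abs]
      gcongr
    have h5 : β ^ 2 ≤ β ^ 4 := pow_le_pow_right₀ hβ1 (by norm_num)
    calc _ ≤ |σ - w| * |σ + w| + w ^ 2 * |1 - ν| := by
          refine (abs_add_le _ _).trans (le_of_eq ?_)
          rw [abs_mul, abs_mul, abs_of_nonneg (sq_nonneg w)]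
      _ ≤ 2 * β * η * (3 * β) + β ^ 2 * (6 * β ^ 2 * η) := by
          rw [abs_sub_comm 1 ν]
          gcongr
      _ = 6 * β ^ 2 * η + 6 * β ^ 4 * η := by ring
      _ ≤ 6 * β ^ 4 * η + 6 * β ^ 4 * η := by gcongr
      _ = _ := by ring
  have hνpos : 0 < ν := by linarith
  rw [h1, abs_div, abs_of_pos hνpos, div_le_iff₀ hνpos]
  have h6 : 0 ≤ β ^ 4 * η := by positivity
  nlinarith

set_option maxHeartbeats 400000 in
/-- Quadratic approximation for data of the form `γ (x + e)`, with `e` a small perturbation,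
together with a pseudo-point proportional to their sum. -/
theorem empLogLR_perturbed_approx {z : Option ι → ℝ} {x e : ι → ℝ} {γ b g w β η : ℝ}
    (hγ : 0 < γ) (hg : 0 < g) (hη : 0 < η) (hβ : |w| + 1 ≤ β) (hβη : 96 * β ^ 2 * η ≤ 1)
    (hz : ∀ s, z (some s) = γ * (x s + e s)) (hz0 : z none = -b * ∑ s, z (some s))
    (hb : |b| ≤ η) (hw : ∑ s, x s = w * g) (hx2 : |∑ s, x s ^ 2 - g ^ 2| ≤ η * g ^ 2)
    (hx4 : ∀ s, |x s| ≤ η * g) (he : |∑ s, e s| ≤ η * g) (he2 : ∑ s, e s ^ 2 ≤ (η * g) ^ 2) :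
    ∃ Y : ℝ, empLogLR z = Y ∧ |Y - w ^ 2| ≤ 4000 * β ^ 4 * η := by
  have hw0 := abs_nonneg w
  have hβ1 : 1 ≤ β := by linarith
  have hβsq : 1 ≤ β ^ 2 := one_le_pow₀ hβ1
  have hη1 : η ≤ 1 / 96 := by nlinarith only [hβη, hβsq, hη]
  set E := ∑ s, e s with hE
  set T := w * g + E with hT
  have hsum : ∑ s, z (some s) = γ * T := by
    simp only [hz]
    rw [← Finset.mul_sum, Finset.sum_add_distrib, hw]
  -- The pseudo-point changes the total only by the factor 1 - b.
  have hS : ∑ s, z s = γ * ((1 - b) * T) := by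
    rw [Fintype.sum_option, hz0, hsum]
    ring
  have hTg : |T| ≤ β * g := by
    calc |T| ≤ |w| * g + η * g := (abs_add_le _ _).trans (by rw [abs_mul, abs_of_pos hg]; gcongr)
      _ = (|w| + η) * g := by ring
      _ ≤ β * g := by gcongr; linarith
  set Q := ∑ s, (x s + e s) ^ 2 with hQ
  have hVeq : ∑ s, z s ^ 2 = γ ^ 2 * (Q + b ^ 2 * T ^ 2) := by
    rw [Fintype.sum_option, hz0, hsum]
    simp only [hz, mul_pow]
    rw [← Finset.mul_sum]
    ring
  have hx2' := abs_le.1 hx2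
  have hQle : |Q - ∑ s, x s ^ 2| ≤ 4 * η * g ^ 2 := abs_sum_sq_add_sub_le hη (by linarith) hx2 he2
  set ν := (Q + b ^ 2 * T ^ 2) / g ^ 2 with hν
  have hg2 : 0 < g ^ 2 := by positivity
  have hbT : b ^ 2 * T ^ 2 ≤ η * β ^ 2 * g ^ 2 := by
    have h1 : b ^ 2 ≤ η ^ 2 := by rw [← sq_abs]; gcongr
    have h2 : T ^ 2 ≤ (β * g) ^ 2 := by rw [← sq_abs]; gcongr
    calc b ^ 2 * T ^ 2 ≤ η ^ 2 * (β * g) ^ 2 := by gcongr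
      _ = η * (η * β ^ 2 * g ^ 2) := by ring
      _ ≤ 1 * (η * β ^ 2 * g ^ 2) := by gcongr; linarith
      _ = _ := one_mul _
  have hν1 : |ν - 1| ≤ 6 * β ^ 2 * η := by
    have h1 : ν - 1 = (Q + b ^ 2 * T ^ 2 - g ^ 2) / g ^ 2 := by rw [hν]; field_simp
    rw [h1, abs_div, abs_of_pos hg2, div_le_iff₀ hg2, abs_le]
    have h2 := abs_le.1 hQle
    have h3 : η * g ^ 2 ≤ β ^ 2 * (η * g ^ 2) := le_mul_of_one_le_left (by positivity) hβsq
    have h4 : 0 ≤ b ^ 2 * T ^ 2 := by positivity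
    constructor <;> linarith
  have hν1' := abs_le.1 hν1
  have hνhalf : 1 / 2 ≤ ν := by linarith
  have hVν : ∑ s, z s ^ 2 = γ ^ 2 * g ^ 2 * ν := by rw [hVeq, hν]; field_simp
  have hb1 : |1 - b| ≤ 2 := by
    refine (abs_sub _ _).trans ?_
    rw [abs_one]
    linarith
  have hβη2 : η * β ≤ 1 := by nlinarith only [hβη, hβ1, hη, mul_nonneg hη.le (sub_nonneg.2 hβ1)]
  -- An ordinary point is at most 2 γ η g and the pseudo-point at most γ η β g.
  have hM : ∀ s, |z s| ≤ γ * (3 * β * η * g) := by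
    intro s
    have hβg : η * g ≤ β * (η * g) := le_mul_of_one_le_left (by positivity) hβ1
    cases s with
    | none =>
      rw [hz0, hsum, abs_mul, abs_neg, abs_mul, abs_of_pos hγ, mul_left_comm]
      refine mul_le_mul_of_nonneg_left ?_ hγ.le
      calc |b| * |T| ≤ η * (β * g) := by gcongr
        _ ≤ _ := by linarith only [show 0 ≤ β * η * g by positivity]
    | some s =>
      rw [hz, abs_mul, abs_of_pos hγ]
      refine mul_le_mul_of_nonneg_left ?_ hγ.le
      have h1 : |e s| ≤ η * g := by
        refine abs_le_of_sq_le_sq ?_ (by positivity)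
        exact (Finset.single_le_sum (f := fun s => e s ^ 2) (fun s _ => sq_nonneg _)
          (Finset.mem_univ s)).trans he2
      calc |x s + e s| ≤ η * g + η * g := (abs_add_le _ _).trans (add_le_add (hx4 s) h1)
        _ ≤ _ := by linarith only [show 0 ≤ η * g by positivity, hβg]
  have hMS : γ * (3 * β * η * g) * |∑ s, z s| ≤ 12 * β ^ 2 * η * ∑ s, z s ^ 2 := by
    rw [hS, hVν, abs_mul, abs_mul, abs_of_pos hγ]
    calc γ * (3 * β * η * g) * (γ * (|1 - b| * |T|))
        ≤ γ * (3 * β * η * g) * (γ * (2 * (β * g))) := by gcongr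
      _ = 12 * β ^ 2 * η * (γ ^ 2 * g ^ 2 * (1 / 2)) := by ring
      _ ≤ _ := by gcongr
  obtain ⟨Y, hY, hYapp⟩ := empLogLR_approx (z := z) (M := γ * (3 * β * η * g))
    (ε := 12 * β ^ 2 * η) (by rw [hVν]; positivity) hM hMS (by linarith)
  refine ⟨Y, hY, ?_⟩
  set σ := (1 - b) * T / g with hσ
  have hratio : (∑ s, z s) ^ 2 / ∑ s, z s ^ 2 = σ ^ 2 / ν := by
    rw [hS, hVν, hσ]
    field_simp
  rw [hratio] at hYapp
  have hσw : |σ - w| ≤ 2 * β * η := by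
    have h1 : σ - w = (E - b * T) / g := by
      rw [hσ, hT]
      field_simp
      ring
    rw [h1, abs_div, abs_of_pos hg, div_le_iff₀ hg]
    calc |E - b * T| ≤ η * g + η * (β * g) := by
          refine (abs_sub _ _).trans (add_le_add he ?_)
          rw [abs_mul]
          gcongr
      _ ≤ _ := by
        have := mul_le_mul_of_nonneg_right hβ1 (mul_pos hη hg).le
        linarith
  have hσβ : |σ| ≤ 2 * β := by
    rw [hσ, abs_div, abs_mul, abs_of_pos hg, div_le_iff₀ hg]
    calc |1 - b| * |T| ≤ 2 * (β * g) := by gcongr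
      _ = _ := by ring
  have hσν : σ ^ 2 / ν ≤ 8 * β ^ 2 := by
    rw [div_le_iff₀ (by linarith)]
    have : σ ^ 2 ≤ (2 * β) ^ 2 := by rw [← sq_abs]; gcongr
    nlinarith only [this, hνhalf, sq_nonneg β]
  have hmain := abs_sq_div_sub_sq_le hβ1 hη.le (by linarith) hνhalf hσw hσβ hν1
  have hfirst : |Y - σ ^ 2 / ν| ≤ 3072 * β ^ 4 * η := by
    refine hYapp.trans ?_
    calc 32 * (12 * β ^ 2 * η) * (σ ^ 2 / ν) ≤ 32 * (12 * β ^ 2 * η) * (8 * β ^ 2) := by gcongr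
      _ = _ := by ring
  have h7 : 0 ≤ β ^ 4 * η := by positivity
  calc |Y - w ^ 2| ≤ |Y - σ ^ 2 / ν| + |σ ^ 2 / ν - w ^ 2| := abs_sub_le _ _ _
    _ ≤ _ := by linarith

end EmpiricalLikelihood

/-! ### Rényi's representation of exponential order statistics -/

section Renyi

/-- The entries of a vector, in descending order. -/
noncomputable def descSort {m : ℕ} (v : Fin m → ℝ) (j : Fin m) : ℝ := v (Tuple.sort v j.rev)

/-- Rényi's sums: the descending exponential order statistics in terms of normalized spacings. -/
noncomputable def renyiSum {m : ℕ} (g : Fin m → ℝ) (j : Fin m) : ℝ :=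
  ∑ l, if j ≤ l then g l / ((l : ℝ) + 1) else 0

instance isProbabilityMeasure_expMeasure_one : IsProbabilityMeasure (expMeasure 1) :=
  isProbabilityMeasure_expMeasure one_pos

/-- The sorting permutation itself depends on the vector, so one counts instead: an order statistic
is at most c exactly when sufficiently many coordinates are, which is a finite union over index
sets. -/
theorem measurable_descSort {m : ℕ} : Measurable (descSort : (Fin m → ℝ) → Fin m → ℝ) := by
  refine measurable_pi_lambda _ fun j => measurable_of_Iic fun c => ?_
  have h : (fun v : Fin m → ℝ => descSort v j) ⁻¹' Set.Iic c
      = ⋃ t ∈ {t : Finset (Fin m) | (j.rev : ℕ) < t.card},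
        ⋂ i ∈ t, {v : Fin m → ℝ | v i ≤ c} := by
    ext v
    have h1 := Tuple.lt_card_le_iff_apply_le_of_monotone (j := j.rev) (a := c)
      (Tuple.monotone_sort v)
    have h2 : (Finset.univ.filter fun i => (v ∘ Tuple.sort v) i ≤ c).card
        = (Finset.univ.filter fun i => v i ≤ c).card := by
      refine Finset.card_equiv (Tuple.sort v) fun i => ?_
      simp
    rw [h2] at h1
    simp only [Set.mem_preimage, Set.mem_Iic, Set.mem_iUnion, Set.mem_iInter]
    constructor
    · intro h
      exact ⟨_, h1.2 h, fun i hi => (Finset.mem_filter.1 hi).2⟩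
    · rintro ⟨t, ht, hc⟩
      refine h1.1 (lt_of_lt_of_le ht (Finset.card_le_card fun i hi => ?_))
      exact Finset.mem_filter.2 ⟨Finset.mem_univ _, hc i hi⟩
  rw [h]
  refine MeasurableSet.biUnion (Set.to_countable _) fun t _ => ?_
  exact MeasurableSet.biInter (Set.to_countable _) fun i _ =>
    measurableSet_le (measurable_pi_apply i) measurable_const

theorem measurable_renyiSum {m : ℕ} : Measurable (renyiSum : (Fin m → ℝ) → Fin m → ℝ) := by
  refine measurable_pi_lambda _ fun j => Finset.measurable_fun_sum _ fun l _ => ?_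
  split_ifs <;> fun_prop

/-- The joint density of independent standard exponential variables. -/
theorem pi_expMeasure_eq_withDensity (m : ℕ) :
    Measure.pi (fun _ : Fin m => expMeasure 1)
      = (volume : Measure (Fin m → ℝ)).withDensity fun v => ∏ i, exponentialPDF 1 (v i) := by
  refine (Measure.pi_eq fun s hs => ?_)
  have hint : Integrable (exponentialPDFReal 1) volume := by
    refine ⟨(measurable_exponentialPDFReal 1).aestronglyMeasurable, ?_⟩
    rw [hasFiniteIntegral_iff_ofReal (.of_forall (exponentialPDFReal_nonneg one_pos))]
    exact (lintegral_exponentialPDF_eq_one one_pos).trans_lt ENNReal.one_lt_top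
  have hind : ∀ i, Integrable ((s i).indicator (exponentialPDFReal 1)) volume :=
    fun i => hint.indicator (hs i)
  have hnn : ∀ i x, 0 ≤ (s i).indicator (exponentialPDFReal 1) x := fun i x =>
    Set.indicator_nonneg (fun y _ => exponentialPDFReal_nonneg one_pos y) x
  rw [withDensity_apply _ (.univ_pi hs), ← lintegral_indicator (.univ_pi hs)]
  have h1 : (Set.univ.pi s).indicator (fun v : Fin m → ℝ => ∏ i, exponentialPDF 1 (v i))
      = fun v => ENNReal.ofReal (∏ i, (s i).indicator (exponentialPDFReal 1) (v i)) := by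
    ext v
    rw [ENNReal.ofReal_prod_of_nonneg fun i _ => hnn i _]
    by_cases hv : v ∈ Set.univ.pi s
    · rw [Set.indicator_of_mem hv]
      refine Finset.prod_congr rfl fun i _ => ?_
      rw [Set.indicator_of_mem (hv i (Set.mem_univ i))]
      rfl
    · rw [Set.indicator_of_notMem hv]
      simp only [Set.mem_univ_pi, not_forall] at hv
      obtain ⟨i, hi⟩ := hv
      refine (Finset.prod_eq_zero (Finset.mem_univ i) ?_).symm
      rw [Set.indicator_of_notMem hi, ENNReal.ofReal_zero]
  have hI : Integrable (fun v : Fin m → ℝ => ∏ i, (s i).indicator (exponentialPDFReal 1) (v i))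
      volume := Integrable.fintype_prod hind
  rw [h1, ← ofReal_integral_eq_lintegral_ofReal hI
    (.of_forall fun v => Finset.prod_nonneg fun i _ => hnn i _),
    integral_fintype_prod_volume_eq_prod,
    ENNReal.ofReal_prod_of_nonneg fun i _ => integral_nonneg (hnn i)]
  refine Finset.prod_congr rfl fun i _ => ?_
  rw [ofReal_integral_eq_lintegral_ofReal (hind i) (.of_forall (hnn i))]
  have h2 : (fun x => ENNReal.ofReal ((s i).indicator (exponentialPDFReal 1) x))
      = (s i).indicator (exponentialPDF 1) := by
    ext x
    by_cases hx : x ∈ s i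
    · rw [Set.indicator_of_mem hx, Set.indicator_of_mem hx]
      rfl
    · rw [Set.indicator_of_notMem hx, Set.indicator_of_notMem hx, ENNReal.ofReal_zero]
  rw [h2, lintegral_indicator (hs i)]
  exact (withDensity_apply _ (hs i)).symm

/-- Ties lie on the hyperplanes v i = v j, proper subspaces and hence Lebesgue-null. -/
theorem ae_injective (m : ℕ) :
    ∀ᵐ v ∂(volume : Measure (Fin m → ℝ)), Function.Injective v := by
  have h : ∀ i j : Fin m, i ≠ j → ∀ᵐ v ∂(volume : Measure (Fin m → ℝ)), v i ≠ v j := by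
    intro i j hij
    set W : Submodule ℝ (Fin m → ℝ) :=
      LinearMap.ker (LinearMap.proj (R := ℝ) (φ := fun _ : Fin m => ℝ) i - LinearMap.proj j)
    have hW : W ≠ ⊤ := by
      intro htop
      have : Pi.single i (1 : ℝ) ∈ W := by rw [htop]; trivial
      simp [W, LinearMap.mem_ker, hij] at this
    rw [ae_iff]
    refine measure_mono_null (fun v hv => ?_) (Measure.addHaar_submodule volume W hW)
    have hv' : v i = v j := not_not.1 hv
    simp [W, LinearMap.mem_ker, hv']
  have h' : ∀ᵐ v ∂(volume : Measure (Fin m → ℝ)), ∀ i j, i ≠ j → v i ≠ v j := by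
    simp only [ae_all_iff]
    exact h
  filter_upwards [h'] with v hv i j hij
  by_contra hne
  exact hv i j hne hij

theorem ae_coord_ne_zero (m : ℕ) :
    ∀ᵐ v ∂(volume : Measure (Fin m → ℝ)), ∀ i, v i ≠ 0 := by
  rw [ae_all_iff]
  intro i
  set W : Submodule ℝ (Fin m → ℝ) :=
    LinearMap.ker (LinearMap.proj (R := ℝ) (φ := fun _ : Fin m => ℝ) i)
  have hW : W ≠ ⊤ := by
    intro htop
    have : Pi.single i (1 : ℝ) ∈ W := by rw [htop]; trivial
    simp [W, LinearMap.mem_ker] at this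
  rw [ae_iff]
  refine measure_mono_null (fun v hv => ?_) (Measure.addHaar_submodule volume W hW)
  have hv' : v i = 0 := not_not.1 hv
  simp [W, LinearMap.mem_ker, hv']

theorem strictAnti_descSort {m : ℕ} {v : Fin m → ℝ} (hv : Function.Injective v) :
    StrictAnti (descSort v) := by
  have h : StrictMono (v ∘ Tuple.sort v) :=
    (Tuple.monotone_sort v).strictMono_of_injective (hv.comp (Tuple.sort v).injective)
  intro i j hij
  exact h (Fin.rev_lt_rev.2 hij)

open Classical in
/-- Exactly one permutation puts a vector with distinct entries into descending order. -/
theorem sum_perm_strictAnti {m : ℕ} {v : Fin m → ℝ} (hv : Function.Injective v)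
    (φ : (Fin m → ℝ) → ENNReal) :
    ∑ σ : Equiv.Perm (Fin m), (if StrictAnti (v ∘ σ) then φ (v ∘ σ) else 0) = φ (descSort v) := by
  have h0 : v ∘ (Fin.revPerm.trans (Tuple.sort v)) = descSort v := rfl
  rw [Finset.sum_eq_single (Fin.revPerm.trans (Tuple.sort v))]
  · rw [h0, if_pos (strictAnti_descSort hv)]
  · intro σ _ hσ
    refine if_neg fun h => hσ ?_
    have h1 := Tuple.unique_antitone h.antitone
      (τ := Fin.revPerm.trans (Tuple.sort v)) (strictAnti_descSort hv).antitone
    refine Equiv.ext fun i => hv ?_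
    exact congrFun h1 i
  · simp

/-- The matrix of Rényi's linear transformation. -/
noncomputable def renyiMatrix (m : ℕ) : Matrix (Fin m) (Fin m) ℝ :=
  fun j l => if j ≤ l then 1 / ((l : ℝ) + 1) else 0

theorem toLin'_renyiMatrix {m : ℕ} (g : Fin m → ℝ) :
    Matrix.toLin' (renyiMatrix m) g = renyiSum g := by
  ext j
  simp only [Matrix.toLin'_apply, Matrix.mulVec, dotProduct, renyiMatrix, renyiSum]
  refine Finset.sum_congr rfl fun l _ => ?_
  split_ifs <;> ring

/-- The matrix is upper triangular with diagonal 1/(l + 1). This Jacobian cancels the m! orderings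
of a sample. -/
theorem det_renyiMatrix (m : ℕ) : (renyiMatrix m).det = ((m.factorial : ℕ) : ℝ)⁻¹ := by
  rw [Matrix.det_of_isUpperTriangular]
  · simp only [renyiMatrix, le_refl, if_true, one_div]
    rw [Finset.prod_inv_distrib, Fin.prod_univ_eq_prod_range (fun l => (l : ℝ) + 1) m,
      ← Finset.prod_range_add_one_eq_factorial]
    push_cast
    rfl
  · intro i j hij
    exact if_neg (not_le.2 hij)

theorem lintegral_eq_lintegral_renyiSum {m : ℕ} {f : (Fin m → ℝ) → ENNReal} (hf : Measurable f) :
    (m.factorial : ENNReal) * ∫⁻ v, f v = ∫⁻ g, f (renyiSum g) := by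
  have hdet : (renyiMatrix m).det ≠ 0 := by
    rw [det_renyiMatrix]
    positivity
  have h := Real.map_matrix_volume_pi_eq_smul_volume_pi hdet
  have hT : (Matrix.toLin' (renyiMatrix m) : (Fin m → ℝ) → Fin m → ℝ) = renyiSum :=
    funext toLin'_renyiMatrix
  rw [hT, det_renyiMatrix, inv_inv, abs_of_nonneg (by positivity), ENNReal.ofReal_natCast] at h
  rw [← lintegral_map hf measurable_renyiSum, h, lintegral_smul_measure, smul_eq_mul]

theorem renyiSum_eq_add {m : ℕ} (g : Fin m → ℝ) (j : Fin m) :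
    renyiSum g j = g j / ((j : ℝ) + 1) + ∑ l, if j < l then g l / ((l : ℝ) + 1) else 0 := by
  have h : ∀ l, (if j ≤ l then g l / ((l : ℝ) + 1) else 0)
      = (if l = j then g l / ((l : ℝ) + 1) else 0)
        + (if j < l then g l / ((l : ℝ) + 1) else 0) := by
    intro l
    rcases lt_trichotomy j l with h | rfl | h
    · simp [h, h.le, h.ne']
    · simp
    · simp [h.ne, not_le.2 h, h.le]
  simp only [renyiSum, h, Finset.sum_add_distrib]
  simp

theorem renyiSum_nonneg {m : ℕ} {g : Fin m → ℝ} (hg : ∀ l, 0 ≤ g l) (j : Fin m) :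
    0 ≤ renyiSum g j := by
  refine Finset.sum_nonneg fun l _ => ?_
  have := hg l
  split_ifs <;> positivity

theorem strictAnti_renyiSum {m : ℕ} {g : Fin m → ℝ} (hg : ∀ l, 0 < g l) :
    StrictAnti (renyiSum g) := by
  intro i j hij
  rw [renyiSum_eq_add g i, renyiSum]
  have h1 : 0 < g i / ((i : ℝ) + 1) := div_pos (hg i) (by positivity)
  have h2 : (∑ l, if j ≤ l then g l / ((l : ℝ) + 1) else 0)
      ≤ ∑ l, if i < l then g l / ((l : ℝ) + 1) else 0 := by
    refine Finset.sum_le_sum fun l _ => ?_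
    have : 0 ≤ g l / ((l : ℝ) + 1) := div_nonneg (hg l).le (by positivity)
    by_cases h : j ≤ l
    · rw [if_pos h, if_pos (hij.trans_le h)]
    · rw [if_neg h]
      split_ifs <;> simp [this]
  linarith

/-- The term g l/(l + 1) occurs in exactly l + 1 of the sums. The joint exponential density on the
positive orthant depends only on the coordinate sum, so the transformation preserves it. -/
theorem sum_renyiSum {m : ℕ} (g : Fin m → ℝ) : ∑ j, renyiSum g j = ∑ l, g l := by
  simp only [renyiSum]
  rw [Finset.sum_comm]
  refine Finset.sum_congr rfl fun l _ => ?_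
  rw [← Finset.sum_filter, Finset.sum_const, nsmul_eq_mul]
  have : (Finset.univ.filter fun j => j ≤ l) = Finset.Iic l := by ext; simp
  rw [this, Fin.card_Iic]
  push_cast
  field_simp

/-- g l/(l + 1) is the gap between consecutive sums, or the last sum itself. Thus only spacings from
the positive orthant give descending nonnegative vectors. -/
theorem nonneg_of_strictAnti_renyiSum {m : ℕ} {g : Fin m → ℝ} (h : StrictAnti (renyiSum g))
    (h0 : ∀ j, 0 ≤ renyiSum g j) (l : Fin m) : 0 ≤ g l := by
  have hl : (0 : ℝ) < (l : ℝ) + 1 := by positivity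
  suffices 0 ≤ g l / ((l : ℝ) + 1) by
    have h1 := mul_nonneg this hl.le
    rwa [div_mul_cancel₀ _ hl.ne'] at h1
  have h1 := renyiSum_eq_add g l
  by_cases hlast : (l : ℕ) + 1 < m
  · set l' : Fin m := ⟨l + 1, hlast⟩ with hl'
    have h2 : (∑ k, if l < k then g k / ((k : ℝ) + 1) else 0) = renyiSum g l' := by
      refine Finset.sum_congr rfl fun k _ => ?_
      have : l < k ↔ l' ≤ k := by rw [Fin.lt_def, Fin.le_def]; exact Nat.lt_iff_add_one_le
      simp only [this]
    have h3 : renyiSum g l' < renyiSum g l := h (Fin.lt_def.2 (Nat.lt_succ_self _))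
    linarith
  · have h2 : (∑ k, if l < k then g k / ((k : ℝ) + 1) else 0) = 0 := by
      refine Finset.sum_eq_zero fun k _ => if_neg fun hk => ?_
      have := Fin.lt_def.1 hk
      have := k.2
      omega
    linarith [h0 l]

theorem prod_exponentialPDF_of_nonneg {m : ℕ} {v : Fin m → ℝ} (hv : ∀ i, 0 ≤ v i) :
    ∏ i, exponentialPDF 1 (v i) = ENNReal.ofReal (Real.exp (-∑ i, v i)) := by
  rw [← Finset.sum_neg_distrib, Real.exp_sum,
    ENNReal.ofReal_prod_of_nonneg fun i _ => (Real.exp_pos _).le]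
  refine Finset.prod_congr rfl fun i _ => ?_
  rw [exponentialPDF_of_nonneg (hv i), one_mul, one_mul]

theorem prod_exponentialPDF_of_neg {m : ℕ} {v : Fin m → ℝ} {i : Fin m} (hi : v i < 0) :
    ∏ i, exponentialPDF 1 (v i) = 0 :=
  Finset.prod_eq_zero (Finset.mem_univ i) (exponentialPDF_of_neg hi)

-- The density restricted to the descending cone, pulled back to spacings, is again the product
-- density. Zero coordinates are excluded because there the sums are no longer strictly descending;
-- they form a null set.
open Classical in
theorem strictAnti_density_renyiSum {m : ℕ} {g : Fin m → ℝ} (hg : ∀ l, g l ≠ 0) :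
    (if StrictAnti (renyiSum g) then ∏ i, exponentialPDF 1 (renyiSum g i) else 0)
      = ∏ i, exponentialPDF 1 (g i) := by
  by_cases hpos : ∀ l, 0 ≤ g l
  · have hpos' : ∀ l, 0 < g l := fun l => lt_of_le_of_ne (hpos l) (hg l).symm
    rw [if_pos (strictAnti_renyiSum hpos'), prod_exponentialPDF_of_nonneg hpos,
      prod_exponentialPDF_of_nonneg (renyiSum_nonneg hpos), sum_renyiSum]
  · have hneg := hpos
    push Not at hneg
    obtain ⟨l, hl⟩ := hneg
    rw [prod_exponentialPDF_of_neg hl]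
    split_ifs with h
    · by_cases h0 : ∀ j, 0 ≤ renyiSum g j
      · exact absurd (nonneg_of_strictAnti_renyiSum h h0) hpos
      · push Not at h0
        obtain ⟨j, hj⟩ := h0
        exact prod_exponentialPDF_of_neg hj
    · rfl

theorem measurableSet_strictAnti (m : ℕ) : MeasurableSet {v : Fin m → ℝ | StrictAnti v} := by
  have : {v : Fin m → ℝ | StrictAnti v}
      = ⋂ i : Fin m, ⋂ j : Fin m, ⋂ _ : i < j, {v | v j < v i} := by
    ext v
    simp only [Set.mem_iInter]
    exact ⟨fun h i j hij => h hij, fun h i j hij => h i j hij⟩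
  rw [this]
  exact MeasurableSet.iInter fun i => MeasurableSet.iInter fun j => MeasurableSet.iInter fun _ =>
    measurableSet_lt (measurable_pi_apply j) (measurable_pi_apply i)

theorem map_perm_pi {m : ℕ} (μ : Measure ℝ) [IsProbabilityMeasure μ] (σ : Equiv.Perm (Fin m)) :
    (Measure.pi fun _ : Fin m => μ).map (fun v => v ∘ σ) = Measure.pi fun _ : Fin m => μ := by
  have h := Measure.map_infinitePi_infinitePi_of_inj (P := fun _ : Fin m => μ) σ.injective
  rwa [Measure.infinitePi_eq_pi] at h

open Classical in
/-- **Rényi's representation**: the descending order statistics of independent standard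
exponential variables have the joint law of the sums of their normalized spacings. -/
theorem map_descSort_eq_map_renyiSum (m : ℕ) :
    (Measure.pi fun _ : Fin m => expMeasure 1).map descSort
      = (Measure.pi fun _ : Fin m => expMeasure 1).map renyiSum := by
  have hpdf : Measurable (exponentialPDF 1) := (measurable_exponentialPDFReal 1).ennreal_ofReal
  have hf : Measurable fun v : Fin m → ℝ => ∏ i, exponentialPDF 1 (v i) :=
    Finset.measurable_fun_prod _ fun i _ => hpdf.comp (measurable_pi_apply i)
  refine Measure.ext_of_lintegral _ fun φ hφ => ?_
  rw [lintegral_map hφ measurable_descSort, lintegral_map hφ measurable_renyiSum]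
  set ψ : (Fin m → ℝ) → ENNReal := fun v => if StrictAnti v then φ v else 0 with hψdef
  have hψ : Measurable ψ := Measurable.ite (measurableSet_strictAnti m) hφ measurable_const
  have hac : ∀ᵐ v ∂(Measure.pi fun _ : Fin m => expMeasure 1), Function.Injective v := by
    rw [pi_expMeasure_eq_withDensity]
    exact (withDensity_absolutelyContinuous _ _).ae_le (ae_injective m)
  -- Almost surely exactly one permutation sorts the sample, and by exchangeability all m!
  -- permutations contribute equally.
  have h1 : ∫⁻ v, φ (descSort v) ∂(Measure.pi fun _ : Fin m => expMeasure 1)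
      = (m.factorial : ENNReal) * ∫⁻ v, ψ v ∂(Measure.pi fun _ : Fin m => expMeasure 1) := by
    have h2 : ∫⁻ v, φ (descSort v) ∂(Measure.pi fun _ : Fin m => expMeasure 1)
        = ∫⁻ v, ∑ σ : Equiv.Perm (Fin m), ψ (v ∘ σ)
          ∂(Measure.pi fun _ : Fin m => expMeasure 1) := by
      refine lintegral_congr_ae ?_
      filter_upwards [hac] with v hv
      exact (sum_perm_strictAnti hv φ).symm
    have hcomp : ∀ σ : Equiv.Perm (Fin m), Measurable fun v : Fin m → ℝ => v ∘ σ := fun σ =>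
      measurable_pi_lambda _ fun i => measurable_pi_apply (σ i)
    have hψc : ∀ σ : Equiv.Perm (Fin m), Measurable fun v => ψ (v ∘ σ) := fun σ =>
      hψ.comp (hcomp σ)
    rw [h2, lintegral_finsetSum _ fun σ _ => hψc σ]
    have h3 : ∀ σ : Equiv.Perm (Fin m),
        ∫⁻ v, ψ (v ∘ σ) ∂(Measure.pi fun _ : Fin m => expMeasure 1)
          = ∫⁻ v, ψ v ∂(Measure.pi fun _ : Fin m => expMeasure 1) := fun σ => by
      rw [← lintegral_map hψ (hcomp σ), map_perm_pi]
    simp only [h3, Finset.sum_const, Finset.card_univ, Fintype.card_perm, Fintype.card_fin,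
      nsmul_eq_mul]
  have hφr : Measurable fun g : Fin m → ℝ => φ (renyiSum g) := hφ.comp measurable_renyiSum
  rw [h1, pi_expMeasure_eq_withDensity, lintegral_withDensity_eq_lintegral_mul _ hf hψ,
    lintegral_withDensity_eq_lintegral_mul _ hf hφr,
    lintegral_eq_lintegral_renyiSum (hf.mul hψ)]
  refine lintegral_congr_ae ?_
  filter_upwards [ae_coord_ne_zero m] with g hg
  simp only [Pi.mul_apply, hψdef]
  rw [← strictAnti_density_renyiSum hg]
  split_ifs <;> simp

end Renyi

/-! ### The joint law of the block order statistics -/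

section BlockLaw

/-- If q creates ties, the sorting permutations of the two vectors may differ; but both arrangements
are descending rearrangements of one vector, and such an arrangement is unique. Hence no continuity
of the distribution function is needed. -/
theorem descSort_comp_of_monotone {m : ℕ} {q : ℝ → ℝ} (hq : Monotone q) (v : Fin m → ℝ) :
    descSort (fun i => q (v i)) = fun j => q (descSort v j) := by
  have h1 : Antitone ((fun i => q (v i)) ∘
      (Fin.revPerm.trans (Tuple.sort fun i => q (v i)) : Equiv.Perm (Fin m))) := fun i j hij =>
    Tuple.monotone_sort (fun i => q (v i)) (Fin.rev_le_rev.2 hij)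
  have h2 : Antitone ((fun i => q (v i)) ∘
      (Fin.revPerm.trans (Tuple.sort v) : Equiv.Perm (Fin m))) := fun i j hij =>
    hq (Tuple.monotone_sort v (Fin.rev_le_rev.2 hij))
  exact Tuple.unique_antitone h1 h2

/-- The law of an array of independent standard exponential variables. -/
noncomputable def expArray : Measure (ℕ × ℕ → ℝ) := Measure.infinitePi fun _ => expMeasure 1

instance : IsProbabilityMeasure expArray := by
  unfold expArray
  infer_instance

theorem map_descSort_pi {μ : Measure ℝ} [IsProbabilityMeasure μ] {q : ℝ → ℝ} (hq : Monotone q)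
    (hqμ : (expMeasure 1).map q = μ) (m : ℕ) :
    (Measure.pi fun _ : Fin m => μ).map descSort
      = (Measure.pi fun _ : Fin m => expMeasure 1).map fun g j => q (renyiSum g j) := by
  have hqm := hq.measurable
  have hcomp : Measurable fun (v : Fin m → ℝ) i => q (v i) :=
    measurable_pi_lambda _ fun i => hqm.comp (measurable_pi_apply i)
  have h1 : (Measure.pi fun _ : Fin m => μ)
      = (Measure.pi fun _ : Fin m => expMeasure 1).map fun v i => q (v i) := by
    have : SigmaFinite ((expMeasure 1).map q) := by rw [hqμ]; infer_instance
    rw [Measure.pi_map_pi fun _ => hqm.aemeasurable, hqμ]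
  rw [h1, Measure.map_map measurable_descSort hcomp]
  have h2 : (descSort ∘ fun (v : Fin m → ℝ) i => q (v i))
      = (fun v i => q (v i)) ∘ (descSort : (Fin m → ℝ) → Fin m → ℝ) :=
    funext fun v => descSort_comp_of_monotone hq v
  rw [h2, ← Measure.map_map hcomp measurable_descSort, map_descSort_eq_map_renyiSum,
    Measure.map_map hcomp measurable_renyiSum]
  rfl

/-- Only injectivity of the indexing matters, so the lemma serves both the consecutive blocks of a
sequence and the rows of a double array. -/
theorem map_blocks_infinitePi {α : Type*} {κ : Type*} {m k : ℕ} (μ : Measure ℝ)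
    [IsProbabilityMeasure μ] [MeasurableSpace α] {f : Fin k × Fin m → κ}
    (hf : Function.Injective f) {T : (Fin m → ℝ) → α} (hT : Measurable T) :
    (Measure.infinitePi fun _ : κ => μ).map (fun x (i : Fin k) => T fun l => x (f (i, l)))
      = Measure.infinitePi fun _ : Fin k => (Measure.pi fun _ : Fin m => μ).map T := by
  have h1 := Measure.map_infinitePi_infinitePi_of_inj (P := fun _ : κ => μ) hf
  have h2 := Measure.infinitePi_map_curry (fun (_ : Fin k) (_ : Fin m) => μ)
  have h3 := Measure.infinitePi_map_pi
    (μ := fun _ : Fin k => Measure.infinitePi fun _ : Fin m => μ) (f := fun _ => T) fun _ => hT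
  have hTm : Measurable fun (x : Fin k → Fin m → ℝ) i => T (x i) :=
    measurable_pi_lambda _ fun i => hT.comp (measurable_pi_apply i)
  have hre : Measurable fun (x : κ → ℝ) p => x (f p) :=
    measurable_pi_lambda _ fun p => measurable_pi_apply _
  rw [← h2, ← h1, Measure.map_map (MeasurableEquiv.measurable _) hre,
    Measure.map_map hTm ((MeasurableEquiv.measurable _).comp hre)] at h3
  simp only [Measure.infinitePi_eq_pi (ι := Fin m)] at h3
  rw [← h3]
  rfl

theorem injective_block_index {k m : ℕ} :
    Function.Injective fun p : Fin k × Fin m => (p.1 : ℕ) * m + p.2 := by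
  rintro ⟨i, l⟩ ⟨i', l'⟩ h
  simp only at h
  have hm : 0 < m := l.pos
  have h1 : (i : ℕ) = i' := by
    have := congrArg (· / m) h
    simpa [Nat.add_comm _ (l : ℕ), Nat.add_comm _ (l' : ℕ), Nat.add_mul_div_right, hm,
      Nat.div_eq_of_lt] using this
  rw [h1] at h
  have h2 : (l : ℕ) = l' := by omega
  exact Prod.ext (Fin.ext h1) (Fin.ext h2)

/-- The descending block order statistics of an i.i.d. sample have the law of the quantile
transforms of Rényi sums of an exponential array. -/
theorem map_block_descSort {Ω : Type*} [MeasurableSpace Ω] {P : Measure Ω} [IsProbabilityMeasure P]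
    {X : ℕ → Ω → ℝ} (hX : ∀ i, Measurable (X i)) (hind : iIndepFun X P) {μ : Measure ℝ}
    [IsProbabilityMeasure μ] (hμ : ∀ i, P.map (X i) = μ) {q : ℝ → ℝ} (hq : Monotone q)
    (hqμ : (expMeasure 1).map q = μ) (k m : ℕ) :
    P.map (fun ω (i : Fin k) => descSort fun l : Fin m => X (i * m + l) ω)
      = expArray.map fun g (i : Fin k) j => q (renyiSum (fun l : Fin m => g (i, l)) j) := by
  have hlaw := hind.map_fun_eq_infinitePi_map hX
  simp only [hμ] at hlaw
  have hqr : Measurable fun (g : Fin m → ℝ) j => q (renyiSum g j) :=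
    measurable_pi_lambda _ fun j => hq.measurable.comp
      ((measurable_pi_apply j).comp measurable_renyiSum)
  have h1 := map_blocks_infinitePi μ (k := k) (m := m) injective_block_index measurable_descSort
  have hinj : Function.Injective fun p : Fin k × Fin m => ((p.1 : ℕ), (p.2 : ℕ)) := by
    rintro ⟨i, l⟩ ⟨i', l'⟩ h
    simp only [Prod.mk.injEq] at h
    exact Prod.ext (Fin.ext h.1) (Fin.ext h.2)
  have h2 := map_blocks_infinitePi (expMeasure 1) (k := k) (m := m) hinj hqr
  rw [← map_descSort_pi hq hqμ, ← h1, ← hlaw, Measure.map_map] at h2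
  · exact h2.symm
  · exact measurable_pi_lambda _ fun i => measurable_descSort.comp
      (measurable_pi_lambda _ fun l => measurable_pi_apply _)
  · exact measurable_pi_lambda _ hX

end BlockLaw

/-! ### Moments of the exponential array -/

section Moments

theorem expMeasure_one_eq : expMeasure 1
    = (volume.restrict (Set.Ioi 0)).withDensity fun x => ENNReal.ofReal (Real.exp (-x)) := by
  rw [restrict_Ioi_eq_restrict_Ici, ← withDensity_indicator measurableSet_Ici]
  have : (Set.Ici (0 : ℝ)).indicator (fun x => ENNReal.ofReal (Real.exp (-x)))
      = exponentialPDF 1 := by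
    ext x
    by_cases hx : 0 ≤ x
    · rw [Set.indicator_of_mem (Set.mem_Ici.2 hx), exponentialPDF_of_nonneg hx, one_mul, one_mul]
    · rw [Set.indicator_of_notMem (by simpa using hx), exponentialPDF_of_neg (not_le.1 hx)]
  rw [this]
  rfl

theorem integral_expMeasure (f : ℝ → ℝ) :
    ∫ x, f x ∂(expMeasure 1) = ∫ x in Set.Ioi 0, Real.exp (-x) * f x := by
  rw [expMeasure_one_eq, integral_withDensity_eq_integral_toReal_smul (by fun_prop) (by simp)]
  simp [ENNReal.toReal_ofReal, Real.exp_nonneg]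

theorem integrable_expMeasure_iff (f : ℝ → ℝ) :
    Integrable f (expMeasure 1) ↔ IntegrableOn (fun x => Real.exp (-x) * f x) (Set.Ioi 0) := by
  rw [expMeasure_one_eq, integrable_withDensity_iff_integrable_smul' (by fun_prop) (by simp)]
  simp [IntegrableOn, ENNReal.toReal_ofReal, Real.exp_nonneg]

theorem integrable_pow_expMeasure (n : ℕ) : Integrable (fun x => x ^ n) (expMeasure 1) := by
  rw [integrable_expMeasure_iff]
  have h := Real.GammaIntegral_convergent (s := n + 1) (by positivity)
  simpa using h

theorem integral_pow_expMeasure (n : ℕ) : ∫ x, x ^ n ∂(expMeasure 1) = n.factorial := by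
  rw [integral_expMeasure, ← Real.Gamma_nat_eq_factorial, Real.Gamma_eq_integral (by positivity)]
  simp

theorem integrable_quartic_expMeasure (a₀ a₁ a₂ a₃ a₄ : ℝ) :
    Integrable (fun x => a₀ + a₁ * x + a₂ * x ^ 2 + a₃ * x ^ 3 + a₄ * x ^ 4) (expMeasure 1) := by
  have h1 : Integrable (fun x : ℝ => x) (expMeasure 1) := by
    simpa using integrable_pow_expMeasure 1
  exact ((((integrable_const a₀).add (h1.const_mul a₁)).add
    ((integrable_pow_expMeasure 2).const_mul a₂)).add
    ((integrable_pow_expMeasure 3).const_mul a₃)).add ((integrable_pow_expMeasure 4).const_mul a₄)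

/-- The coefficients are the factorial moments n!; this single formula yields all the central
moments used below. -/
theorem integral_quartic_expMeasure (a₀ a₁ a₂ a₃ a₄ : ℝ) :
    ∫ x, (a₀ + a₁ * x + a₂ * x ^ 2 + a₃ * x ^ 3 + a₄ * x ^ 4) ∂(expMeasure 1)
      = a₀ + a₁ + 2 * a₂ + 6 * a₃ + 24 * a₄ := by
  have h1 : Integrable (fun x : ℝ => x) (expMeasure 1) := by
    simpa using integrable_pow_expMeasure 1
  have h1' : ∫ x : ℝ, x ∂(expMeasure 1) = 1 := by
    simpa using integral_pow_expMeasure 1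
  have i0 := integrable_const (μ := expMeasure 1) a₀
  have i1 := h1.const_mul a₁
  have i2 := (integrable_pow_expMeasure 2).const_mul a₂
  have i3 := (integrable_pow_expMeasure 3).const_mul a₃
  have i4 := (integrable_pow_expMeasure 4).const_mul a₄
  have j1 : Integrable (fun x => a₀ + a₁ * x) (expMeasure 1) := i0.add i1
  have j2 : Integrable (fun x => a₀ + a₁ * x + a₂ * x ^ 2) (expMeasure 1) := j1.add i2
  have j3 : Integrable (fun x => a₀ + a₁ * x + a₂ * x ^ 2 + a₃ * x ^ 3) (expMeasure 1) := j2.add i3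
  have i1' : ∫ x, a₁ * x ∂(expMeasure 1) = a₁ := by rw [integral_const_mul, h1', mul_one]
  rw [integral_add j3 i4, integral_add j2 i3, integral_add j1 i2, integral_add i0 i1]
  simp only [i1', integral_const_mul, integral_pow_expMeasure, integral_const, probReal_univ]
  simp [Nat.factorial]
  ring

theorem integral_exp_neg_mul_expMeasure {θ : ℝ} (hθ : 0 ≤ θ) :
    ∫ x, Real.exp (-θ * x) ∂(expMeasure 1) = 1 / (1 + θ) := by
  have h := integral_exp_mul_Ioi (a := -(1 + θ)) (by linarith) 0
  rw [integral_expMeasure]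
  simp only [← Real.exp_add]
  calc _ = ∫ x in Set.Ioi (0 : ℝ), Real.exp (-(1 + θ) * x) := by congr! 3; ring
    _ = _ := by
      rw [h]
      simp only [mul_zero, Real.exp_zero]
      rw [neg_div_neg_eq]

theorem integral_sub_one_expMeasure : ∫ x, (x - 1) ∂(expMeasure 1) = 0 := by
  have h := integral_quartic_expMeasure (-1) 1 0 0 0
  calc _ = _ := integral_congr_ae (.of_forall fun x => by ring)
    _ = _ := h
    _ = 0 := by norm_num

theorem integrable_sub_one_sq_expMeasure :
    Integrable (fun x : ℝ => (x - 1) ^ 2) (expMeasure 1) :=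
  (integrable_quartic_expMeasure 1 (-2) 1 0 0).congr (.of_forall fun x => by ring)

theorem integral_sub_one_sq_expMeasure : ∫ x, (x - 1) ^ 2 ∂(expMeasure 1) = 1 := by
  have h := integral_quartic_expMeasure 1 (-2) 1 0 0
  calc _ = _ := integral_congr_ae (.of_forall fun x => by ring)
    _ = _ := h
    _ = 1 := by norm_num

theorem integrable_sub_one_pow_four_expMeasure :
    Integrable (fun x : ℝ => (x - 1) ^ 4) (expMeasure 1) :=
  (integrable_quartic_expMeasure 1 (-4) 6 (-4) 1).congr (.of_forall fun x => by ring)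

theorem integral_sub_one_pow_four_expMeasure : ∫ x, (x - 1) ^ 4 ∂(expMeasure 1) = 9 := by
  have h := integral_quartic_expMeasure 1 (-4) 6 (-4) 1
  calc _ = _ := integral_congr_ae (.of_forall fun x => by ring)
    _ = _ := h
    _ = 9 := by norm_num

theorem integral_centered_sq_expMeasure : ∫ x, ((x - 1) ^ 2 - 1) ∂(expMeasure 1) = 0 := by
  have h := integral_quartic_expMeasure 0 (-2) 1 0 0
  calc _ = _ := integral_congr_ae (.of_forall fun x => by ring)
    _ = _ := h
    _ = 0 := by norm_num

theorem integrable_centered_sq_sq_expMeasure :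
    Integrable (fun x : ℝ => ((x - 1) ^ 2 - 1) ^ 2) (expMeasure 1) :=
  (integrable_quartic_expMeasure 0 0 4 (-4) 1).congr (.of_forall fun x => by ring)

theorem integral_centered_sq_sq_expMeasure :
    ∫ x, ((x - 1) ^ 2 - 1) ^ 2 ∂(expMeasure 1) = 8 := by
  have h := integral_quartic_expMeasure 0 0 4 (-4) 1
  calc _ = _ := integral_congr_ae (.of_forall fun x => by ring)
    _ = _ := h
    _ = 8 := by norm_num

theorem map_eval_expArray (s : ℕ × ℕ) : expArray.map (fun g => g s) = expMeasure 1 :=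
  Measure.infinitePi_map_eval (fun _ => expMeasure 1) s

theorem iIndepFun_expArray : iIndepFun (fun (s : ℕ × ℕ) (g : ℕ × ℕ → ℝ) => g s) expArray :=
  iIndepFun_infinitePi (P := fun _ : ℕ × ℕ => expMeasure 1) (X := fun _ x => x)
    fun _ => measurable_id

theorem integral_eval_expArray (s : ℕ × ℕ) {f : ℝ → ℝ} (hf : Measurable f) :
    ∫ g, f (g s) ∂expArray = ∫ x, f x ∂(expMeasure 1) := by
  rw [← map_eval_expArray s, integral_map (measurable_pi_apply s).aemeasurable
    hf.aestronglyMeasurable]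

theorem integrable_eval_expArray (s : ℕ × ℕ) {f : ℝ → ℝ} (hf : Integrable f (expMeasure 1)) :
    Integrable (fun g => f (g s)) expArray := by
  rw [← map_eval_expArray s] at hf
  exact hf.comp_measurable (measurable_pi_apply s)

/-- Second moment of a linear combination of centered functions of the array. -/
theorem second_moment_sum {f : ℝ → ℝ} (hf : Measurable f)
    (h0 : ∫ x, f x ∂(expMeasure 1) = 0) (h2 : Integrable (fun x => f x ^ 2) (expMeasure 1))
    (S : Finset (ℕ × ℕ)) (b : ℕ × ℕ → ℝ) :
    Integrable (fun g => (∑ s ∈ S, b s * f (g s)) ^ 2) expArray ∧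
    ∫ g, (∑ s ∈ S, b s * f (g s)) ^ 2 ∂expArray
      = (∫ x, f x ^ 2 ∂(expMeasure 1)) * ∑ s ∈ S, b s ^ 2 := by
  have hmem : ∀ s, MemLp (fun g : ℕ × ℕ → ℝ => b s * f (g s)) 2 expArray := fun s =>
    ((memLp_two_iff_integrable_sq ((hf.comp (measurable_pi_apply s)).aestronglyMeasurable)).2
      (integrable_eval_expArray s h2)).const_mul (b s)
  have hmeas : ∀ s, Measurable fun g : ℕ × ℕ → ℝ => b s * f (g s) := fun s =>
    (hf.comp (measurable_pi_apply s)).const_mul (b s)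
  have hsum : MemLp (fun g : ℕ × ℕ → ℝ => ∑ s ∈ S, b s * f (g s)) 2 expArray :=
    memLp_finsetSum S fun s _ => hmem s
  have hint0 : ∀ s, ∫ g, b s * f (g s) ∂expArray = 0 := fun s => by
    rw [integral_const_mul, integral_eval_expArray s hf, h0, mul_zero]
  have hindep : iIndepFun (fun s (g : ℕ × ℕ → ℝ) => b s * f (g s)) expArray :=
    iIndepFun_expArray.comp (fun s x => b s * f x) fun s => hf.const_mul (b s)
  refine ⟨(memLp_two_iff_integrable_sq hsum.aestronglyMeasurable).1 hsum, ?_⟩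
  have hvar := IndepFun.variance_sum (s := S) (fun s _ => hmem s)
    fun s _ t _ hst => hindep.indepFun hst
  have hvs : ∀ s, variance (fun g : ℕ × ℕ → ℝ => b s * f (g s)) expArray
      = (∫ x, f x ^ 2 ∂(expMeasure 1)) * b s ^ 2 := fun s => by
    rw [variance_of_integral_eq_zero (hmeas s).aemeasurable (hint0 s)]
    simp only [mul_pow]
    rw [integral_const_mul, integral_eval_expArray s (hf.pow_const 2), mul_comm]
  have hS : (∑ s ∈ S, fun g : ℕ × ℕ → ℝ => b s * f (g s))
      = fun g => ∑ s ∈ S, b s * f (g s) := by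
    ext g
    simp
  rw [hS, variance_of_integral_eq_zero hsum.aestronglyMeasurable.aemeasurable] at hvar
  · rw [hvar, Finset.mul_sum]
    exact Finset.sum_congr rfl fun s _ => hvs s
  · rw [integral_finsetSum _ fun s _ => (hmem s).integrable (by norm_num)]
    exact Finset.sum_eq_zero fun s _ => hint0 s

end Moments

/-! ### Exponential order statistics: Laplace transform, negative moments, mean and variance -/

section ExpTail

/-- The `(j + 1)`-th largest exponential order statistic of block `i`, in Rényi's
representation by the exponential array `g`. -/
noncomputable def expTail (m : ℕ) (g : ℕ × ℕ → ℝ) (i j : ℕ) : ℝ :=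
  ∑ l ∈ Finset.Ico j m, g (i, l) / ((l : ℝ) + 1)

theorem renyiSum_eq_expTail {m : ℕ} (g : ℕ × ℕ → ℝ) (i : ℕ) (j : Fin m) :
    renyiSum (fun l : Fin m => g (i, l)) j = expTail m g i j := by
  have h := Fin.sum_univ_eq_sum_range
    (fun l : ℕ => if (j : ℕ) ≤ l then g (i, l) / ((l : ℝ) + 1) else 0) m
  have h2 : (Finset.range m).filter (fun l => (j : ℕ) ≤ l) = Finset.Ico (j : ℕ) m := by
    ext l
    simp [and_comm]
  rw [← Finset.sum_filter (s := Finset.range m), h2] at h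
  exact h

theorem measurable_expTail (m i j : ℕ) : Measurable fun g => expTail m g i j :=
  Finset.measurable_fun_sum _ fun l _ => (measurable_pi_apply (i, l)).div_const _

theorem expTail_eq_add {m j : ℕ} (hj : j < m) (g : ℕ × ℕ → ℝ) (i : ℕ) :
    expTail m g i j = g (i, j) / ((j : ℝ) + 1) + expTail m g i (j + 1) :=
  Finset.sum_eq_sum_Ico_succ_bot hj _

theorem ae_pos_expArray : ∀ᵐ g ∂expArray, ∀ s, 0 < g s := by
  rw [ae_all_iff]
  intro s
  have h : ∀ᵐ x ∂(expMeasure 1), 0 < x := by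
    rw [expMeasure_one_eq]
    exact (withDensity_absolutelyContinuous _ _).ae_le (ae_restrict_mem measurableSet_Ioi)
  rw [← map_eval_expArray s] at h
  exact ae_of_ae_map (measurable_pi_apply s).aemeasurable h

theorem expTail_pos {m j : ℕ} (hj : j < m) {g : ℕ × ℕ → ℝ} (hg : ∀ s, 0 < g s) (i : ℕ) :
    0 < expTail m g i j :=
  Finset.sum_pos (fun l _ => div_pos (hg _) (by positivity)) ⟨j, Finset.mem_Ico.2 ⟨le_rfl, hj⟩⟩

theorem integral_exp_neg_expTail {θ : ℝ} (hθ : 0 ≤ θ) (m i j : ℕ) :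
    ∫ g, Real.exp (-θ * expTail m g i j) ∂expArray
      = ∏ l ∈ Finset.Ico j m, ((l : ℝ) + 1) / ((l : ℝ) + 1 + θ) := by
  have hinj : Function.Injective fun l : ℕ => (i, l) := fun a b h => (Prod.mk.inj h).2
  have hind : iIndepFun (fun (l : ℕ) (g : ℕ × ℕ → ℝ) => g (i, l) / ((l : ℝ) + 1)) expArray :=
    (iIndepFun_expArray.precomp hinj).comp (fun l x => x / ((l : ℝ) + 1))
      fun l => measurable_id.div_const _
  have h := hind.mgf_sum (t := -θ) (fun l => (measurable_pi_apply (i, l)).div_const _)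
    (Finset.Ico j m)
  simp only [mgf, Finset.sum_apply] at h
  rw [← Finset.prod_congr rfl fun l _ => ?_]
  · exact h
  · have h1 := integral_eval_expArray (i, l)
      (f := fun x => Real.exp (-(θ / ((l : ℝ) + 1)) * x)) (by fun_prop)
    rw [integral_exp_neg_mul_expMeasure (by positivity)] at h1
    calc _ = ∫ g, Real.exp (-(θ / ((l : ℝ) + 1)) * g (i, l)) ∂expArray := by
          congr! 3
          ring
      _ = _ := h1
      _ = _ := by field_simp

/-- A nonintegrable function has integral 0 by convention, while the product formula gives a
positive value. -/
theorem integrable_exp_neg_expTail {θ : ℝ} (hθ : 0 ≤ θ) (m i j : ℕ) :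
    Integrable (fun g => Real.exp (-θ * expTail m g i j)) expArray := by
  by_contra hcon
  have h := integral_exp_neg_expTail hθ m i j
  rw [integral_undef hcon] at h
  have : 0 < ∏ l ∈ Finset.Ico j m, ((l : ℝ) + 1) / ((l : ℝ) + 1 + θ) :=
    Finset.prod_pos fun l _ => by positivity
  linarith

/-- Induction on m: Bernoulli's inequality bounds the new factor by ((m+1+s)/(m+2+s))^s, and these
powers telescope. The resulting decay m^(-s) compensates the factor m^s in the moments of m
exp(-E_j). -/
theorem prod_ratio_le (s : ℕ) {j m : ℕ} (hj : j ≤ m) :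
    ∏ l ∈ Finset.Ico j m, ((l : ℝ) + 1) / ((l : ℝ) + 1 + s)
      ≤ (((j : ℝ) + 1 + s) / ((m : ℝ) + 1 + s)) ^ s := by
  induction m, hj using Nat.le_induction with
  | base =>
    rw [Finset.Ico_self, Finset.prod_empty, div_self (by positivity), one_pow]
  | succ m hjm ih =>
    rw [Finset.prod_Ico_succ_top hjm]
    have hb : 1 + (s : ℝ) * (-(1 / ((m : ℝ) + 2 + s))) ≤ (1 + -(1 / ((m : ℝ) + 2 + s))) ^ s :=
      one_add_mul_le_pow (by
        have : 1 / ((m : ℝ) + 2 + s) ≤ 1 := by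
          rw [div_le_one (by positivity)]
          have : (0 : ℝ) ≤ m := m.cast_nonneg
          have : (0 : ℝ) ≤ s := s.cast_nonneg
          linarith
        linarith) s
    have h1 : ((m : ℝ) + 1) / ((m : ℝ) + 1 + s) ≤ 1 + (s : ℝ) * (-(1 / ((m : ℝ) + 2 + s))) := by
      have h2 : 1 + (s : ℝ) * (-(1 / ((m : ℝ) + 2 + s))) = ((m : ℝ) + 2) / ((m : ℝ) + 2 + s) := by
        field_simp
        ring
      rw [h2, div_le_div_iff₀ (by positivity) (by positivity)]
      have : (0 : ℝ) ≤ s := s.cast_nonneg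
      nlinarith
    have h3 : 1 + -(1 / ((m : ℝ) + 2 + s)) = ((m : ℝ) + 1 + s) / ((m : ℝ) + 2 + s) := by
      field_simp
      ring
    rw [h3] at hb
    calc _ ≤ (((j : ℝ) + 1 + s) / ((m : ℝ) + 1 + s)) ^ s
          * (((m : ℝ) + 1 + s) / ((m : ℝ) + 2 + s)) ^ s := by
            gcongr
            exact h1.trans hb
      _ = (((j : ℝ) + 1 + s) / (((m + 1 : ℕ) : ℝ) + 1 + s)) ^ s := by
          rw [← mul_pow]
          congr 1
          push_cast
          field_simp
          ring

/-- Uniform bound for the negative exponential moments of the upper order statistics. -/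
theorem integral_exp_sub_expTail_le (s r : ℕ) {m j : ℕ} (hm : 0 < m) (hjm : j ≤ m) (hjr : j ≤ r)
    (i : ℕ) :
    Integrable (fun g => Real.exp (s * (Real.log m - expTail m g i j))) expArray ∧
    ∫ g, Real.exp (s * (Real.log m - expTail m g i j)) ∂expArray ≤ ((r : ℝ) + 1 + s) ^ s := by
  have hm' : (0 : ℝ) < m := by exact_mod_cast hm
  have e : (fun g => Real.exp (s * (Real.log m - expTail m g i j)))
      = fun g => (m : ℝ) ^ s * Real.exp (-(s : ℝ) * expTail m g i j) := by
    ext g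
    rw [mul_sub, Real.exp_sub, ← Real.log_pow, Real.exp_log (by positivity), neg_mul,
      Real.exp_neg, div_eq_mul_inv]
  rw [e]
  refine ⟨(integrable_exp_neg_expTail s.cast_nonneg m i j).const_mul _, ?_⟩
  rw [integral_const_mul, integral_exp_neg_expTail s.cast_nonneg]
  calc _ ≤ (m : ℝ) ^ s * (((j : ℝ) + 1 + s) / ((m : ℝ) + 1 + s)) ^ s := by
        gcongr
        exact prod_ratio_le s hjm
    _ = ((m : ℝ) / ((m : ℝ) + 1 + s) * ((j : ℝ) + 1 + s)) ^ s := by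
        rw [← mul_pow]
        congr 1
        ring
    _ ≤ (1 * ((r : ℝ) + 1 + s)) ^ s := by
        have h1 : (m : ℝ) / ((m : ℝ) + 1 + s) ≤ 1 := by
          rw [div_le_one (by positivity)]
          have : (0 : ℝ) ≤ s := s.cast_nonneg
          linarith
        gcongr
    _ = _ := by rw [one_mul]

/-- The mean of the `(r + 1)`-th largest exponential order statistic. -/
noncomputable def expTailMean (m r : ℕ) : ℝ := ∑ l ∈ Finset.Ico r m, 1 / ((l : ℝ) + 1)

theorem aCoef_eq (m r : ℕ) (p : ℝ) : aCoef m r p = expTailMean m r + Real.log p := by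
  rw [aCoef, expTailMean]
  congr 1
  have h1 : Finset.Icc (r + 1) m = Finset.Ico (r + 1) (m + 1) := by
    ext
    simp
  have h2 := Finset.sum_Ico_add' (fun j : ℕ => 1 / (j : ℝ)) r m 1
  rw [h1, ← h2]
  simp

theorem expTail_sub_mean (m r i : ℕ) (g : ℕ × ℕ → ℝ) :
    expTail m g i r - expTailMean m r
      = ∑ l ∈ Finset.Ico r m, 1 / ((l : ℝ) + 1) * (g (i, l) - 1) := by
  rw [expTail, expTailMean, ← Finset.sum_sub_distrib]
  exact Finset.sum_congr rfl fun l _ => by ring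

/-- This bounds the variance of an upper order statistic uniformly in the block size. -/
theorem sum_inv_sq_le (r m : ℕ) : ∑ l ∈ Finset.Ico r m, (1 / ((l : ℝ) + 1)) ^ 2 ≤ 2 := by
  have h : ∀ n : ℕ, ∑ l ∈ Finset.range n, (1 / ((l : ℝ) + 1)) ^ 2 ≤ 2 - 1 / (n : ℝ) := by
    intro n
    induction n with
    | zero => norm_num
    | succ n ih =>
      rw [Finset.sum_range_succ]
      rcases Nat.eq_zero_or_pos n with rfl | hn
      · norm_num
      · have hn' : (0 : ℝ) < n := by exact_mod_cast hn
        have h1 : (1 / ((n : ℝ) + 1)) ^ 2 ≤ 1 / (n : ℝ) - 1 / ((n + 1 : ℕ) : ℝ) := by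
          have h2 : 1 / (n : ℝ) - 1 / ((n + 1 : ℕ) : ℝ) = 1 / (n * ((n : ℝ) + 1)) := by
            push_cast
            field_simp
            ring
          rw [h2, div_pow, one_pow]
          apply one_div_le_one_div_of_le (by positivity)
          nlinarith
        linarith
  calc _ ≤ ∑ l ∈ Finset.range m, (1 / ((l : ℝ) + 1)) ^ 2 := by
        refine Finset.sum_le_sum_of_subset_of_nonneg (fun l hl => ?_) fun _ _ _ => by positivity
        exact Finset.mem_range.2 (Finset.mem_Ico.1 hl).2
    _ ≤ _ := by
        have := h m
        have : 0 ≤ 1 / (m : ℝ) := by positivity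
        linarith

end ExpTail

/-! ### The statistic as a function of logarithmic order statistics -/

section LogData

/-- The data points as a function of the logarithms `L i j` of the `(j + 1)`-th largest
observations of the blocks. -/
noncomputable def logData (k r : ℕ) (α a y : ℝ) (L : Fin k → ℕ → ℝ) :
    Option (Fin k × Fin r) → ℝ
  | none => -(a / ((k : ℝ) * (r : ℝ))) * ∑ s : Fin k × Fin r,
      (((s.2 : ℕ) + 1 : ℝ) * (L s.1 s.2 - L s.1 (s.2 + 1)) - 1 / α * (L s.1 r - y))
  | some s => ((s.2 : ℕ) + 1 : ℝ) * (L s.1 s.2 - L s.1 (s.2 + 1)) - 1 / α * (L s.1 r - y)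

/-- The logarithms of the entries of a vector, extended by zero. -/
noncomputable def extLog {m : ℕ} (v : Fin m → ℝ) (j : ℕ) : ℝ :=
  if h : j < m then Real.log (v ⟨j, h⟩) else 0

/-- Out of range both sides are 0, because the default order statistic is 0 and `Real.log 0 = 0`. -/
theorem log_blockOrderStat (x : ℕ → ℝ) (m i j : ℕ) :
    Real.log (blockOrderStat x m i (j + 1))
      = extLog (descSort fun l : Fin m => x (i * m + l)) j := by
  rw [blockOrderStat, descOrderStat, extLog]
  by_cases h : j < m
  · rw [dif_pos h, dif_pos ⟨by omega, by omega⟩]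
    rfl
  · rw [dif_neg h, dif_neg (by omega), Real.log_zero]

theorem adjustedData_eq_logData (x : ℕ → ℝ) (k m r : ℕ) (p a y : ℝ) :
    adjustedData x k m r p a y = logData k r (aCoef m r p) a y
      fun i => extLog (descSort fun l : Fin m => x (i * m + l)) := by
  have hz : ∀ i j : ℕ, zData x m r p y i (j + 1)
      = ((j : ℝ) + 1) * (extLog (descSort fun l : Fin m => x (i * m + l)) j
          - extLog (descSort fun l : Fin m => x (i * m + l)) (j + 1))
        - 1 / aCoef m r p * (extLog (descSort fun l : Fin m => x (i * m + l)) r - y) := by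
    intro i j
    rw [zData, log_blockOrderStat, log_blockOrderStat, log_blockOrderStat]
    push_cast
    rfl
  funext s
  rcases s with _ | ⟨i, j⟩
  · simp only [adjustedData, pseudoPoint, logData]
    congr 1
    rw [Fintype.sum_prod_type, Finset.sum_range]
    refine Finset.sum_congr rfl fun i _ => ?_
    have h1 : Finset.Icc 1 r = Finset.Ico (0 + 1) (r + 1) := by
      ext
      simp
    rw [h1, ← Finset.sum_Ico_add' (fun j => zData x m r p y i j) 0 r 1,
      Nat.Ico_zero_eq_range, Finset.sum_range]
    exact Finset.sum_congr rfl fun j _ => hz i j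
  · exact hz i j

theorem measurable_empLogLR_logData (k m r : ℕ) (α a y : ℝ) :
    Measurable fun o : Fin k → Fin m → ℝ =>
      empLogLR (logData k r α a y fun i => extLog (o i)) := by
  have hL : ∀ (i : Fin k) (j : ℕ), Measurable fun o : Fin k → Fin m → ℝ => extLog (o i) j := by
    intro i j
    unfold extLog
    split_ifs with h
    · exact Real.measurable_log.comp ((measurable_pi_apply _).comp (measurable_pi_apply i))
    · exact measurable_const
  have hz : ∀ s : Fin k × Fin r, Measurable fun o : Fin k → Fin m → ℝ =>
      ((s.2 : ℕ) + 1 : ℝ) * (extLog (o s.1) s.2 - extLog (o s.1) (s.2 + 1))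
        - 1 / α * (extLog (o s.1) r - y) := fun s =>
    (((hL _ _).sub (hL _ _)).const_mul _).sub (((hL _ _).sub_const y).const_mul _)
  refine measurable_empLogLR.comp (measurable_pi_lambda _ fun s => ?_)
  cases s with
  | none => exact (Finset.measurable_fun_sum _ fun s _ => hz s).const_mul _
  | some s => exact hz s

/-- The adjusted statistic has the same law as its counterpart for the exponential array. -/
theorem map_adjustedLogLR {Ω : Type*} [MeasurableSpace Ω] {P : Measure Ω} [IsProbabilityMeasure P]
    {X : ℕ → Ω → ℝ} (hX : ∀ i, Measurable (X i)) (hind : iIndepFun X P) {μ : Measure ℝ}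
    [IsProbabilityMeasure μ] (hμ : ∀ i, P.map (X i) = μ) {q : ℝ → ℝ} (hq : Monotone q)
    (hqμ : (expMeasure 1).map q = μ) (k m r : ℕ) (p a y : ℝ) :
    Measurable (fun ω => adjustedLogLR (fun i => X i ω) k m r p a y) ∧
    Measurable (fun g => empLogLR (logData k r (aCoef m r p) a y
      fun i => extLog fun j : Fin m => q (expTail m g i j))) ∧
    P.map (fun ω => adjustedLogLR (fun i => X i ω) k m r p a y)
      = expArray.map fun g => empLogLR (logData k r (aCoef m r p) a y
          fun i => extLog fun j : Fin m => q (expTail m g i j)) := by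
  have hΦ := measurable_empLogLR_logData k m r (aCoef m r p) a y
  have h1 := map_block_descSort hX hind hμ hq hqμ k m
  simp only [renyiSum_eq_expTail] at h1
  have hm1 : Measurable fun ω (i : Fin k) => descSort fun l : Fin m => X (i * m + l) ω :=
    measurable_pi_lambda _ fun i => measurable_descSort.comp
      (measurable_pi_lambda _ fun l => hX _)
  have hm2 : Measurable fun g (i : Fin k) (j : Fin m) => q (expTail m g i j) :=
    measurable_pi_lambda _ fun i => measurable_pi_lambda _ fun j =>
      hq.measurable.comp (measurable_expTail m i j)
  have e : (fun ω => adjustedLogLR (fun i => X i ω) k m r p a y)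
      = (fun o : Fin k → Fin m → ℝ => empLogLR (logData k r (aCoef m r p) a y
          fun i => extLog (o i))) ∘
        fun ω (i : Fin k) => descSort fun l : Fin m => X (i * m + l) ω := by
    funext ω
    rw [adjustedLogLR, adjustedData_eq_logData]
    rfl
  refine ⟨e ▸ hΦ.comp hm1, hΦ.comp hm2, ?_⟩
  rw [e, ← Measure.map_map hΦ hm1, h1, Measure.map_map hΦ hm2]
  rfl

end LogData

/-! ### The data in exponential coordinates and the deterministic approximation -/

section Deterministic

/-- The data points in exponential coordinates, as centered exponentials plus a perturbation. -/
theorem logData_some_eq {k r m : ℕ} (hrm : r < m) {γ c p y : ℝ} (hγ : γ ≠ 0) {ℓ h : ℝ → ℝ}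
    (hℓ : ∀ w, ℓ w = γ * w + c + h w) (hy : y = ℓ (-Real.log p)) (hα : aCoef m r p ≠ 0) (a : ℝ)
    (g : ℕ × ℕ → ℝ) (s : Fin k × Fin r) {L : Fin k → ℕ → ℝ}
    (hL : ∀ i, ∀ j < m, L i j = ℓ (expTail m g i j)) :
    logData k r (aCoef m r p) a y L (some s)
      = γ * ((g (s.1, s.2) - 1) + (-((expTail m g s.1 r - expTailMean m r) / aCoef m r p)
        + (((s.2 : ℕ) + 1 : ℝ) * (h (expTail m g s.1 s.2) - h (expTail m g s.1 (s.2 + 1)))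
          - 1 / aCoef m r p * (h (expTail m g s.1 r) - h (-Real.log p))) / γ)) := by
  have hj : (s.2 : ℕ) < m := s.2.2.trans hrm
  have hj1 : (s.2 : ℕ) + 1 < m := by have := s.2.2; omega
  have hE := expTail_eq_add hj g s.1
  have hG : g (s.1, s.2) = ((s.2 : ℕ) + 1 : ℝ) *
      (expTail m g s.1 s.2 - expTail m g s.1 (s.2 + 1)) := by
    rw [hE]
    field_simp
    ring
  -- With α the coefficient, E_r + log p = α + (E_r - mean): division by α produces the 1 that
  -- centers g, plus a fluctuation.
  have hmean : expTailMean m r = aCoef m r p - Real.log p := by rw [aCoef_eq]; ring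
  simp only [logData]
  rw [hL _ _ hj, hL _ _ hj1, hL _ _ hrm, hy, hG, hmean]
  simp only [hℓ]
  field_simp
  ring

/-- On the event where the relevant sums are under control, the statistic is close to the square
of the normalized sum of the centered exponentials. -/
theorem empLogLR_logData_approx {k r m : ℕ} (hk : 0 < k) (hr : 0 < r) (hrm : r < m)
    {γ c p y a β η : ℝ} (hγ : 0 < γ) {ℓ h : ℝ → ℝ}
    (hℓ : ∀ w, ℓ w = γ * w + c + h w) (hy : y = ℓ (-Real.log p)) (hα : 1 ≤ |aCoef m r p|)
    (g : ℕ × ℕ → ℝ) {L : Fin k → ℕ → ℝ} (hL : ∀ i, ∀ j < m, L i j = ℓ (expTail m g i j))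
    {H : ℕ → ℝ} (hH : ∀ i < k, ∀ j ≤ r, |h (expTail m g i j)| ≤ H i)
    (hH0 : ∀ i < k, |h (-Real.log p)| ≤ 2 * H i)
    (hη : 0 < η) (hβ : |(√(k * r : ℝ))⁻¹ * ∑ s : Fin k × Fin r, (g (s.1, s.2) - 1)| + 1 ≤ β)
    (hβη : 96 * β ^ 2 * η ≤ 1) (ha : |a / ((k : ℝ) * (r : ℝ))| ≤ η)
    (hc1 : (r : ℝ) ^ 2 * (∑ i : Fin k, (expTail m g i r - expTailMean m r)) ^ 2
      ≤ (η / 2) ^ 2 * (k * r : ℝ) * aCoef m r p ^ 2)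
    (hc2 : 2 * r * ∑ i : Fin k, (expTail m g i r - expTailMean m r) ^ 2
      ≤ η ^ 2 / 2 * (k * r : ℝ) * aCoef m r p ^ 2)
    (hD : r * (2 * r + 3) * ∑ i : Fin k, H i ≤ γ * (η / 2) * √(k * r : ℝ))
    (hx2 : (∑ s : Fin k × Fin r, ((g (s.1, s.2) - 1) ^ 2 - 1)) ^ 2 ≤ η ^ 2 * (k * r : ℝ) ^ 2)
    (hx4 : ∑ s : Fin k × Fin r, (g (s.1, s.2) - 1) ^ 4 ≤ η ^ 4 * (k * r : ℝ) ^ 2) :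
    ∃ Y : ℝ, empLogLR (logData k r (aCoef m r p) a y L) = Y ∧
      |Y - ((√(k * r : ℝ))⁻¹ * ∑ s : Fin k × Fin r, (g (s.1, s.2) - 1)) ^ 2|
        ≤ 4000 * β ^ 4 * η := by
  set α := aCoef m r p with hαdef
  have hα0 : α ≠ 0 := by
    intro h0
    rw [h0, abs_zero] at hα
    linarith
  have hk' : (0 : ℝ) < k := by exact_mod_cast hk
  have hr' : (0 : ℝ) < r := by exact_mod_cast hr
  have hr1 : (1 : ℝ) ≤ r := by exact_mod_cast hr
  have hK : (0 : ℝ) < k * r := by positivity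
  set q := √(k * r : ℝ) with hq
  have hq0 : 0 < q := Real.sqrt_pos.2 hK
  have hq2 : q ^ 2 = k * r := Real.sq_sqrt hK.le
  set x : Fin k × Fin r → ℝ := fun s => g (s.1, s.2) - 1 with hx
  set u : Fin k → ℝ := fun i => expTail m g i r - expTailMean m r with hu
  set d : Fin k × Fin r → ℝ := fun s =>
    ((s.2 : ℕ) + 1 : ℝ) * (h (expTail m g s.1 s.2) - h (expTail m g s.1 (s.2 + 1)))
      - 1 / α * (h (expTail m g s.1 r) - h (-Real.log p)) with hd
  have hdle : ∀ s, |d s| ≤ (2 * r + 3) * H s.1 := by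
    intro s
    have h1 := hH s.1 s.1.2 s.2 s.2.2.le
    have h2 := hH s.1 s.1.2 (s.2 + 1) s.2.2
    have h3 := hH s.1 s.1.2 r le_rfl
    have h4 := hH0 s.1 s.1.2
    have hHn : 0 ≤ H s.1 := (abs_nonneg _).trans h1
    have hjr : ((s.2 : ℕ) : ℝ) + 1 ≤ r := by exact_mod_cast s.2.2
    have hαinv : |1 / α| ≤ 1 := by
      rw [abs_div, abs_one, div_le_one (by linarith)]
      exact hα
    calc |d s| ≤ |((s.2 : ℕ) + 1 : ℝ)|
            * |h (expTail m g s.1 s.2) - h (expTail m g s.1 (s.2 + 1))|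
          + |1 / α| * |h (expTail m g s.1 r) - h (-Real.log p)| := by
            rw [← abs_mul, ← abs_mul]
            exact abs_sub _ _
      _ ≤ r * (H s.1 + H s.1) + 1 * (H s.1 + 2 * H s.1) := by
            rw [abs_of_pos (show (0 : ℝ) < (s.2 : ℕ) + 1 by positivity)]
            gcongr
            · exact (abs_sub _ _).trans (add_le_add h1 h2)
            · exact (abs_sub _ _).trans (add_le_add h3 h4)
      _ = _ := by ring
  have hdsum : ∑ s, |d s| ≤ γ * (η / 2) * q := by
    refine le_trans (Finset.sum_le_sum fun s _ => hdle s) (le_trans (le_of_eq ?_) hD)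
    rw [Fintype.sum_prod_type]
    simp only [Finset.sum_const, Finset.card_univ, Fintype.card_fin, nsmul_eq_mul]
    rw [Finset.mul_sum]
    exact Finset.sum_congr rfl fun i _ => by ring
  -- Squares need no separate moment bound: a sum of squares is at most the square of the sum of
  -- moduli.
  have hd2sum : ∑ s, d s ^ 2 ≤ (γ * (η / 2) * q) ^ 2 := by
    have h1 : ∑ s, |d s| ^ 2 ≤ (∑ s, |d s|) ^ 2 := by
      rw [sq (∑ s, |d s|), Finset.sum_mul]
      refine Finset.sum_le_sum fun s hs => ?_
      rw [sq]
      exact mul_le_mul_of_nonneg_left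
        (Finset.single_le_sum (f := fun s => |d s|) (fun _ _ => abs_nonneg _) hs) (abs_nonneg _)
    simp only [sq_abs] at h1
    exact h1.trans (by gcongr)
  have hα2 : 0 < α ^ 2 := by positivity
  have husum : ∑ s : Fin k × Fin r, u s.1 = r * ∑ i, u i := by
    rw [Fintype.sum_prod_type]
    simp [Finset.mul_sum]
  have husq : ∑ s : Fin k × Fin r, u s.1 ^ 2 = r * ∑ i, u i ^ 2 := by
    rw [Fintype.sum_prod_type]
    simp [Finset.mul_sum]
  refine empLogLR_perturbed_approx (x := x) (e := fun s => -(u s.1 / α) + d s / γ) (γ := γ)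
    (b := a / ((k : ℝ) * (r : ℝ))) (g := q) hγ hq0 hη hβ hβη ?_ ?_ ha ?_ ?_ ?_ ?_ ?_
  · exact fun s => logData_some_eq hrm hγ.ne' hℓ hy hα0 a g s hL
  · rfl
  · field_simp
  · have h1 : ∑ s, x s ^ 2 - q ^ 2 = ∑ s : Fin k × Fin r, ((g (s.1, s.2) - 1) ^ 2 - 1) := by
      rw [Finset.sum_sub_distrib, hq2]
      simp [hx]
    rw [h1]
    refine abs_le_of_sq_le_sq ?_ (by positivity)
    rw [hq2, mul_pow]
    exact hx2
  · intro s
    -- The maximum is controlled by the sum of fourth powers, of order k r, which is small compared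
    -- with q⁴ = (k r)².
    have h1 : x s ^ 4 ≤ (η * q) ^ 4 := by
      calc x s ^ 4 ≤ ∑ s, x s ^ 4 :=
            Finset.single_le_sum (f := fun s => x s ^ 4) (fun s _ => by positivity)
              (Finset.mem_univ s)
        _ ≤ η ^ 4 * (k * r : ℝ) ^ 2 := hx4
        _ = (η * q) ^ 4 := by rw [← hq2]; ring
    rw [← Even.pow_abs (by decide : Even 4)] at h1
    exact le_of_pow_le_pow_left₀ (by norm_num) (by positivity) h1
  · have h1 : ∑ s : Fin k × Fin r, (-(u s.1 / α) + d s / γ)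
        = -(r * ∑ i, u i) / α + (∑ s, d s) / γ := by
      rw [Finset.sum_add_distrib, ← husum, Finset.sum_neg_distrib, ← Finset.sum_div,
        ← Finset.sum_div, neg_div]
    rw [h1]
    have h2 : |(-(r * ∑ i, u i)) / α| ≤ η / 2 * q := by
      refine abs_le_of_sq_le_sq ?_ (by positivity)
      rw [div_pow, neg_sq, div_le_iff₀ hα2, mul_pow, mul_pow, hq2]
      exact hc1
    have h3 : |(∑ s, d s) / γ| ≤ η / 2 * q := by
      rw [abs_div, abs_of_pos hγ, div_le_iff₀ hγ]
      refine (Finset.abs_sum_le_sum_abs _ _).trans (hdsum.trans (le_of_eq ?_))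
      ring
    exact (abs_add_le _ _).trans (by linarith)
  · have h1 : ∀ s : Fin k × Fin r, (-(u s.1 / α) + d s / γ) ^ 2
        ≤ 2 / α ^ 2 * u s.1 ^ 2 + 2 / γ ^ 2 * d s ^ 2 := by
      intro s
      have h2 : 2 / α ^ 2 * u s.1 ^ 2 = 2 * (u s.1 / α) ^ 2 := by rw [div_pow]; ring
      have h3 : 2 / γ ^ 2 * d s ^ 2 = 2 * (d s / γ) ^ 2 := by rw [div_pow]; ring
      rw [h2, h3]
      nlinarith only [sq_nonneg (u s.1 / α + d s / γ)]
    calc _ ≤ ∑ s : Fin k × Fin r, (2 / α ^ 2 * u s.1 ^ 2 + 2 / γ ^ 2 * d s ^ 2) :=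
          Finset.sum_le_sum fun s _ => h1 s
      _ = (2 * r * ∑ i, u i ^ 2) / α ^ 2 + 2 / γ ^ 2 * ∑ s, d s ^ 2 := by
          rw [Finset.sum_add_distrib, ← Finset.mul_sum, ← Finset.mul_sum, husq]
          ring
      _ ≤ η ^ 2 / 2 * q ^ 2 + 2 / γ ^ 2 * (γ * (η / 2) * q) ^ 2 := by
          gcongr
          rw [div_le_iff₀ hα2, hq2]
          exact hc2
      _ = (η * q) ^ 2 := by
          field_simp
          ring

end Deterministic

/-! ### Limit theorems for the exponential array -/

section Limits

/-- The normalized sum of the centered exponential variables. -/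
noncomputable def normSum (k r : ℕ) (g : ℕ × ℕ → ℝ) : ℝ :=
  (√((k : ℝ) * (r : ℝ)))⁻¹ * ∑ s : Fin k × Fin r, (g (s.1, s.2) - 1)

theorem sum_fin_prod (k r : ℕ) (F : ℕ × ℕ → ℝ) :
    ∑ s : Fin k × Fin r, F (s.1, s.2) = ∑ s ∈ Finset.range k ×ˢ Finset.range r, F s := by
  rw [Fintype.sum_prod_type, Finset.sum_product, Finset.sum_range]
  refine Finset.sum_congr rfl fun i _ => ?_
  rw [Finset.sum_range]

/-- Reading the array row by row makes it a single i.i.d. sequence, to which the central limit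
theorem applies along k n * r. -/
theorem sum_range_mul (k r : ℕ) (F : ℕ × ℕ → ℝ) :
    ∑ s : Fin k × Fin r, F (s.1, s.2) = ∑ q ∈ Finset.range (k * r), F (q / r, q % r) := by
  rw [sum_fin_prod, Finset.sum_product]
  induction k with
  | zero => simp
  | succ k ih =>
    rw [Finset.sum_range_succ, ih, Nat.succ_mul, Finset.sum_range_add]
    congr 1
    refine Finset.sum_congr rfl fun j hj => ?_
    have hj' := Finset.mem_range.1 hj
    rw [mul_comm k r, Nat.mul_add_div (by omega), Nat.div_eq_of_lt hj', Nat.mul_add_mod,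
      Nat.mod_eq_of_lt hj', add_zero]

theorem measurable_normSum (k r : ℕ) : Measurable (normSum k r) := by
  have h : ∀ s : Fin k × Fin r, Measurable fun g : ℕ × ℕ → ℝ => g (s.1, s.2) - 1 := fun s =>
    (measurable_pi_apply _).sub_const 1
  unfold normSum
  exact (Finset.measurable_fun_sum _ fun s _ => h s).const_mul _

/-- Central limit theorem for the exponential array. -/
theorem tendstoInDistribution_normSum {k : ℕ → ℕ} (hk : Tendsto k atTop atTop) {r : ℕ}
    (hr : 1 ≤ r) :
    TendstoInDistribution (fun n => normSum (k n) r) atTop (fun x : ℝ => x) (fun _ => expArray)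
      (gaussianReal 0 1) := by
  have hinj : Function.Injective fun q : ℕ => (q / r, q % r) := fun a b h => by
    have h1 := (Prod.mk.inj h).1
    have h2 := (Prod.mk.inj h).2
    rw [← Nat.div_add_mod a r, ← Nat.div_add_mod b r, h1, h2]
  have hmeas : ∀ q : ℕ, Measurable fun g : ℕ × ℕ → ℝ => g (q / r, q % r) - 1 := fun q =>
    (measurable_pi_apply _).sub_const 1
  have hmap : ∀ q : ℕ, expArray.map (fun g : ℕ × ℕ → ℝ => g (q / r, q % r) - 1)
      = (expMeasure 1).map fun x => x - 1 := fun q => by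
    rw [← map_eval_expArray (q / r, q % r)]
    exact (Measure.map_map (g := fun x : ℝ => x - 1) (f := fun g : ℕ × ℕ → ℝ => g (q / r, q % r))
      (by fun_prop) (measurable_pi_apply _)).symm
  have h := tendstoInDistribution_inv_sqrt_mul_sum (P := expArray)
    (X := fun (q : ℕ) (g : ℕ × ℕ → ℝ) => g (q / r, q % r) - 1)
    (HasLaw.id (μ := gaussianReal 0 1)) ?_ ?_ ?_ ?_
  · have hN : Tendsto (fun n => k n * r) atTop atTop :=
      tendsto_atTop_mono (fun n => Nat.le_mul_of_pos_right _ hr) hk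
    have e : ∀ n, normSum (k n) r = fun g => (√((k n * r : ℕ) : ℝ))⁻¹
        * ∑ q ∈ Finset.range (k n * r), (g (q / r, q % r) - 1) := fun n => by
      ext g
      rw [normSum, sum_range_mul (k n) r fun s => g s - 1]
      push_cast
      rfl
    refine ⟨fun n => (measurable_normSum _ _).aemeasurable, by fun_prop, ?_⟩
    simp only [e]
    exact h.tendsto.comp hN
  · exact (integral_eval_expArray _ (f := fun x => x - 1) (by fun_prop)).trans
      integral_sub_one_expMeasure
  · exact (integral_eval_expArray _ (f := fun x => (x - 1) ^ 2) (by fun_prop)).trans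
      integral_sub_one_sq_expMeasure
  · exact (iIndepFun_expArray.precomp hinj).comp (fun _ x => x - 1) fun _ => by fun_prop
  · exact fun q => ⟨(hmeas q).aemeasurable, (hmeas 0).aemeasurable, by rw [hmap, hmap]⟩

theorem integral_normSum_sq_le (k r : ℕ) :
    Integrable (fun g => normSum k r g ^ 2) expArray ∧
    ∫ g, normSum k r g ^ 2 ∂expArray ≤ 1 := by
  obtain ⟨h1, h2⟩ := second_moment_sum (f := fun x => x - 1) (by fun_prop)
    integral_sub_one_expMeasure integrable_sub_one_sq_expMeasure
    (Finset.range k ×ˢ Finset.range r) fun _ => 1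
  rw [integral_sub_one_sq_expMeasure] at h2
  simp only [one_mul, one_pow, Finset.sum_const, Finset.card_product, Finset.card_range,
    nsmul_eq_mul, mul_one] at h1 h2
  have e : (fun g => normSum k r g ^ 2) = fun g : ℕ × ℕ → ℝ => (√((k : ℝ) * (r : ℝ)))⁻¹ ^ 2
      * (∑ s ∈ Finset.range k ×ˢ Finset.range r, (g s - 1)) ^ 2 := by
    ext g
    rw [normSum, sum_fin_prod k r fun s => g s - 1, mul_pow]
  rw [e]
  refine ⟨h1.const_mul _, ?_⟩
  rw [integral_const_mul, h2, inv_pow, Real.sq_sqrt (by positivity)]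
  push_cast
  exact inv_mul_le_one

theorem integral_sum_centered_sq (k r : ℕ) :
    Integrable (fun g => (∑ s : Fin k × Fin r, ((g (s.1, s.2) - 1) ^ 2 - 1)) ^ 2) expArray ∧
    ∫ g, (∑ s : Fin k × Fin r, ((g (s.1, s.2) - 1) ^ 2 - 1)) ^ 2 ∂expArray
      ≤ 8 * ((k : ℝ) * r) := by
  obtain ⟨h1, h2⟩ := second_moment_sum (f := fun x => (x - 1) ^ 2 - 1) (by fun_prop)
    integral_centered_sq_expMeasure integrable_centered_sq_sq_expMeasure
    (Finset.range k ×ˢ Finset.range r) fun _ => 1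
  rw [integral_centered_sq_sq_expMeasure] at h2
  simp only [one_mul, one_pow, Finset.sum_const, Finset.card_product, Finset.card_range,
    nsmul_eq_mul, mul_one] at h1 h2
  have e : (fun g : ℕ × ℕ → ℝ => (∑ s : Fin k × Fin r, ((g (s.1, s.2) - 1) ^ 2 - 1)) ^ 2)
      = fun g => (∑ s ∈ Finset.range k ×ˢ Finset.range r, ((g s - 1) ^ 2 - 1)) ^ 2 := by
    ext g
    rw [sum_fin_prod k r fun s => (g s - 1) ^ 2 - 1]
  rw [e]
  refine ⟨h1, ?_⟩
  rw [h2]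
  push_cast
  rfl

theorem integral_sum_pow_four (k r : ℕ) :
    Integrable (fun g => ∑ s : Fin k × Fin r, (g (s.1, s.2) - 1) ^ 4) expArray ∧
    ∫ g, ∑ s : Fin k × Fin r, (g (s.1, s.2) - 1) ^ 4 ∂expArray ≤ 9 * ((k : ℝ) * r) := by
  have hi : ∀ s : ℕ × ℕ, Integrable (fun g : ℕ × ℕ → ℝ => (g s - 1) ^ 4) expArray := fun s =>
    integrable_eval_expArray s integrable_sub_one_pow_four_expMeasure
  refine ⟨integrable_finsetSum _ fun s _ => hi _, ?_⟩
  rw [integral_finsetSum _ fun s _ => hi _]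
  have h : ∀ s : ℕ × ℕ, ∫ g, (g s - 1) ^ 4 ∂expArray = 9 := fun s =>
    (integral_eval_expArray s (f := fun x => (x - 1) ^ 4) (by fun_prop)).trans
      integral_sub_one_pow_four_expMeasure
  simp only [h]
  simp
  linarith

/-- Rows are independent, so the variances of the k order statistics, each at most 2, add up. -/
theorem integral_sum_expTail_sq (k r m : ℕ) :
    Integrable (fun g => (∑ i : Fin k, (expTail m g i r - expTailMean m r)) ^ 2) expArray ∧
    ∫ g, (∑ i : Fin k, (expTail m g i r - expTailMean m r)) ^ 2 ∂expArray ≤ 2 * k := by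
  obtain ⟨h1, h2⟩ := second_moment_sum (f := fun x => x - 1) (by fun_prop)
    integral_sub_one_expMeasure integrable_sub_one_sq_expMeasure
    (Finset.range k ×ˢ Finset.Ico r m) fun s => 1 / ((s.2 : ℝ) + 1)
  rw [integral_sub_one_sq_expMeasure, one_mul] at h2
  have e : (fun g : ℕ × ℕ → ℝ => (∑ i : Fin k, (expTail m g i r - expTailMean m r)) ^ 2)
      = fun g => (∑ s ∈ Finset.range k ×ˢ Finset.Ico r m, 1 / ((s.2 : ℝ) + 1) * (g s - 1)) ^ 2 := by
    ext g
    simp only [expTail_sub_mean]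
    rw [Finset.sum_product, Finset.sum_range]
  rw [e]
  refine ⟨h1, ?_⟩
  rw [h2, Finset.sum_product]
  calc _ ≤ ∑ _i ∈ Finset.range k, (2 : ℝ) := Finset.sum_le_sum fun i _ => sum_inv_sq_le r m
    _ = 2 * k := by simp [mul_comm]

theorem integral_sum_sq_expTail (k r m : ℕ) :
    Integrable (fun g => ∑ i : Fin k, (expTail m g i r - expTailMean m r) ^ 2) expArray ∧
    ∫ g, ∑ i : Fin k, (expTail m g i r - expTailMean m r) ^ 2 ∂expArray ≤ 2 * k := by
  have hi : ∀ i : ℕ, Integrable (fun g => (expTail m g i r - expTailMean m r) ^ 2) expArray ∧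
      ∫ g, (expTail m g i r - expTailMean m r) ^ 2 ∂expArray ≤ 2 := by
    intro i
    obtain ⟨h1, h2⟩ := second_moment_sum (f := fun x => x - 1) (by fun_prop)
      integral_sub_one_expMeasure integrable_sub_one_sq_expMeasure
      (({i} : Finset ℕ) ×ˢ Finset.Ico r m) fun s => 1 / ((s.2 : ℝ) + 1)
    rw [integral_sub_one_sq_expMeasure, one_mul] at h2
    simp only [Finset.sum_product, Finset.sum_singleton] at h1 h2
    simp only [expTail_sub_mean]
    exact ⟨h1, h2.trans_le (sum_inv_sq_le r m)⟩
  refine ⟨integrable_finsetSum _ fun i _ => (hi i).1, ?_⟩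
  rw [integral_finsetSum _ fun (i : Fin k) _ => (hi i).1]
  calc _ ≤ ∑ _i : Fin k, (2 : ℝ) := Finset.sum_le_sum fun i _ => (hi i).2
    _ = 2 * k := by simp [mul_comm]

/-- The bound for the second-order remainders in block `i`. -/
noncomputable def remainderBound (C A : ℝ) (s m r : ℕ) (g : ℕ × ℕ → ℝ) (i : ℕ) : ℝ :=
  ∑ j ∈ Finset.range (r + 1), C * A * (1 + Real.exp (s * (Real.log m - expTail m g i j)))

theorem integral_sum_remainderBound {C A : ℝ} (hC : 0 ≤ C) (hA : 0 ≤ A) (s k : ℕ) {m r : ℕ}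
    (hrm : r < m) :
    Integrable (fun g => ∑ i : Fin k, remainderBound C A s m r g i) expArray ∧
    ∫ g, ∑ i : Fin k, remainderBound C A s m r g i ∂expArray
      ≤ k * ((r + 1) * (C * A * (1 + ((r : ℝ) + 1 + s) ^ s))) := by
  have hi : ∀ i : ℕ, ∀ j ∈ Finset.range (r + 1), Integrable (fun g =>
      C * A * (1 + Real.exp (s * (Real.log m - expTail m g i j)))) expArray ∧
      ∫ g, C * A * (1 + Real.exp (s * (Real.log m - expTail m g i j))) ∂expArray
        ≤ C * A * (1 + ((r : ℝ) + 1 + s) ^ s) := by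
    intro i j hj
    have hj' : j ≤ r := Nat.lt_succ_iff.1 (Finset.mem_range.1 hj)
    obtain ⟨h1, h2⟩ := integral_exp_sub_expTail_le s r (by omega : 0 < m) (by omega) hj' i
    refine ⟨((integrable_const 1).add h1).const_mul _, ?_⟩
    rw [integral_const_mul, integral_add (integrable_const 1) h1]
    simp only [integral_const, probReal_univ, smul_eq_mul, mul_one]
    gcongr
  have hr : ∀ i : ℕ, Integrable (fun g => remainderBound C A s m r g i) expArray ∧
      ∫ g, remainderBound C A s m r g i ∂expArray
        ≤ (r + 1) * (C * A * (1 + ((r : ℝ) + 1 + s) ^ s)) := by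
    intro i
    refine ⟨integrable_finsetSum _ fun j hj => (hi i j hj).1, ?_⟩
    simp only [remainderBound]
    rw [integral_finsetSum _ fun j hj => (hi i j hj).1]
    refine (Finset.sum_le_sum fun j hj => (hi i j hj).2).trans (le_of_eq ?_)
    simp
  refine ⟨integrable_finsetSum _ fun i _ => (hr i).1, ?_⟩
  rw [integral_finsetSum _ fun (i : Fin k) _ => (hr i).1]
  refine (Finset.sum_le_sum fun (i : Fin k) _ => (hr i).2).trans (le_of_eq ?_)
  simp

/-- Markov's inequality for a sequence of nonnegative functions. -/
theorem tendsto_measureReal_lt_of_integral_le {α : Type*} [MeasurableSpace α] {μ : Measure α}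
    [IsProbabilityMeasure μ] {f : ℕ → α → ℝ} {t e : ℕ → ℝ} (hf : ∀ n x, 0 ≤ f n x)
    (h : ∀ᶠ n in atTop, Integrable (f n) μ ∧ ∫ x, f n x ∂μ ≤ e n)
    (ht : ∀ᶠ n in atTop, 0 < t n) (het : Tendsto (fun n => e n / t n) atTop (𝓝 0)) :
    Tendsto (fun n => μ.real {x | t n < f n x}) atTop (𝓝 0) := by
  refine squeeze_zero' (.of_forall fun n => measureReal_nonneg) ?_ het
  filter_upwards [h, ht] with n ⟨h1, h2⟩ h3
  rw [le_div_iff₀ h3, mul_comm]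
  refine le_trans ?_ ((mul_meas_ge_le_integral_of_nonneg (.of_forall (hf n)) h1 (t n)).trans h2)
  refine mul_le_mul_of_nonneg_left (measureReal_mono ?_) h3.le
  intro x (hx : t n < f n x)
  exact hx.le

/-- Convergence in distribution is not affected by changes on sets of vanishing probability. -/
theorem tendstoInDistribution_of_tendsto_measure_ne {α α' : Type*} {mα : MeasurableSpace α}
    {mα' : MeasurableSpace α'} {μ : Measure α} [IsProbabilityMeasure μ] {μ' : Measure α'}
    [IsProbabilityMeasure μ'] {X Y : ℕ → α → EReal} {Z : α' → EReal}
    (hX : TendstoInDistribution X atTop Z (fun _ => μ) μ') (hXm : ∀ n, Measurable (X n))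
    (hYm : ∀ n, Measurable (Y n))
    (hne : Tendsto (fun n => μ.real {x | Y n x ≠ X n x}) atTop (𝓝 0)) :
    TendstoInDistribution Y atTop Z (fun _ => μ) μ' := by
  refine ⟨fun n => (hYm n).aemeasurable, hX.aemeasurable_limit, ?_⟩
  refine ProbabilityMeasure.tendsto_iff_forall_integral_tendsto.2 fun f => ?_
  have h2 := ProbabilityMeasure.tendsto_iff_forall_integral_tendsto.1 hX.tendsto f
  simp only [ProbabilityMeasure.coe_mk] at h2 ⊢
  have hfm : Measurable f := f.continuous.measurable
  have key : Tendsto (fun n => ∫ x, f x ∂(μ.map (Y n)) - ∫ x, f x ∂(μ.map (X n))) atTop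
      (𝓝 0) := by
    have h3 : Tendsto (fun n => 2 * ‖f‖ * μ.real {x | Y n x ≠ X n x}) atTop (𝓝 0) := by
      simpa using hne.const_mul (2 * ‖f‖)
    refine squeeze_zero_norm (fun n => ?_) h3
    have hS : MeasurableSet {x | Y n x ≠ X n x} :=
      (measurableSet_eq_fun (hYm n) (hXm n)).compl
    have iY : Integrable (fun x => f (Y n x)) μ :=
      Integrable.of_bound (hfm.comp (hYm n)).aestronglyMeasurable ‖f‖
        (.of_forall fun x => f.norm_coe_le_norm _)
    have iX : Integrable (fun x => f (X n x)) μ :=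
      Integrable.of_bound (hfm.comp (hXm n)).aestronglyMeasurable ‖f‖
        (.of_forall fun x => f.norm_coe_le_norm _)
    rw [integral_map (hYm n).aemeasurable hfm.aestronglyMeasurable,
      integral_map (hXm n).aemeasurable hfm.aestronglyMeasurable, ← integral_sub iY iX]
    calc ‖∫ x, (f (Y n x) - f (X n x)) ∂μ‖
        ≤ ∫ x, {x | Y n x ≠ X n x}.indicator (fun _ => 2 * ‖f‖) x ∂μ := by
          refine norm_integral_le_of_norm_le ((integrable_const _).indicator hS)
            (.of_forall fun x => ?_)
          by_cases hx : Y n x = X n x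
          · rw [hx, sub_self, norm_zero]
            exact Set.indicator_nonneg (fun _ _ => by positivity) _
          · rw [Set.indicator_of_mem (show x ∈ {x | Y n x ≠ X n x} from hx)]
            refine (norm_sub_le _ _).trans ?_
            have h4 := f.norm_coe_le_norm (Y n x)
            have h5 := f.norm_coe_le_norm (X n x)
            linarith
      _ = 2 * ‖f‖ * μ.real {x | Y n x ≠ X n x} := by
          rw [integral_indicator hS, setIntegral_const, smul_eq_mul, mul_comm]
  simpa using key.add h2

end Limits

/-! ### Approximation of the statistic in probability -/

section Approximation

theorem expTailMean_le (m r : ℕ) : expTailMean m r ≤ 1 + Real.log m := by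
  refine le_trans ?_ (harmonic_le_one_add_log m)
  rw [expTailMean, harmonic]
  push_cast
  refine (Finset.sum_le_sum_of_subset_of_nonneg (fun l hl => ?_) fun l _ _ => ?_).trans
    (le_of_eq (Finset.sum_congr rfl fun l _ => one_div _))
  · exact Finset.mem_range.2 (Finset.mem_Ico.1 hl).2
  · positivity

/-- The harmonic part is at most 1 + log m, so the coefficient is at most 1 + log(m p), and m p → 0.
-/
theorem tendsto_aCoef {m : ℕ → ℕ} (hm : Tendsto m atTop atTop) {p : ℕ → ℝ} (hp : ∀ n, 0 < p n)
    (hmp : Tendsto (fun n => (m n : ℝ) * p n) atTop (𝓝 0)) (r : ℕ) :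
    Tendsto (fun n => aCoef (m n) r (p n)) atTop atBot := by
  have h0 : ∀ᶠ n in atTop, 0 < m n := hm.eventually_gt_atTop 0
  have h1 : Tendsto (fun n => (m n : ℝ) * p n) atTop (𝓝[>] 0) :=
    tendsto_nhdsWithin_iff.2 ⟨hmp, h0.mono fun n hn =>
      mul_pos (Nat.cast_pos.2 hn) (hp n)⟩
  refine tendsto_atBot_mono' _ ?_
    (tendsto_atBot_add_const_left _ 1 (Real.tendsto_log_nhdsGT_zero.comp h1))
  filter_upwards [h0] with n hn
  rw [aCoef_eq, Function.comp_apply,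
    Real.log_mul (Nat.cast_pos.2 hn).ne' (hp n).ne']
  linarith [expTailMean_le (m n) r]

theorem remainderBound_nonneg {C A : ℝ} (hC : 0 ≤ C) (hA : 0 ≤ A) (s m r : ℕ) (g : ℕ × ℕ → ℝ)
    (i : ℕ) : 0 ≤ remainderBound C A s m r g i :=
  Finset.sum_nonneg fun _ _ => by positivity

theorem le_remainderBound {C A : ℝ} (hC : 0 ≤ C) (hA : 0 ≤ A) (s m : ℕ) {r j : ℕ} (hj : j ≤ r)
    (g : ℕ × ℕ → ℝ) (i : ℕ) :
    C * A * (1 + Real.exp (s * (Real.log m - expTail m g i j))) ≤ remainderBound C A s m r g i :=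
  Finset.single_le_sum (f := fun j => C * A * (1 + Real.exp (s * (Real.log m - expTail m g i j))))
    (fun _ _ => by positivity) (Finset.mem_range.2 (Nat.lt_succ_of_le hj))

theorem tendsto_div_of_isLittleO_rpow {k : ℕ → ℕ} (hk : Tendsto k atTop atTop) {a : ℕ → ℝ}
    (ha : a =o[atTop] fun n => (k n : ℝ) ^ (2 / 3 : ℝ)) (r : ℕ) :
    Tendsto (fun n => a n / ((k n : ℝ) * r)) atTop (𝓝 0) := by
  have h1 : (fun n => (k n : ℝ) ^ (2 / 3 : ℝ)) =O[atTop] fun n => (k n : ℝ) := by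
    refine Asymptotics.IsBigO.of_bound 1 ?_
    filter_upwards [hk.eventually_ge_atTop 1] with n hn
    have hn' : (1 : ℝ) ≤ k n := by exact_mod_cast hn
    rw [Real.norm_of_nonneg (by positivity), Real.norm_of_nonneg (by positivity), one_mul]
    calc (k n : ℝ) ^ (2 / 3 : ℝ) ≤ (k n : ℝ) ^ (1 : ℝ) :=
          Real.rpow_le_rpow_of_exponent_le hn' (by norm_num)
      _ = k n := Real.rpow_one _
  have h2 := (ha.trans_isBigO h1).tendsto_div_nhds_zero.div_const (r : ℝ)
  simpa only [div_div, zero_div] using h2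

/-- A union bound in which A₁, where the normalized sum is large, keeps a fixed small probability,
while A₀ is null and the others vanish in the limit. -/
theorem measureReal_lt_of_subset {α : Type*} [MeasurableSpace α] {μ : Measure α}
    [IsProbabilityMeasure μ] {S A₀ A₁ A₂ A₃ A₄ A₅ A₆ : Set α} {δ : ℝ} (hδ : 0 < δ)
    (h₀ : μ.real A₀ = 0) (h₁ : μ.real A₁ ≤ δ / 4)
    (h₂ : μ.real A₂ + μ.real A₃ + μ.real A₄ + μ.real A₅ + μ.real A₆ < δ / 2)
    (hS : ∀ x, x ∉ A₀ → x ∉ A₁ → x ∉ A₂ → x ∉ A₃ → x ∉ A₄ → x ∉ A₅ → x ∉ A₆ → x ∉ S) :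
    μ.real S < δ := by
  have hsub : S ⊆ A₀ ∪ A₁ ∪ A₂ ∪ A₃ ∪ A₄ ∪ A₅ ∪ A₆ := by
    intro x hx
    by_contra h
    simp only [Set.mem_union, not_or] at h
    obtain ⟨⟨⟨⟨⟨⟨a0, a1⟩, a2⟩, a3⟩, a4⟩, a5⟩, a6⟩ := h
    exact hS x a0 a1 a2 a3 a4 a5 a6 hx
  have h := measureReal_mono (μ := μ) hsub
  have e1 := measureReal_union_le (μ := μ) A₀ A₁
  have e2 := measureReal_union_le (μ := μ) (A₀ ∪ A₁) A₂
  have e3 := measureReal_union_le (μ := μ) (A₀ ∪ A₁ ∪ A₂) A₃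
  have e4 := measureReal_union_le (μ := μ) (A₀ ∪ A₁ ∪ A₂ ∪ A₃) A₄
  have e5 := measureReal_union_le (μ := μ) (A₀ ∪ A₁ ∪ A₂ ∪ A₃ ∪ A₄) A₅
  have e6 := measureReal_union_le (μ := μ) (A₀ ∪ A₁ ∪ A₂ ∪ A₃ ∪ A₄ ∪ A₅) A₆
  linarith

/-- The statistic is approximated, in probability, by the square of the normalized sum. -/
theorem tendsto_measureReal_not_approx {k m : ℕ → ℕ} {r : ℕ} (hr : 1 ≤ r)
    (hk : Tendsto k atTop atTop) (hm : Tendsto m atTop atTop) {γ c C : ℝ} (hγ : 0 < γ)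
    (hC : 0 ≤ C) {s : ℕ} {ℓ h : ℝ → ℝ} (hℓ : ∀ w, ℓ w = γ * w + c + h w) {B : ℕ → ℝ}
    (hB : ∀ n, 0 ≤ B n) (hkB : Tendsto (fun n => √(k n : ℝ) * B n) atTop (𝓝 0))
    (hh : ∀ᶠ n in atTop, ∀ w, 0 < w →
      |h w| ≤ C * B n * (1 + Real.exp (s * (Real.log (m n) - w))))
    {p : ℕ → ℝ} (hp : ∀ n, 0 < p n ∧ p n < 1)
    (hmp : Tendsto (fun n => (m n : ℝ) * p n) atTop (𝓝 0))
    {a : ℕ → ℝ} (ha : a =o[atTop] fun n => (k n : ℝ) ^ (2 / 3 : ℝ))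
    {L : ∀ n, (ℕ × ℕ → ℝ) → Fin (k n) → ℕ → ℝ}
    (hL : ∀ n g i, ∀ j < m n, L n g i j = ℓ (expTail (m n) g i j)) {τ : ℝ} (hτ : 0 < τ) :
    Tendsto (fun n => expArray.real {g | ¬ ∃ Y : ℝ,
      empLogLR (logData (k n) r (aCoef (m n) r (p n)) (a n) (ℓ (-Real.log (p n))) (L n g)) = Y ∧
        |Y - normSum (k n) r g ^ 2| < τ}) atTop (𝓝 0) := by
  have hr' : (0 : ℝ) < r := by exact_mod_cast hr
  have hkt : Tendsto (fun n => (k n : ℝ)) atTop atTop := tendsto_natCast_atTop_atTop.comp hk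
  have hα := tendsto_aCoef hm (fun n => (hp n).1) hmp r
  have hα2 : Tendsto (fun n => (aCoef (m n) r (p n) ^ 2)⁻¹) atTop (𝓝 0) := by
    have h1 : Tendsto (fun n => |aCoef (m n) r (p n)| ^ 2) atTop atTop :=
      (tendsto_pow_atTop two_ne_zero).comp (tendsto_abs_atBot_atTop.comp hα)
    refine h1.inv_tendsto_atTop.congr fun n => ?_
    rw [Pi.inv_apply, sq_abs]
  have hkinv : Tendsto (fun n => (k n : ℝ)⁻¹) atTop (𝓝 0) := hkt.inv_tendsto_atTop
  have ek : ∀ᶠ n in atTop, 0 < k n := hk.eventually_gt_atTop 0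
  have em : ∀ᶠ n in atTop, r < m n := hm.eventually_gt_atTop r
  have eα : ∀ᶠ n in atTop, aCoef (m n) r (p n) ≤ -1 := hα.eventually_le_atBot (-1)
  have emp : ∀ᶠ n in atTop, (m n : ℝ) * p n < 1 := hmp.eventually_lt_const one_pos
  refine tendsto_order.2 ⟨fun b hb => .of_forall fun n => hb.trans_le measureReal_nonneg,
    fun δ hδ => ?_⟩
  -- The normalized sum has second moment at most 1, so by Markov's inequality its modulus reaches β
  -- - 1 with probability at most δ/4. The accuracy η is chosen after β.
  obtain ⟨β, hβ1, hβδ⟩ : ∃ β : ℝ, 1 < β ∧ (β - 1) ^ 2 = 4 / δ :=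
    ⟨1 + √(4 / δ), by have := Real.sqrt_pos.2 (div_pos four_pos hδ); linarith, by
      rw [add_sub_cancel_left, Real.sq_sqrt (div_pos four_pos hδ).le]⟩
  have hβ0 : 0 < β := by linarith
  obtain ⟨η, hη, hη1, hη2⟩ : ∃ η : ℝ, 0 < η ∧ 96 * β ^ 2 * η ≤ 1 ∧ 4000 * β ^ 4 * η < τ := by
    refine ⟨min (1 / (96 * β ^ 2)) (τ / (8000 * β ^ 4)), by positivity, ?_, ?_⟩
    · calc _ ≤ 96 * β ^ 2 * (1 / (96 * β ^ 2)) := by gcongr; exact min_le_left _ _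
        _ = 1 := mul_one_div_cancel (by positivity)
    · calc _ ≤ 4000 * β ^ 4 * (τ / (8000 * β ^ 4)) := by gcongr; exact min_le_right _ _
        _ = τ / 2 := by field_simp; norm_num
        _ < τ := half_lt_self hτ
  have ea : ∀ᶠ n in atTop, |a n / ((k n : ℝ) * r)| < η := by
    have := (tendsto_div_of_isLittleO_rpow hk ha r).abs
    rw [abs_zero] at this
    exact this.eventually_lt_const hη
  have hkr : ∀ n, 0 < k n → (0 : ℝ) < (k n : ℝ) * r := fun n hn =>
    mul_pos (Nat.cast_pos.2 hn) hr'
  have hα0 : ∀ n, aCoef (m n) r (p n) ≤ -1 → 0 < aCoef (m n) r (p n) ^ 2 := fun n hn =>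
    sq_pos_of_neg (by linarith)
  -- Each threshold in M1 to M5 is the corresponding condition of `empLogLR_logData_approx`. The
  -- Markov ratios are of order 1/α² for M1 and M2, √k B for M3, and 1/k for M4 and M5.
  have M1 := tendsto_measureReal_lt_of_integral_le (μ := expArray)
    (f := fun n g => (∑ i : Fin (k n), (expTail (m n) g i r - expTailMean (m n) r)) ^ 2)
    (t := fun n => (η / 2) ^ 2 * ((k n : ℝ) * r) * aCoef (m n) r (p n) ^ 2 / (r : ℝ) ^ 2)
    (e := fun n => 2 * k n) (fun n g => sq_nonneg _)
    (.of_forall fun n => integral_sum_expTail_sq (k n) r (m n))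
    (by
      filter_upwards [ek, eα] with n h1 h2
      have := hkr n h1
      have := hα0 n h2
      positivity)
    (by
      have h1 := hα2.const_mul (8 * (r : ℝ) / η ^ 2)
      rw [mul_zero] at h1
      refine h1.congr' ?_
      filter_upwards [ek, eα] with n h1 h2
      have h3 : (0 : ℝ) < k n := Nat.cast_pos.2 h1
      have h4 := hα0 n h2
      field_simp
      norm_num)
  have M2 := tendsto_measureReal_lt_of_integral_le (μ := expArray)
    (f := fun n g => ∑ i : Fin (k n), (expTail (m n) g i r - expTailMean (m n) r) ^ 2)
    (t := fun n => η ^ 2 / 2 * ((k n : ℝ) * r) * aCoef (m n) r (p n) ^ 2 / (2 * r))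
    (e := fun n => 2 * k n) (fun n g => Finset.sum_nonneg fun _ _ => sq_nonneg _)
    (.of_forall fun n => integral_sum_sq_expTail (k n) r (m n))
    (by
      filter_upwards [ek, eα] with n h1 h2
      have := hkr n h1
      have := hα0 n h2
      positivity)
    (by
      have h1 := hα2.const_mul (8 / η ^ 2)
      rw [mul_zero] at h1
      refine h1.congr' ?_
      filter_upwards [ek, eα] with n h1 h2
      have h3 : (0 : ℝ) < k n := Nat.cast_pos.2 h1
      have h4 := hα0 n h2
      field_simp
      norm_num)
  have M3 := tendsto_measureReal_lt_of_integral_le (μ := expArray)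
    (f := fun n g => ∑ i : Fin (k n), remainderBound C (B n) s (m n) r g i)
    (t := fun n => γ * (η / 2) * √((k n : ℝ) * r) / (r * (2 * r + 3)))
    (e := fun n => k n * ((r + 1) * (C * B n * (1 + ((r : ℝ) + 1 + s) ^ s))))
    (fun n g => Finset.sum_nonneg fun _ _ => remainderBound_nonneg hC (hB n) _ _ _ _ _)
    (em.mono fun n hn => integral_sum_remainderBound hC (hB n) s (k n) hn)
    (by
      filter_upwards [ek] with n h1
      have := Real.sqrt_pos.2 (hkr n h1)
      positivity)
    (by
      have h1 := hkB.const_mul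
        ((r + 1) * (C * (1 + ((r : ℝ) + 1 + s) ^ s)) * (r * (2 * r + 3)) / (γ * (η / 2) * √(r : ℝ)))
      rw [mul_zero] at h1
      refine h1.congr' ?_
      filter_upwards [ek] with n h1
      have h3 : (0 : ℝ) < √(k n : ℝ) := Real.sqrt_pos.2 (Nat.cast_pos.2 h1)
      have h4 : (0 : ℝ) < √(r : ℝ) := Real.sqrt_pos.2 hr'
      have h5 : (k n : ℝ) = √(k n : ℝ) ^ 2 := (Real.sq_sqrt (Nat.cast_nonneg _)).symm
      rw [Real.sqrt_mul (Nat.cast_nonneg _)]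
      conv_rhs => rw [h5, Real.sqrt_sq h3.le]
      generalize 1 + ((r : ℝ) + 1 + s) ^ s = D
      field_simp)
  have M4 := tendsto_measureReal_lt_of_integral_le (μ := expArray)
    (f := fun n g => (∑ s : Fin (k n) × Fin r, ((g (s.1, s.2) - 1) ^ 2 - 1)) ^ 2)
    (t := fun n => η ^ 2 * ((k n : ℝ) * r) ^ 2)
    (e := fun n => 8 * ((k n : ℝ) * r)) (fun n g => sq_nonneg _)
    (.of_forall fun n => integral_sum_centered_sq (k n) r)
    (by
      filter_upwards [ek] with n h1
      have := hkr n h1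
      positivity)
    (by
      have h1 := hkinv.const_mul (8 / (η ^ 2 * r))
      rw [mul_zero] at h1
      refine h1.congr' ?_
      filter_upwards [ek] with n h1
      have h3 : (0 : ℝ) < k n := Nat.cast_pos.2 h1
      field_simp)
  have M5 := tendsto_measureReal_lt_of_integral_le (μ := expArray)
    (f := fun n g => ∑ s : Fin (k n) × Fin r, (g (s.1, s.2) - 1) ^ 4)
    (t := fun n => η ^ 4 * ((k n : ℝ) * r) ^ 2)
    (e := fun n => 9 * ((k n : ℝ) * r))
    (fun n g => Finset.sum_nonneg fun _ _ => by positivity)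
    (.of_forall fun n => integral_sum_pow_four (k n) r)
    (by
      filter_upwards [ek] with n h1
      have := hkr n h1
      positivity)
    (by
      have h1 := hkinv.const_mul (9 / (η ^ 4 * r))
      rw [mul_zero] at h1
      refine h1.congr' ?_
      filter_upwards [ek] with n h1
      have h3 : (0 : ℝ) < k n := Nat.cast_pos.2 h1
      field_simp)
  have M := (((M1.add M2).add M3).add M4).add M5
  simp only [add_zero] at M
  filter_upwards [ek, em, eα, emp, ea, hh, M.eventually_lt_const (half_pos hδ)] with n hkn hmn hαn
    hmpn han hhn hMn
  have hN : expArray.real {g | ¬ ∀ s, 0 < g s} = 0 :=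
    (measureReal_eq_zero_iff).2 (ae_iff.1 ae_pos_expArray)
  have hW : expArray.real {g | 4 / δ ≤ normSum (k n) r g ^ 2} ≤ δ / 4 := by
    have h1 := (mul_meas_ge_le_integral_of_nonneg (.of_forall fun g => sq_nonneg _)
      (integral_normSum_sq_le (k n) r).1 (4 / δ)).trans (integral_normSum_sq_le (k n) r).2
    rwa [div_mul_eq_mul_div, div_le_one hδ, ← le_div_iff₀' four_pos] at h1
  refine measureReal_lt_of_subset hδ hN hW hMn fun g g0 g1 g2 g3 g4 g5 g6 => ?_
  simp only [Set.mem_ofPred_eq, not_not, not_le, not_lt] at g0 g1 g2 g3 g4 g5 g6 ⊢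
  have hm0 : (0 : ℝ) < m n := Nat.cast_pos.2 (by omega)
  have hrem : ∀ i, C * B n ≤ remainderBound C (B n) s (m n) r g i := fun i =>
    le_trans (le_mul_of_one_le_right (mul_nonneg hC (hB n))
      (le_add_of_nonneg_right (Real.exp_pos _).le)) (le_remainderBound hC (hB n) s _ le_rfl g i)
  obtain ⟨Y, hY1, hY2⟩ := empLogLR_logData_approx (c := c) hkn hr hmn hγ hℓ (p := p n) rfl
    (by rw [abs_of_neg (by linarith)]; linarith) g (hL n g)
    (H := remainderBound C (B n) s (m n) r g)
    (fun i _ j hj => (hhn _ (expTail_pos (by omega) g0 i)).trans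
      (le_remainderBound hC (hB n) s _ hj g i))
    -- Since m p < 1, the point -log p lies to the right of log m; the exponential is then at most 1
    -- and the remainder at the quantile is at most 2 C B.
    (fun i _ => by
      refine (hhn _ (neg_pos.2 (Real.log_neg (hp n).1 (hp n).2))).trans ?_
      have h1 : Real.exp (s * (Real.log (m n) - -Real.log (p n))) ≤ 1 := by
        rw [Real.exp_le_one_iff, sub_neg_eq_add, ← Real.log_mul hm0.ne' (hp n).1.ne']
        exact mul_nonpos_of_nonneg_of_nonpos (Nat.cast_nonneg _)
          (Real.log_nonpos (mul_pos hm0 (hp n).1).le hmpn.le)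
      have h2 := mul_le_mul_of_nonneg_left h1 (mul_nonneg hC (hB n))
      linarith [hrem i])
    hη (β := β)
    (by
      rw [← hβδ] at g1
      have := abs_lt_of_sq_lt_sq g1 (by linarith)
      rw [normSum] at this
      linarith)
    hη1 han.le
    (by rwa [le_div_iff₀' (by positivity)] at g2)
    (by rwa [le_div_iff₀' (by positivity)] at g3)
    (by rwa [le_div_iff₀' (by positivity)] at g4)
    g5 g6
  exact ⟨Y, hY1, hY2.trans_lt hη2⟩

end Approximation

/-! ### Transfer of limit laws to the extended reals and between probability spaces -/

section LimitLaw

/-- Slutsky's argument needs a difference, so it is applied to the real parts. The limit is then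
carried along the continuous inclusion of ℝ, and the event of an infinite value, which has vanishing
probability, is restored last. -/
theorem tendstoInDistribution_of_approx {α α' : Type*} {mα : MeasurableSpace α}
    {mα' : MeasurableSpace α'} {μ : Measure α} [IsProbabilityMeasure μ] {μ' : Measure α'}
    [IsProbabilityMeasure μ'] {S : ℕ → α → EReal} {V : ℕ → α → ℝ} {Z : α' → ℝ}
    (hS : ∀ n, Measurable (S n)) (hV : TendstoInDistribution V atTop Z (fun _ => μ) μ')
    (h : ∀ τ : ℝ, 0 < τ → Tendsto (fun n => μ.real {x | ¬ ∃ Y : ℝ, S n x = Y ∧ |Y - V n x| < τ})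
      atTop (𝓝 0)) :
    TendstoInDistribution S atTop (fun x => (Z x : EReal)) (fun _ => μ) μ' := by
  have hT : ∀ n, Measurable fun x => (S n x).toReal := fun n => (hS n).ereal_toReal
  have h1 : TendstoInDistribution (fun n x => (S n x).toReal) atTop Z (fun _ => μ) μ' := by
    refine tendstoInDistribution_of_tendstoInMeasure_sub _ Z hV ?_ fun n => (hT n).aemeasurable
    rw [tendstoInMeasure_iff_measureReal_norm]
    intro τ hτ
    refine squeeze_zero (fun n => measureReal_nonneg) (fun n => measureReal_mono ?_) (h τ hτ)
    rintro x (hx : τ ≤ ‖(S n x).toReal - V n x - 0‖) ⟨Y, hY1, hY2⟩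
    rw [hY1, EReal.toReal_coe, sub_zero, Real.norm_eq_abs] at hx
    linarith
  have h2 := h1.continuous_comp continuous_coe_real_ereal
  refine tendstoInDistribution_of_tendsto_measure_ne h2
    (fun n => measurable_coe_real_ereal.comp (hT n)) hS ?_
  refine squeeze_zero (fun n => measureReal_nonneg) (fun n => measureReal_mono ?_) (h 1 one_pos)
  rintro x (hx : S n x ≠ _) ⟨Y, hY1, hY2⟩
  exact hx (by simp [hY1])

theorem TendstoInDistribution.congr_map {α α' β β' E : Type*} {mα : MeasurableSpace α}
    {mα' : MeasurableSpace α'} {mβ : MeasurableSpace β} {mβ' : MeasurableSpace β'}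
    [TopologicalSpace E] [MeasurableSpace E] [OpensMeasurableSpace E]
    {μ : Measure α} [IsProbabilityMeasure μ] {μ' : Measure α'} [IsProbabilityMeasure μ']
    {ν : Measure β} [IsProbabilityMeasure ν] {ν' : Measure β'} [IsProbabilityMeasure ν']
    {X : ℕ → α → E} {Z : α' → E} {Y : ℕ → β → E} {T : β' → E}
    (h : TendstoInDistribution X atTop Z (fun _ => μ) μ') (hY : ∀ n, AEMeasurable (Y n) ν)
    (hT : AEMeasurable T ν') (hXY : ∀ n, ν.map (Y n) = μ.map (X n)) (hZT : ν'.map T = μ'.map Z) :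
    TendstoInDistribution Y atTop T (fun _ => ν) ν' := by
  refine ⟨hY, hT, ?_⟩
  have := h.tendsto
  simpa only [hXY, hZT] using this

theorem tailQuantile_exp_neg_log (F : ℝ → ℝ) {p : ℝ} (hp : 0 < p) :
    tailQuantile F (Real.exp (-Real.log p)) = highQuantile F p := by
  rw [tailQuantile, highQuantile, Real.exp_neg, Real.exp_log hp, one_div, inv_inv]

end LimitLaw

end BlockQuantile

/-! ### The limit law of the adjusted statistic -/

theorem theorem6
    {Ω : Type*} [MeasurableSpace Ω] (P : Measure Ω) [IsProbabilityMeasure P]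
    -- an i.i.d. sample from `F`, with values at least `1`
    (X : ℕ → Ω → ℝ) (F : ℝ → ℝ)
    (hXmeas : ∀ i, Measurable (X i))
    (hXindep : iIndepFun X P)
    (hXF : ∀ i x, F x = P.real {ω | X i ω ≤ x})
    (hX1 : ∀ i, ∀ᵐ ω ∂P, 1 ≤ X i ω)
    -- the second-order condition
    (γ ρ : ℝ) (hγ : 0 < γ) (hρ : ρ < 0) (A : ℝ → ℝ)
    (hU : BlockQuantile.SecondOrder F γ ρ A)
    -- `k n` blocks of `m n = [n / k n]` observations, of which the `r + 1` largest are used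
    (r : ℕ) (hr : 1 ≤ r) (k m : ℕ → ℕ) (hm : ∀ n, m n = n / k n)
    (hk_top : Tendsto k atTop atTop) (hm_top : Tendsto m atTop atTop)
    (hA : Tendsto (fun n => Real.sqrt (k n) * A (m n)) atTop (𝓝 0))
    -- the level of the high quantile
    (p : ℕ → ℝ) (hp : ∀ n, 0 < p n ∧ p n < 1)
    (hmp : Tendsto (fun n => (m n : ℝ) * p n) atTop (𝓝 0))
    (hlog : (fun n => Real.log ((m n : ℝ) * p n)) =o[atTop] fun n => Real.sqrt (k n))
    -- the correction factors
    (a : ℕ → ℝ) (ha : a =o[atTop] fun n => (k n : ℝ) ^ (2 / 3 : ℝ)) :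
    TendstoInDistribution
      (fun n ω => BlockQuantile.adjustedLogLR (fun i => X i ω) (k n) (m n) r (p n) (a n)
        (Real.log (BlockQuantile.highQuantile F (p n))))
      atTop (fun t : ℝ => (t : EReal)) (fun _ => P) BlockQuantile.chiSqOne := by
  set μ : Measure ℝ := P.map (X 0) with hμdef
  have : IsProbabilityMeasure μ := Measure.isProbabilityMeasure_map (hXmeas 0).aemeasurable
  have hprob : ∀ i, IsProbabilityMeasure (P.map (X i)) := fun i =>
    Measure.isProbabilityMeasure_map (hXmeas i).aemeasurable
  have hcdf : ∀ i x, cdf (P.map (X i)) x = F x := fun i x => by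
    rw [cdf_eq_real, hXF i, map_measureReal_apply (hXmeas i) measurableSet_Iic]
    rfl
  have hmap : ∀ i, P.map (X i) = μ := fun i =>
    Measure.eq_of_cdf _ _ (StieltjesFunction.ext fun x => by rw [hcdf, hcdf])
  have hF : F = cdf μ := funext fun x => (hcdf 0 x).symm
  have hμ1 : μ (Set.Iio 1) = 0 := by
    rw [hμdef, Measure.map_apply (hXmeas 0) measurableSet_Iio, measure_eq_zero_iff_ae_notMem]
    filter_upwards [hX1 0] with ω hω h
    exact absurd hω (not_le.2 h)
  subst hF
  obtain ⟨c, s, C, V, hC, hexp⟩ := BlockQuantile.SecondOrder.exists_expansion hμ1 hρ hU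
  have hq := BlockQuantile.monotone_tailQuantile_exp hμ1
  have hqμ := BlockQuantile.map_expMeasure_tailQuantile hμ1
  set q : ℝ → ℝ := fun w => BlockQuantile.tailQuantile (cdf μ) (Real.exp w) with hqdef
  have hlaw := fun n => BlockQuantile.map_adjustedLogLR hXmeas hXindep hmap hq hqμ (k n) (m n) r
    (p n) (a n) (Real.log (BlockQuantile.highQuantile (cdf μ) (p n)))
  have hlim := BlockQuantile.tendstoInDistribution_of_approx (fun n => (hlaw n).2.1)
    ((BlockQuantile.tendstoInDistribution_normSum hk_top hr).continuous_comp
      (continuous_pow 2)) fun τ hτ => ?_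
  · refine BlockQuantile.TendstoInDistribution.congr_map hlim (fun n => (hlaw n).1.aemeasurable)
      measurable_coe_real_ereal.aemeasurable (fun n => (hlaw n).2.2) ?_
    rw [BlockQuantile.chiSqOne, Measure.map_map measurable_coe_real_ereal (by fun_prop)]
    rfl
  have h := BlockQuantile.tendsto_measureReal_not_approx hr hk_top hm_top hγ hC (s := s)
    (ℓ := fun w => Real.log (q w)) (h := fun w => Real.log (q w) - γ * w - c) (c := c)
    (fun w => by ring) (B := fun n => |A (m n)|) (fun n => abs_nonneg _) ?_ ?_ hp hmp ha
    (L := fun n g i => BlockQuantile.extLog fun j : Fin (m n) =>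
      q (BlockQuantile.expTail (m n) g i j))
    (fun n g i j hj => by simp only [BlockQuantile.extLog, dif_pos hj]) hτ
  · simpa only [hqdef, Function.comp_apply, BlockQuantile.tailQuantile_exp_neg_log _ (hp _).1] using h
  · simpa only [abs_mul, abs_of_nonneg (Real.sqrt_nonneg _), abs_zero] using hA.abs
  -- The expansion is used at the base point v = log m, where A (exp v) = A m.
  · filter_upwards [hm_top.eventually_gt_atTop 0,
      (Real.tendsto_log_atTop.comp (tendsto_natCast_atTop_atTop.comp hm_top)).eventually_ge_atTop V]
      with n hn hV w hw
    have h1 := hexp _ hV w hw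
    simpa only [Function.comp_apply, Real.exp_log (Nat.cast_pos.2 hn)] using h1
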